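/- **Theorem.** Let $\omega_n=e^{2\pi i/n}$ and $\Lambda_{\omega_6}=\mathbb Z\oplus\mathbb Z\omega_6$. Let $\Lambda\subset\mathbb C$ be a lattice such that the torus $T=\mathbb C/\Lambda$ is isomorphic, as a Riemann surface, to $T_{\omega_6}=\mathbb C/\Lambda_{\omega_6}$. Let $$\rho:A_4\to\mathrm{Aut}(\mathfrak{sl}_2(\mathbb C)),\qquad \sigma:A_4\to\mathrm{Aut}(T)$$ be injective homomorphisms into the group of Lie algebra automorphisms and the group of biholomorphisms, and assume that some $\gamma\neq1$ in $A_4$ satisfies $\sigma(\gamma)(0)=0$ (equivalently, $\sigma(A_4)=C_3\ltimes(C_2\times C_2)$ with $C_3$ fixing the origin and $C_2\times C_2$ acting by translations). Let $\mathbb T=T\setminus A_4\cdot\{0\}$, let $\mathcal O_{\mathbb T}$ be the algebra of holomorphic functions on $\mathbb T$ that are meromorphic at the punctures, let $\tilde\sigma(\gamma)f=f\circ\sigma(\gamma)^{-1}$, and let $\mathfrak A=(\mathfrak{sl}_2\otimes_{\mathbb C}\mathcal O_{\mathbb T})^{\rho\otimes\tilde\sigma(A_4)}$ be the Lie algebra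 of invariants of the diagonal action. Then: 1. $\mathfrak A$ is isomorphic, as a complex Lie algebra, to the Onsager algebra $\mathfrak O$, that is, to the Lie algebra with basis $A_k$ $(k\in\mathbb Z)$, $G_m$ $(m\ge1)$ and brackets $[A_k,A_l]=4G_{k-l}$, $[A_k,G_m]=2(A_{k-m}-A_{k+m})$, $[G_m,G_n]=0$, where $G_{-m}=-G_m$ and $G_0=0$. 2. There is $u\in\mathbb C^*$ with $\Lambda=u\Lambda_{\omega_6}$, and for each such $u$ the following holds. Write $\wp=\wp_\Lambda$, $e_1=\wp(\tfrac u2)$, $e_2=\wp(\tfrac{\omega_6u}2)$, $e_3=\wp(\tfrac{(1+\omega_6)u}2)$, $\beta_2=\frac{4}{(e_1-e_3)(e_2-e_3)^2}$, $\kappa=-i\omega_3^2\beta_2$. For a function $F$ of $z$ let $r_1F(z)=F(z-\tfrac u2)$, $r_2F(z)=F(z-\tfrac{\omega_6u}2)$, and put $$p_0=(1-r_1-r_2+r_1r_2)\tfrac1{\wp'},\quad p_1=(1-r_1+r_2-r_1r_2)\tfrac1{\wp'},\quad p_2=(1+r_1-r_2-r_1r_2)\tfrac1{\wp'} .$$ Then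 $p_0,p_1,p_2,\wp_{\frac12\Lambda},\wp'_{\frac12\Lambda}\in\mathcal O_{\mathbb T}$. In $\mathfrak{sl}_2\otimes\mathcal O_{\mathbb T}$, with the standard basis $h,e,f$ of $\mathfrak{sl}_2$, put $$\Psi h=\tfrac1\kappa\big(h\otimes p_0p_1+e\otimes(ip_0+p_1)p_2+f\otimes(-ip_0+p_1)p_2\big),$$ $$\Psi e=-h\otimes p_2-e\otimes(i\omega_3^2p_1+\omega_3p_0)+f\otimes(i\omega_3^2p_1-\omega_3p_0),$$ $$\Psi f=\tfrac1{4\kappa^2}\big(-h\otimes(p_0^2+p_1^2)p_2+e\otimes(ip_0+p_1)(p_0p_1-\kappa)+f\otimes(-ip_0+p_1)(p_0p_1+\kappa)\big).$$ There is $\theta\in\mathrm{Aut}(\mathfrak{sl}_2)$ such that, with $$h'=-(\theta\otimes1)\Psi h,\qquad e'=-(\theta\otimes1)\Psi f,\qquad f'=-(\theta\otimes1)\Psi e,$$ the following two statements hold. * For the normal subgroup $C_2\times C_2$ of $A_4$, $\mathcal O_{\mathbb T}^{\tilde\sigma(C_2\times C_2)}=\mathbb C[\wp_{\frac12\Lambda},\wp'_{\frac12\Lambda}]$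 and $(\mathfrak{sl}_2\otimes\mathcal O_{\mathbb T})^{\rho\otimes\tilde\sigma(C_2\times C_2)}=\mathbb C\langle h',e',f'\rangle\otimes_{\mathbb C}\mathbb C[\wp_{\frac12\Lambda},\wp'_{\frac12\Lambda}]$, with $[h',e']=2e'$, $[h',f']=-2f'$, $[e',f']=h'$. * $\mathcal O_{\mathbb T}^{\tilde\sigma(A_4)}=\mathbb C[\wp'_{\frac12\Lambda}]$ and $$\mathfrak A=\mathbb C\langle e'\otimes\wp_{\frac12\Lambda},\ f'\otimes\wp_{\frac12\Lambda}^2,\ h'\rangle\otimes_{\mathbb C}\mathbb C[\wp'_{\frac12\Lambda}],$$ and this is a normal form: with $E=e'\otimes\wp_{\frac12\Lambda}$, $F=f'\otimes\wp_{\frac12\Lambda}^2$, $H=h'$, one has $[H,E]=2E$, $[H,F]=-2F$, $[E,F]=H\otimes\wp_{\frac12\Lambda}^3$ with $\wp_{\frac12\Lambda}^3\in\mathbb C[\wp'_{\frac12\Lambda}]$. Here $V\otimes_{\mathbb C}R$ means that the listed generators form a basis of a free $R$-module. -/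

import Mathlib

open scoped Topology TensorProduct

noncomputable section

/-! ### The Onsager algebra -/

/-- The underlying space of the Onsager algebra: complex basis `A k` (`k ∈ ℤ`, left summand of the
index type) and `G m` (`m ≥ 1`, right summand). -/
def OnsagerAlgebra : Type := (ℤ ⊕ ℕ+) →₀ ℂ

namespace OnsagerAlgebra

instance : AddCommGroup OnsagerAlgebra := inferInstanceAs (AddCommGroup ((ℤ ⊕ ℕ+) →₀ ℂ))
instance : Module ℂ OnsagerAlgebra := inferInstanceAs (Module ℂ ((ℤ ⊕ ℕ+) →₀ ℂ))

/-- The basis vectors `A k`. -/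
def A (k : ℤ) : OnsagerAlgebra := Finsupp.single (Sum.inl k) (1 : ℂ)

/-- The vectors `G m` for all integers `m`, where `G 0 = 0` and `G (-m) = - G m`. -/
def G : ℤ → OnsagerAlgebra
  | Int.ofNat 0 => 0
  | Int.ofNat (n + 1) => Finsupp.single (Sum.inr n.succPNat) (1 : ℂ)
  | Int.negSucc n => - Finsupp.single (Sum.inr n.succPNat) (1 : ℂ)

/-- The brackets of the basis vectors:
`[A k, A l] = 4 G (k - l)`, `[A k, G m] = 2 (A (k - m) - A (k + m))`, `[G m, G n] = 0`. -/
def basisBracket : ℤ ⊕ ℕ+ → ℤ ⊕ ℕ+ → OnsagerAlgebra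
  | Sum.inl k, Sum.inl l => (4 : ℂ) • G (k - l)
  | Sum.inl k, Sum.inr m => (2 : ℂ) • (A (k - (m : ℤ)) - A (k + (m : ℤ)))
  | Sum.inr m, Sum.inl k => - ((2 : ℂ) • (A (k - (m : ℤ)) - A (k + (m : ℤ))))
  | Sum.inr _, Sum.inr _ => 0

/-- The bilinear extension of `basisBracket`. -/
def bracketBilin : OnsagerAlgebra →ₗ[ℂ] OnsagerAlgebra →ₗ[ℂ] OnsagerAlgebra :=
  Finsupp.linearCombination ℂ (fun i : ℤ ⊕ ℕ+ =>
    (Finsupp.linearCombination ℂ (fun j : ℤ ⊕ ℕ+ => basisBracket i j) :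
      ((ℤ ⊕ ℕ+) →₀ ℂ) →ₗ[ℂ] OnsagerAlgebra))

lemma bracket_basis (i j : ℤ ⊕ ℕ+) :
    bracketBilin (Finsupp.single i (1 : ℂ) : (ℤ ⊕ ℕ+) →₀ ℂ) (Finsupp.single j (1 : ℂ) : (ℤ ⊕ ℕ+) →₀ ℂ)
      = basisBracket i j := by
  unfold bracketBilin
  erw [Finsupp.linearCombination_single, one_smul, Finsupp.linearCombination_single, one_smul]

lemma G_natCast (m : ℕ+) : G (m : ℤ) = Finsupp.single (Sum.inr m) (1 : ℂ) := by
  obtain ⟨n, rfl⟩ : ∃ n : ℕ, m = n.succPNat := ⟨m.natPred, by simp⟩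
  rfl

lemma G_neg (m : ℤ) : G (-m) = - G m := by
  rcases m with (_ | n) | n
  · exact neg_zero.symm
  · rfl
  · exact (neg_neg _).symm

lemma induction_basis {p : OnsagerAlgebra → Prop} (h0 : p 0)
    (hadd : ∀ x y, p x → p y → p (x + y)) (hsmul : ∀ (c : ℂ) x, p x → p (c • x))
    (hA : ∀ k, p (A k)) (hG : ∀ m : ℕ+, p (G m)) (x : OnsagerAlgebra) : p x := by
  refine Finsupp.induction_linear (motive := p) x h0 hadd ?_
  intro i c
  have h : (Finsupp.single i c : (ℤ ⊕ ℕ+) →₀ ℂ) = c • Finsupp.single i (1 : ℂ) := by simp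
  rw [h]
  refine hsmul c _ ?_
  rcases i with k | m
  · exact hA k
  · have := hG m
    rwa [G_natCast] at this

lemma bracket_A_A (k l : ℤ) : bracketBilin (A k) (A l) = (4 : ℂ) • G (k - l) := by
  have h : bracketBilin (A k) (A l) = basisBracket (Sum.inl k) (Sum.inl l) := 
    bracket_basis _ _
  exact h

lemma bracket_A_G (k m : ℤ) :
    bracketBilin (A k) (G m) = (2 : ℂ) • (A (k - m) - A (k + m)) := by
  have key : ∀ m : ℕ+, bracketBilin (A k) (G m) = (2 : ℂ) • (A (k - (m : ℤ)) - A (k + (m : ℤ))) := by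
    intro m
    have h : bracketBilin (A k) (G m) = basisBracket (Sum.inl k) (Sum.inr m) := by
      rw [G_natCast]; exact bracket_basis _ _
    exact h
  rcases lt_trichotomy m 0 with h | rfl | h
  · obtain ⟨n, rfl⟩ : ∃ n : ℕ+, m = -(n : ℤ) := ⟨⟨m.natAbs, by omega⟩, by rw [PNat.mk_coe]; omega⟩
    rw [G_neg, map_neg, key, sub_neg_eq_add, ← sub_eq_add_neg, ← smul_neg, neg_sub]
  · have : G 0 = 0 := rfl
    simp [this]
  · obtain ⟨n, rfl⟩ : ∃ n : ℕ+, m = (n : ℤ) := ⟨⟨m.natAbs, by omega⟩, by rw [PNat.mk_coe]; omega⟩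
    exact key n

lemma bracket_G_A (k m : ℤ) :
    bracketBilin (G m) (A k) = - ((2 : ℂ) • (A (k - m) - A (k + m))) := by
  have key : ∀ m : ℕ+, bracketBilin (G m) (A k) =
      - ((2 : ℂ) • (A (k - (m : ℤ)) - A (k + (m : ℤ)))) := by
    intro m
    have h : bracketBilin (G m) (A k) = basisBracket (Sum.inr m) (Sum.inl k) := by
      rw [G_natCast]; exact bracket_basis _ _
    exact h
  rcases lt_trichotomy m 0 with h | rfl | h
  · obtain ⟨n, rfl⟩ : ∃ n : ℕ+, m = -(n : ℤ) := ⟨⟨m.natAbs, by omega⟩, by rw [PNat.mk_coe]; omega⟩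
    rw [G_neg, map_neg, LinearMap.neg_apply, key, sub_neg_eq_add, ← sub_eq_add_neg, ← smul_neg,
      neg_sub]
  · have : G 0 = 0 := rfl
    simp [this]
  · obtain ⟨n, rfl⟩ : ∃ n : ℕ+, m = (n : ℤ) := ⟨⟨m.natAbs, by omega⟩, by rw [PNat.mk_coe]; omega⟩
    exact key n

lemma bracket_G_G (m n : ℕ+) : bracketBilin (G m) (G n) = 0 := by
  have h : bracketBilin (G m) (G n) = basisBracket (Sum.inr m) (Sum.inr n) := by
    rw [G_natCast, G_natCast]; exact bracket_basis _ _
  exact h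

lemma bracket_G_G' (m n : ℤ) : bracketBilin (G m) (G n) = 0 := by
  have key : ∀ m : ℤ, ∃ c : ℂ, ∃ i : ℕ+, G m = c • G i := by
    intro m
    rcases lt_trichotomy m 0 with h | rfl | h
    · refine ⟨-1, ⟨m.natAbs, by omega⟩, ?_⟩
      have : m = -((⟨m.natAbs, by omega⟩ : ℕ+) : ℤ) := by
        change m = -(m.natAbs : ℤ)
        omega
      conv_lhs => rw [this]
      rw [G_neg]; simp
    · exact ⟨0, 1, by rw [zero_smul]; rfl⟩
    · refine ⟨1, ⟨m.natAbs, by omega⟩, ?_⟩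
      have : m = ((⟨m.natAbs, by omega⟩ : ℕ+) : ℤ) := by
        change m = (m.natAbs : ℤ)
        omega
      conv_lhs => rw [this]
      simp
  obtain ⟨c, i, hc⟩ := key m
  obtain ⟨d, j, hd⟩ := key n
  rw [hc, hd]
  simp [bracket_G_G]

lemma bracket_skew (x y : OnsagerAlgebra) : bracketBilin x y = - bracketBilin y x := by
  induction x using induction_basis with
  | h0 => simp
  | hadd x x' h h' => simp only [map_add, LinearMap.add_apply, h, h']; abel
  | hsmul c x h => simp only [map_smul, LinearMap.smul_apply, h, smul_neg]
  | hA k =>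
    induction y using induction_basis with
    | h0 => simp
    | hadd x x' h h' => simp only [map_add, LinearMap.add_apply, h, h']; abel
    | hsmul c x h => simp only [map_smul, LinearMap.smul_apply, h, smul_neg]
    | hA l => rw [bracket_A_A, bracket_A_A, ← neg_sub k l, G_neg, smul_neg, neg_neg]
    | hG m => rw [bracket_A_G, bracket_G_A, neg_neg]
  | hG m =>
    induction y using induction_basis with
    | h0 => simp
    | hadd x x' h h' => simp only [map_add, LinearMap.add_apply, h, h']; abel
    | hsmul c x h => simp only [map_smul, LinearMap.smul_apply, h, smul_neg]
    | hA l => rw [bracket_A_G, bracket_G_A]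
    | hG n => rw [bracket_G_G, bracket_G_G, neg_zero]

lemma bracket_jacobi (x y z : OnsagerAlgebra) :
    bracketBilin x (bracketBilin y z) =
      bracketBilin (bracketBilin x y) z + bracketBilin y (bracketBilin x z) := by
  induction x using induction_basis with
  | h0 => simp
  | hadd x x' h h' => simp only [map_add, LinearMap.add_apply, h, h']; abel
  | hsmul c x h => simp only [map_smul, LinearMap.smul_apply, h, smul_add]
  | hA k =>
    induction y using induction_basis with
    | h0 => simp
    | hadd x x' h h' => simp only [map_add, LinearMap.add_apply, h, h']; abel
    | hsmul c x h => simp only [map_smul, LinearMap.smul_apply, h, smul_add]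
    | hA l =>
      induction z using induction_basis with
      | h0 => simp
      | hadd x x' h h' => simp only [map_add, h, h']; abel
      | hsmul c x h => simp only [map_smul, h, smul_add]
      | hA m =>
        simp only [bracket_A_A, map_smul, LinearMap.smul_apply, bracket_A_G, bracket_G_A]
        rw [show k - (l - m) = m + (k - l) by ring, show k + (l - m) = l + (k - m) by ring,
          show m - (k - l) = l - (k - m) by ring]
        module
      | hG m =>
        simp only [bracket_A_A, map_smul, map_sub, LinearMap.smul_apply, bracket_A_G,
          bracket_G_G']
        rw [show k - (l - (m : ℤ)) = k + m - l by ring, show k - (l + (m : ℤ)) = k - m - l by ring,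
          show l - (k - (m : ℤ)) = -(k - m - l) by ring,
          show l - (k + (m : ℤ)) = -(k + m - l) by ring, G_neg, G_neg]
        module
    | hG l =>
      induction z using induction_basis with
      | h0 => simp
      | hadd x x' h h' => simp only [map_add, h, h']; abel
      | hsmul c x h => simp only [map_smul, h, smul_add]
      | hA m =>
        simp only [bracket_A_A, map_smul, map_sub, map_neg, LinearMap.smul_apply, bracket_A_G,
          bracket_G_G', bracket_G_A, LinearMap.sub_apply]
        rw [show k - (m - (l : ℤ)) = k + l - m by ring, show k - (m + (l : ℤ)) = k - l - m by ring]
        module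
      | hG m =>
        simp only [map_smul, map_sub, LinearMap.smul_apply, bracket_A_G,
          bracket_G_G', bracket_G_A, LinearMap.sub_apply, map_zero]
        rw [show k - (l : ℤ) - m = k - m - l by ring, show k - (l : ℤ) + m = k + m - l by ring,
          show k + (l : ℤ) - m = k - m + l by ring, show k + (l : ℤ) + m = k + m + l by ring]
        module
  | hG k =>
    induction y using induction_basis with
    | h0 => simp
    | hadd x x' h h' => simp only [map_add, LinearMap.add_apply, h, h']; abel
    | hsmul c x h => simp only [map_smul, LinearMap.smul_apply, h, smul_add]
    | hA l =>
      induction z using induction_basis with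
      | h0 => simp
      | hadd x x' h h' => simp only [map_add, h, h']; abel
      | hsmul c x h => simp only [map_smul, h, smul_add]
      | hA m =>
        simp only [bracket_A_A, map_smul, map_sub, map_neg, LinearMap.smul_apply,
          LinearMap.neg_apply, bracket_G_G', bracket_G_A, LinearMap.sub_apply]
        rw [show l - (k : ℤ) - m = l - (m + k) by ring, show l + (k : ℤ) - m = l - (m - k) by ring]
        module
      | hG m =>
        simp only [map_smul, map_sub, map_neg, LinearMap.smul_apply, bracket_A_G,
          bracket_G_G', bracket_G_A, LinearMap.sub_apply, LinearMap.neg_apply, map_zero]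
        rw [show l - (k : ℤ) - m = l - m - k by ring, show l - (k : ℤ) + m = l + m - k by ring,
          show l + (k : ℤ) - m = l - m + k by ring, show l + (k : ℤ) + m = l + m + k by ring]
        module
    | hG l =>
      induction z using induction_basis with
      | h0 => simp
      | hadd x x' h h' => simp only [map_add, h, h']; abel
      | hsmul c x h => simp only [map_smul, h, smul_add]
      | hA m =>
        simp only [map_smul, map_sub, map_neg, LinearMap.zero_apply,
          bracket_G_G', bracket_G_A, map_zero]
        rw [show m - (l : ℤ) - k = m - k - l by ring, show m - (l : ℤ) + k = m + k - l by ring,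
          show m + (l : ℤ) - k = m - k + l by ring, show m + (l : ℤ) + k = m + k + l by ring]
        module
      | hG m => simp [bracket_G_G']

instance : LieRing OnsagerAlgebra where
  bracket x y := bracketBilin x y
  add_lie x y z := by
    change bracketBilin (x + y) z = bracketBilin x z + bracketBilin y z
    simp
  lie_add x y z := by
    change bracketBilin x (y + z) = bracketBilin x y + bracketBilin x z
    simp
  lie_self x := by
    change bracketBilin x x = 0
    have h := bracket_skew x x
    have h2 : (2 : ℂ) • bracketBilin x x = 0 := by
      rw [two_smul]; nth_rewrite 1 [h]; simp
    exact (smul_eq_zero.mp h2).resolve_left two_ne_zero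
  leibniz_lie x y z := bracket_jacobi x y z

instance : LieAlgebra ℂ OnsagerAlgebra where
  lie_smul c x y := by
    change bracketBilin x (c • y) = c • bracketBilin x y
    simp

end OnsagerAlgebra

/-! ### Complex tori, their automorphisms and their regular functions -/

/-- The complex torus `ℂ / Λ`. -/
abbrev Torus (L : PeriodPair) : Type := ℂ ⧸ L.lattice

/-- The projection `ℂ → ℂ / Λ`. -/
def Torus.mk (L : PeriodPair) (z : ℂ) : Torus L := Submodule.Quotient.mk z

/-- Holomorphic maps between complex tori: since the charts of `ℂ / Λ` are the local inverses of
the projection `ℂ → ℂ / Λ`, these are the maps which locally lift to holomorphic functions. -/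
def IsHolomorphicMap (L M : PeriodPair) (φ : Torus L → Torus M) : Prop :=
  ∀ z : ℂ, ∃ g : ℂ → ℂ, AnalyticAt ℂ g z ∧ ∀ᶠ w in 𝓝 z, φ (Torus.mk L w) = Torus.mk M (g w)

/-- The tori `ℂ / Λ_L` and `ℂ / Λ_M` are isomorphic as Riemann surfaces. -/
def AreBiholomorphic (L M : PeriodPair) : Prop :=
  ∃ φ : Torus L ≃ Torus M, IsHolomorphicMap L M φ ∧ IsHolomorphicMap M L φ.symm

lemma IsHolomorphicMap.comp {L M N : PeriodPair} {ψ : Torus M → Torus N} {φ : Torus L → Torus M}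
    (hψ : IsHolomorphicMap M N ψ) (hφ : IsHolomorphicMap L M φ) :
    IsHolomorphicMap L N (ψ ∘ φ) := by
  intro z
  obtain ⟨g, hg, hgφ⟩ := hφ z
  obtain ⟨k, hk, hkψ⟩ := hψ (g z)
  refine ⟨k ∘ g, hk.comp hg, ?_⟩
  filter_upwards [hgφ, hg.continuousAt.eventually hkψ] with w h1 h2
  simp [h1, h2]

/-- `Aut(T)`: the group of biholomorphisms of the torus `T = ℂ / Λ`. -/
def TorusAut (L : PeriodPair) : Subgroup (Equiv.Perm (Torus L)) where
  carrier := {φ | IsHolomorphicMap L L φ ∧ IsHolomorphicMap L L φ.symm}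
  one_mem' := by
    have h : IsHolomorphicMap L L id := fun z =>
      ⟨id, analyticAt_id, Filter.Eventually.of_forall fun _ => rfl⟩
    exact ⟨h, h⟩
  mul_mem' := fun {a b} ha hb => ⟨ha.1.comp hb.1, hb.2.comp ha.2⟩
  inv_mem' := fun {a} ha => ⟨ha.2, ha.1⟩

/-- `𝒪_𝕋` for `𝕋 = T ∖ S`: the algebra of functions which are holomorphic on `T ∖ S` and
meromorphic at the points of the finite set `S`. The elements are functions on `T ∖ S`, so that no
values at the punctures enter. -/
def RegularFunctions (L : PeriodPair) (S : Set (Torus L)) : Subalgebra ℂ ((Sᶜ : Set _) → ℂ) where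
  carrier := {f |
    (∀ z : ℂ, Torus.mk L z ∉ S → ∃ g : ℂ → ℂ, AnalyticAt ℂ g z ∧
      ∀ᶠ w in 𝓝 z, ∀ h : Torus.mk L w ∉ S, f ⟨Torus.mk L w, h⟩ = g w) ∧
    (∀ z : ℂ, Torus.mk L z ∈ S → ∃ g : ℂ → ℂ, MeromorphicAt g z ∧
      ∀ᶠ w in 𝓝 z, ∀ h : Torus.mk L w ∉ S, f ⟨Torus.mk L w, h⟩ = g w)}
  mul_mem' := by
    rintro a b ⟨ha, ha'⟩ ⟨hb, hb'⟩
    refine ⟨fun z hz => ?_, fun z hz => ?_⟩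
    · obtain ⟨g, hg, h⟩ := ha z hz
      obtain ⟨k, hk, h'⟩ := hb z hz
      refine ⟨g * k, hg.mul hk, ?_⟩
      filter_upwards [h, h'] with w h1 h2 hw
      simp [h1 hw, h2 hw]
    · obtain ⟨g, hg, h⟩ := ha' z hz
      obtain ⟨k, hk, h'⟩ := hb' z hz
      refine ⟨g * k, hg.mul hk, ?_⟩
      filter_upwards [h, h'] with w h1 h2 hw
      simp [h1 hw, h2 hw]
  add_mem' := by
    rintro a b ⟨ha, ha'⟩ ⟨hb, hb'⟩
    refine ⟨fun z hz => ?_, fun z hz => ?_⟩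
    · obtain ⟨g, hg, h⟩ := ha z hz
      obtain ⟨k, hk, h'⟩ := hb z hz
      refine ⟨g + k, hg.add hk, ?_⟩
      filter_upwards [h, h'] with w h1 h2 hw
      simp [h1 hw, h2 hw]
    · obtain ⟨g, hg, h⟩ := ha' z hz
      obtain ⟨k, hk, h'⟩ := hb' z hz
      refine ⟨g + k, hg.add hk, ?_⟩
      filter_upwards [h, h'] with w h1 h2 hw
      simp [h1 hw, h2 hw]
  algebraMap_mem' := fun c =>
    ⟨fun z _ => ⟨fun _ => c, analyticAt_const, Filter.Eventually.of_forall fun _ _ => rfl⟩,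
      fun z _ => ⟨fun _ => c, MeromorphicAt.const c z, Filter.Eventually.of_forall fun _ _ => rfl⟩⟩

/-- The element `f` of `𝒪_𝕋` is given by the function `F` of the coordinate `z ∈ ℂ`. -/
def IsGivenBy {L : PeriodPair} {S : Set (Torus L)} (f : RegularFunctions L S) (F : ℂ → ℂ) : Prop :=
  ∀ (z : ℂ) (h : Torus.mk L z ∉ S), f.1 ⟨Torus.mk L z, h⟩ = F z

/-- The algebra endomorphism `f ↦ f ∘ φ⁻¹` of `𝒪_𝕋` induced by a biholomorphism `φ` of `T` which
preserves the set `S` of punctures. -/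
def pushFunction {L : PeriodPair} {S : Set (Torus L)} (φ : TorusAut L)
    (hφ : ∀ x, φ.1 x ∈ S ↔ x ∈ S) : RegularFunctions L S →ₐ[ℂ] RegularFunctions L S where
  toFun f := ⟨fun x => f.1 ⟨φ.1.symm x.1, fun h => x.2 (by
      have := (hφ (φ.1.symm x.1)).2 h
      rwa [Equiv.apply_symm_apply] at this)⟩, by
    have hS : ∀ x, φ.1.symm x ∈ S ↔ x ∈ S := fun x => by
      rw [← hφ, Equiv.apply_symm_apply]
    obtain ⟨f, hf, hf'⟩ := f
    refine ⟨fun z hz => ?_, fun z hz => ?_⟩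
    · obtain ⟨g, hg, hgφ⟩ := φ.2.2 z
      have e := hgφ.self_of_nhds
      obtain ⟨k, hk, hkf⟩ := hf (g z) (by rwa [← e, hS])
      refine ⟨k ∘ g, hk.comp hg, ?_⟩
      filter_upwards [hgφ, hg.continuousAt.eventually hkf] with w h1 h2 hw
      simp only [h1]
      exact h2 _
    · obtain ⟨g, hg, hgφ⟩ := φ.2.2 z
      have e := hgφ.self_of_nhds
      obtain ⟨k, hk, hkf⟩ := hf' (g z) (by rwa [← e, hS])
      refine ⟨k ∘ g, hk.comp_analyticAt hg, ?_⟩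
      filter_upwards [hgφ, hg.continuousAt.eventually hkf] with w h1 h2 hw
      simp only [h1]
      exact h2 _⟩
  map_one' := rfl
  map_mul' _ _ := rfl
  map_zero' := rfl
  map_add' _ _ := rfl
  commutes' _ := rfl

/-! ### Automorphic Lie algebras with base Lie algebra `sl₂` -/

/-- `sl₂(ℂ)`. -/
abbrev Sl2 : Type := LieAlgebra.SpecialLinear.sl (Fin 2) ℂ

/-- `Aut(sl₂)`: the Lie algebra automorphisms of `sl₂(ℂ)`. -/
abbrev Sl2Aut : Type := Sl2 ≃ₗ⁅ℂ⁆ Sl2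

/-- `Aut(sl₂)` is a group under composition. -/
instance Sl2Aut.instGroup : Group Sl2Aut where
  mul a b := b.trans a
  one := 1
  inv a := a.symm
  mul_assoc _ _ _ := rfl
  one_mul _ := rfl
  mul_one _ := rfl
  inv_mul_cancel a := LieEquiv.self_trans_symm a

/-- The standard basis vector `h` of `sl₂(ℂ)`. -/
def Sl2.h : Sl2 := ⟨!![1, 0; 0, -1], by
  simp [LieAlgebra.SpecialLinear.sl, Matrix.trace_fin_two]⟩

/-- The standard basis vector `e` of `sl₂(ℂ)`. -/
def Sl2.e : Sl2 := ⟨!![0, 1; 0, 0], by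
  simp [LieAlgebra.SpecialLinear.sl, Matrix.trace_fin_two]⟩

/-- The standard basis vector `f` of `sl₂(ℂ)`. -/
def Sl2.f : Sl2 := ⟨!![0, 0; 1, 0], by
  simp [LieAlgebra.SpecialLinear.sl, Matrix.trace_fin_two]⟩

section Alia

variable {L : PeriodPair} {S : Set (Torus L)}

/-- The current algebra `sl₂ ⊗ 𝒪_𝕋`, written with the coefficients on the left. -/
abbrev CurrentAlgebra (L : PeriodPair) (S : Set (Torus L)) : Type :=
  RegularFunctions L S ⊗[ℂ] Sl2

instance : LieRing (CurrentAlgebra L S) := LieAlgebra.ExtendScalars.instLieRing ℂ _ Sl2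
instance : AddCommGroup (CurrentAlgebra L S) := TensorProduct.addCommGroup

/-- The diagonal action `A ⊗ f ↦ ρ(γ) A ⊗ f ∘ σ(γ)⁻¹`. -/
def diagonalAction {Γ : Type*} [Group Γ] (ρ : Γ →* Sl2Aut) (σ : Γ →* TorusAut L)
    (hS : ∀ γ x, (σ γ).1 x ∈ S ↔ x ∈ S) (γ : Γ) :
    CurrentAlgebra L S →ₗ[ℂ] CurrentAlgebra L S :=
  TensorProduct.map (pushFunction (σ γ) (hS γ)).toLinearMap (ρ γ).toLinearEquiv.toLinearMap

lemma diagonalAction_lie {Γ : Type*} [Group Γ] (ρ : Γ →* Sl2Aut) (σ : Γ →* TorusAut L)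
    (hS : ∀ γ x, (σ γ).1 x ∈ S ↔ x ∈ S) (γ : Γ) (a b : CurrentAlgebra L S) :
    diagonalAction ρ σ hS γ ⁅a, b⁆ = ⁅diagonalAction ρ σ hS γ a, diagonalAction ρ σ hS γ b⁆ := by
  induction a using TensorProduct.induction_on with
  | zero => rw [zero_lie, map_zero, zero_lie]
  | add a a' h h' => rw [add_lie, map_add, map_add, add_lie, h, h']
  | tmul f x =>
    induction b using TensorProduct.induction_on with
    | zero => rw [lie_zero, map_zero, lie_zero]
    | add a a' h h' => rw [lie_add, map_add, map_add, lie_add, h, h']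
    | tmul g y =>
      have h : (ρ γ) ⁅x, y⁆ = ⁅(ρ γ) x, (ρ γ) y⁆ := LieEquiv.map_lie _ _ _
      simp [diagonalAction, LieAlgebra.ExtendScalars.bracket_tmul, h]

/-- The automorphic Lie algebra `(sl₂ ⊗ 𝒪_𝕋)^{ρ ⊗ σ̃ (Γ)}`, where `𝕋 = T ∖ S`. -/
def automorphicLieAlgebra {Γ : Type*} [Group Γ] (ρ : Γ →* Sl2Aut) (σ : Γ →* TorusAut L)
    (hS : ∀ γ x, (σ γ).1 x ∈ S ↔ x ∈ S) : LieSubalgebra ℂ (CurrentAlgebra L S) where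
  carrier := {a | ∀ γ, diagonalAction ρ σ hS γ a = a}
  add_mem' := fun ha hb γ => by rw [map_add, ha γ, hb γ]
  zero_mem' := fun γ => map_zero _
  smul_mem' := fun c a ha γ => by rw [map_smul, ha γ]
  lie_mem' := fun {a b} ha hb γ => by rw [diagonalAction_lie, ha γ, hb γ]

/-- The algebra `𝒪_𝕋^Γ` of invariant functions. -/
def invariantFunctions {Γ : Type*} [Group Γ] (σ : Γ →* TorusAut L)
    (hS : ∀ γ x, (σ γ).1 x ∈ S ↔ x ∈ S) : Subalgebra ℂ (RegularFunctions L S) where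
  carrier := {f | ∀ γ, pushFunction (σ γ) (hS γ) f = f}
  mul_mem' := fun ha hb γ => by rw [map_mul, ha γ, hb γ]
  add_mem' := fun ha hb γ => by rw [map_add, ha γ, hb γ]
  algebraMap_mem' := fun c γ => AlgHom.commutes _ c

/-- Normal form: `𝔄 = ℂ⟨E, F, H⟩ ⊗ R`, that is, `𝔄` is a free `R`-module with basis `E, F, H`, and
`[H, E] = 2 E`, `[H, F] = -2 F`, `[E, F] = H ⊗ p` with `p ∈ R`. -/
structure IsNormalForm (𝔄 : LieSubalgebra ℂ (CurrentAlgebra L S))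
    (R : Subalgebra ℂ (RegularFunctions L S)) (E F H : CurrentAlgebra L S)
    (p : RegularFunctions L S) : Prop where
  linearIndependent : LinearIndependent R ![E, F, H]
  mem_iff : ∀ a, a ∈ 𝔄 ↔ a ∈ Submodule.span R {E, F, H}
  lie_H_E : ⁅H, E⁆ = (2 : ℂ) • E
  lie_H_F : ⁅H, F⁆ = (-2 : ℂ) • F
  lie_E_F : ⁅E, F⁆ = p • H
  coeff_mem : p ∈ R

/-- The element `h ⊗ a + e ⊗ b + f ⊗ c`, moved by the automorphism `θ` of `sl₂`. -/
def currentElement (θ : Sl2Aut) (a b c : RegularFunctions L S) : CurrentAlgebra L S :=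
  a ⊗ₜ[ℂ] θ Sl2.h + b ⊗ₜ[ℂ] θ Sl2.e + c ⊗ₜ[ℂ] θ Sl2.f

/-- The orbit `Γ · {0}` of the origin of the torus. -/
def zeroOrbit {Γ : Type*} [Group Γ] (σ : Γ →* TorusAut L) : Set (Torus L) :=
  Set.range fun γ => (σ γ).1 0

lemma zeroOrbit_invariant {Γ : Type*} [Group Γ] (σ : Γ →* TorusAut L) (γ : Γ) (x : Torus L) :
    (σ γ).1 x ∈ zeroOrbit σ ↔ x ∈ zeroOrbit σ := by
  constructor
  · rintro ⟨δ, hδ⟩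
    refine ⟨γ⁻¹ * δ, ?_⟩
    apply (σ γ).1.injective
    rw [← hδ]
    simp only [map_mul, map_inv, Subgroup.coe_mul, InvMemClass.coe_inv, Equiv.Perm.mul_apply]
    exact Equiv.apply_symm_apply _ _
  · rintro ⟨δ, rfl⟩
    exact ⟨γ * δ, by simp⟩

end Alia

/-! ### The hexagonal torus and the functions in the normal form -/

/-- `ω₆ = e^{2πi/6}`. -/
def omega6 : ℂ := Complex.exp (2 * Real.pi * Complex.I / 6)

/-- `ω₃ = e^{2πi/3}`. -/
def omega3 : ℂ := Complex.exp (2 * Real.pi * Complex.I / 3)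

lemma omega6_im_ne_zero : omega6.im ≠ 0 := by
  have h : (2 * Real.pi * Complex.I / 6 : ℂ) = ((Real.pi / 3 : ℝ) : ℂ) * Complex.I := by
    push_cast; ring
  rw [omega6, h, Complex.exp_ofReal_mul_I_im, Real.sin_pi_div_three]
  positivity

/-- The periods `1, ω₆` of the hexagonal lattice `ℤ ⊕ ℤ ω₆`. -/
def hexagonal : PeriodPair where
  ω₁ := 1
  ω₂ := omega6
  indep := by
    rw [LinearIndependent.pair_iff]
    intro s t h
    have him := congrArg Complex.im h
    have hre := congrArg Complex.re h
    simp [omega6_im_ne_zero] at him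
    subst him
    simpa using hre

/-- The lattice `½Λ`. -/
def halfPair (L : PeriodPair) : PeriodPair where
  ω₁ := L.ω₁ / 2
  ω₂ := L.ω₂ / 2
  indep := by
    have h := L.indep
    rw [LinearIndependent.pair_iff] at h ⊢
    intro s t hst
    refine h s t ?_
    simp only [Complex.real_smul] at hst ⊢
    linear_combination 2 * hst

/-- `Λ = u (ℤ ⊕ ℤ ω₆)`. -/
def IsHexagonalPeriod (L : PeriodPair) (u : ℂ) : Prop :=
  L.lattice = Submodule.span ℤ {u, omega6 * u}

section PFunctions

variable (L : PeriodPair) (u : ℂ)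

/-- The function `1 / ℘'`. The translations `r₁ : z ↦ z + u / 2` and `r₂ : z ↦ z + ω₆ u / 2` act on
functions of `z` by `r · F = F ∘ r⁻¹`. -/
def recipDeriv (z : ℂ) : ℂ := 1 / L.derivWeierstrassP z

/-- `p₀ = (1 - r₁ - r₂ + r₁ r₂) · (1 / ℘')`. -/
def pZero (z : ℂ) : ℂ :=
  recipDeriv L z - recipDeriv L (z - u / 2) - recipDeriv L (z - omega6 * u / 2)
    + recipDeriv L (z - u / 2 - omega6 * u / 2)

/-- `p₁ = (1 - r₁ + r₂ - r₁ r₂) · (1 / ℘')`. -/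
def pOne (z : ℂ) : ℂ :=
  recipDeriv L z - recipDeriv L (z - u / 2) + recipDeriv L (z - omega6 * u / 2)
    - recipDeriv L (z - u / 2 - omega6 * u / 2)

/-- `p₂ = (1 + r₁ - r₂ - r₁ r₂) · (1 / ℘')`. -/
def pTwo (z : ℂ) : ℂ :=
  recipDeriv L z + recipDeriv L (z - u / 2) - recipDeriv L (z - omega6 * u / 2)
    - recipDeriv L (z - u / 2 - omega6 * u / 2)

/-- `β₂ = 4 / ((e₁ - e₃) (e₂ - e₃)²)` with `e₁ = ℘(u/2)`, `e₂ = ℘(ω₆u/2)`, `e₃ = ℘((1 + ω₆)u/2)`. -/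
def betaTwo : ℂ :=
  4 / ((L.weierstrassP (u / 2) - L.weierstrassP ((1 + omega6) * u / 2)) *
    (L.weierstrassP (omega6 * u / 2) - L.weierstrassP ((1 + omega6) * u / 2)) ^ 2)

/-- The square root `κ` of `α₂ β₂` which belongs to `A₁ = -i`, `B₁ = 1`, where
`α₂ = 4 / ((e₁ - e₂) (e₂ - e₃)²)`; for hexagonal lattices `α₂ = -ω₃ β₂`. -/
def kappa : ℂ := -Complex.I * omega3 ^ 2 * betaTwo L u

end PFunctions

section Generators

variable {L : PeriodPair} {S : Set (Torus L)}

/-! The columns `Ψ h`, `Ψ e`, `Ψ f` of the intertwiner `Ψ = Ad Ω` with respect to the basis `h, e, f`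
for hexagonal lattices (`α₁ = ω₃`, `β₁ = ω₃²`, `A₁ = -i`, `B₁ = 1`, `√(α₂β₂) = κ`), moved by an
automorphism `θ` of `sl₂`. -/

/-- `Ψ h`. -/
def psiH (θ : Sl2Aut) (κ : ℂ) (p₀ p₁ p₂ : RegularFunctions L S) : CurrentAlgebra L S :=
  currentElement θ
    (κ⁻¹ • (p₀ * p₁))
    (κ⁻¹ • ((Complex.I • p₀ + p₁) * p₂))
    (κ⁻¹ • ((-Complex.I • p₀ + p₁) * p₂))

/-- `Ψ e`. -/
def psiE (θ : Sl2Aut) (p₀ p₁ p₂ : RegularFunctions L S) : CurrentAlgebra L S :=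
  currentElement θ
    (-p₂)
    ((-Complex.I * omega3 ^ 2) • p₁ - omega3 • p₀)
    ((Complex.I * omega3 ^ 2) • p₁ - omega3 • p₀)

/-- `Ψ f`. -/
def psiF (θ : Sl2Aut) (κ : ℂ) (p₀ p₁ p₂ : RegularFunctions L S) : CurrentAlgebra L S :=
  currentElement θ
    (-(4 * κ ^ 2)⁻¹ • ((p₀ ^ 2 + p₁ ^ 2) * p₂))
    ((4 * κ ^ 2)⁻¹ • ((Complex.I • p₀ + p₁) * (p₀ * p₁ - algebraMap ℂ _ κ)))
    ((4 * κ ^ 2)⁻¹ • ((-Complex.I • p₀ + p₁) * (p₀ * p₁ + algebraMap ℂ _ κ)))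

end Generators

end

/-! ### The numbers `ω₆` and `ω₃` -/

/-! Geometry. Local lifts of a holomorphic map between tori have a common derivative, which is
entire and doubly periodic, hence constant: the map is affine (`IsHolomorphicMap.exists_affine`).
This gives `Λ = u Λ_{ω₆}`. Taking linear parts is multiplicative with commutative target, so it
kills the commutator subgroup of `A₄`, the Klein four-group `V`. Thus `V` acts by translations, by
counting exactly those in `½Λ/Λ`, and the given element fixing the origin, or its square, is
multiplication by `ω₃` (`IsHexagonalPeriod.exists_isA4Frame`). In particular the punctures are
`½Λ/Λ`.

Functions. A `V`-invariant function is `½Λ`-periodic with poles in `½Λ`; removing leading terms one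
by one shows that it is a polynomial in `℘` and `℘'` of `½Λ`
(`IsHexagonalPeriod.exists_mem_adjoin`). For a hexagonal lattice `g₂ = 0`, so `℘³ = (℘'² + g₃)/4`;
the rotation fixes `℘'` and scales `℘` by a cube root of unity. With `R = ℂ[℘']` the ring splits
into the rotation eigenspaces `R`, `R℘`, `R℘²`. The functions `p₀, p₁, p₂` carry the three
nontrivial characters of `V`, are permuted cyclically by the rotation, and have squares that are
affine in `℘` (`IsFunctionFrame.sq_eq`).

Lie algebra. A faithful action of `A₄` on `sl₂` has a basis `Y₀, Y₁, Y₂` of `V`-weight vectors,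
permuted cyclically, whose bracket is `-2i` times the cross product (`IsA4Frame.exists_isSl2Frame`).
In this basis the characters of the coefficients of `h', e', f'` cancel those of the `Yⱼ`, so the
triple is `V`-invariant. The square relations make it an `sl₂`-triple and a basis over `𝒪_𝕋`
(`IsCoefficientFrame.isFreeTriple`), and the rotation scales `e', f', h'` by `ω₃, ω₃², 1`.
Invariance of an element thus becomes a condition on its coefficients: `V`-invariance puts them in
`ℂ[℘, ℘']`, and the rotation then selects `R℘`, `R℘²`, `R`.

Onsager algebra. Here `[E, F] = H ⊗ (℘'² + g₃)/4` with `g₃ ≠ 0`. For `c² = -g₃` and `t = ℘'/c`,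
suitable combinations `X, Y` of `E, F` satisfy `[X, Y] = -8(t² - 1)H`. Then `A_k ↦ 2T_k(t)H +
U_{k-1}(t)X`, `G_m ↦ U_{m-1}(t)Y` turns the Onsager relations into the addition formulas for
Chebyshev polynomials, and it is bijective because the `T_n` and the `U_n` are bases of the
polynomials. -/

lemma omega6_eq : omega6 = 1 / 2 + (Real.sqrt 3 / 2 : ℝ) * Complex.I := by
  have h : (2 * Real.pi * Complex.I / 6 : ℂ) = ((Real.pi / 3 : ℝ) : ℂ) * Complex.I := by
    push_cast; ring
  rw [omega6, h, Complex.exp_mul_I, ← Complex.ofReal_cos, ← Complex.ofReal_sin,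
    Real.cos_pi_div_three, Real.sin_pi_div_three]
  push_cast; ring

lemma omega6_sq : omega6 ^ 2 = omega6 - 1 := by
  have h : ((Real.sqrt 3 : ℝ) : ℂ) ^ 2 = 3 := by
    rw [← Complex.ofReal_pow, Real.sq_sqrt (by norm_num)]; norm_num
  rw [omega6_eq]
  push_cast
  linear_combination (Complex.I ^ 2 / 4) * h + (3 / 4) * Complex.I_sq

lemma omega3_eq : omega3 = omega6 - 1 := by
  rw [← omega6_sq, omega6, omega3, ← Complex.exp_nat_mul]
  congr 1
  push_cast; ring

lemma omega6_eq_add : omega6 = omega3 + 1 := by rw [omega3_eq]; ring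

lemma omega3_sq : omega3 ^ 2 = -omega3 - 1 := by
  rw [omega3_eq]; linear_combination omega6_sq

lemma omega3_pow_three : omega3 ^ 3 = 1 := by
  linear_combination (omega3 - 1) * omega3_sq

lemma omega6_ne_zero : omega6 ≠ 0 := Complex.exp_ne_zero _

lemma omega3_ne_zero : omega3 ≠ 0 := Complex.exp_ne_zero _

lemma omega3_ne_one : omega3 ≠ 1 := by
  intro h
  have := omega3_sq
  rw [h] at this
  norm_num at this

/-! ### Hexagonal lattices -/

lemma halfPair_mem_lattice {L : PeriodPair} {z : ℂ} :
    z ∈ (halfPair L).lattice ↔ 2 * z ∈ L.lattice := by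
  simp only [PeriodPair.mem_lattice, halfPair]
  constructor
  · rintro ⟨m, n, rfl⟩; exact ⟨m, n, by ring⟩
  · rintro ⟨m, n, h⟩; exact ⟨m, n, by linear_combination h / 2⟩

lemma mem_halfPair_of_mem {L : PeriodPair} {z : ℂ} (hz : z ∈ L.lattice) :
    z ∈ (halfPair L).lattice := by
  rw [halfPair_mem_lattice, two_mul]; exact add_mem hz hz

namespace IsHexagonalPeriod

variable {M : PeriodPair} {v : ℂ}

lemma mem_iff (h : IsHexagonalPeriod M v) {l : ℂ} :
    l ∈ M.lattice ↔ ∃ m n : ℤ, l = (m + n * omega6) * v := by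
  rw [h, Submodule.mem_span_pair]
  simp only [zsmul_eq_mul]
  constructor
  · rintro ⟨m, n, rfl⟩; exact ⟨m, n, by ring⟩
  · rintro ⟨m, n, rfl⟩; exact ⟨m, n, by ring⟩

lemma ne_zero (h : IsHexagonalPeriod M v) : v ≠ 0 := by
  rintro rfl
  obtain ⟨m, n, hmn⟩ := h.mem_iff.1 M.ω₁_mem_lattice
  have := M.indep.ne_zero 0
  simp at this hmn
  exact this hmn

lemma half (h : IsHexagonalPeriod M v) : IsHexagonalPeriod (halfPair M) (v / 2) := by
  ext l
  rw [halfPair_mem_lattice, h.mem_iff, Submodule.mem_span_pair]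
  simp only [zsmul_eq_mul]
  constructor
  · rintro ⟨m, n, h⟩; exact ⟨m, n, by linear_combination -h / 2⟩
  · rintro ⟨m, n, rfl⟩; exact ⟨m, n, by ring⟩

lemma omega6_mul_mem (h : IsHexagonalPeriod M v) {l : ℂ} (hl : l ∈ M.lattice) :
    omega6 * l ∈ M.lattice := by
  obtain ⟨m, n, rfl⟩ := h.mem_iff.1 hl
  refine h.mem_iff.2 ⟨-n, m + n, ?_⟩
  push_cast
  linear_combination n * v * omega6_sq

lemma omega6_mul_mem_iff (h : IsHexagonalPeriod M v) {l : ℂ} :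
    omega6 * l ∈ M.lattice ↔ l ∈ M.lattice := by
  refine ⟨fun hl => ?_, h.omega6_mul_mem⟩
  have h2 := h.omega6_mul_mem (h.omega6_mul_mem hl)
  have : l = - (omega6 * (omega6 * (omega6 * l))) := by
    linear_combination (omega6 + 1) * l * omega6_sq
  rw [this]; exact neg_mem h2

lemma omega3_mul_mem_iff (h : IsHexagonalPeriod M v) {l : ℂ} :
    omega3 * l ∈ M.lattice ↔ l ∈ M.lattice := by
  rw [← h.omega6_mul_mem_iff (l := l), ← h.omega6_mul_mem_iff (l := omega6 * l), omega3_eq,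
    ← omega6_sq]
  ring_nf

/-- Comparing imaginary and then real parts shows that the coordinates with respect to `1, ω₆` are
unique, so membership would force both `m` and `n` to be even. -/
lemma add_mul_half_notMem (h : IsHexagonalPeriod M v) {m n : ℤ} (hmn : Odd m ∨ Odd n) :
    (m + n * omega6) * v / 2 ∉ M.lattice := by
  intro hl
  obtain ⟨a, b, hab⟩ := h.mem_iff.1 hl
  have h0 : ((m - 2 * a : ℤ) : ℂ) + ((n - 2 * b : ℤ) : ℂ) * omega6 = 0 := by
    have : (((m - 2 * a : ℤ) : ℂ) + ((n - 2 * b : ℤ) : ℂ) * omega6) * v = 0 := by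
      push_cast; linear_combination 2 * hab
    exact (mul_eq_zero.1 this).resolve_right h.ne_zero
  have him : n - 2 * b = 0 := by
    have := congrArg Complex.im h0
    simp only [Complex.add_im, Complex.intCast_im, Complex.mul_im, Complex.intCast_re,
      zero_mul, add_zero, zero_add, Complex.zero_im, mul_eq_zero, omega6_im_ne_zero, or_false] at this
    exact_mod_cast this
  have hre : m - 2 * a = 0 := by
    rw [him] at h0
    simp only [Int.cast_zero, zero_mul, add_zero] at h0
    exact_mod_cast h0
  rcases hmn with ⟨k, hk⟩ | ⟨k, hk⟩ <;> omega

/-- Multiplication by `ω₆` on a hexagonal lattice. -/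
noncomputable def rotation (h : IsHexagonalPeriod M v) : M.lattice ≃ M.lattice where
  toFun l := ⟨omega6 * l, h.omega6_mul_mem l.2⟩
  invFun l := ⟨omega6⁻¹ * l, by
    rw [← h.omega6_mul_mem_iff, mul_inv_cancel_left₀ omega6_ne_zero]; exact l.2⟩
  left_inv l := by ext; simp [omega6_ne_zero]
  right_inv l := by ext; simp [omega6_ne_zero]

lemma coe_rotation (h : IsHexagonalPeriod M v) (l : M.lattice) :
    ((h.rotation l : M.lattice) : ℂ) = omega6 * l := rfl

/-- Multiplication by `ω₆` permutes the lattice, so the defining series can be reindexed;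
homogeneity of degree `-2` produces the factor `ω₆⁻² = -ω₆`. -/
lemma weierstrassP_omega6_mul (h : IsHexagonalPeriod M v) (z : ℂ) :
    M.weierstrassP (omega6 * z) = -omega6 * M.weierstrassP z := by
  have h6 : (omega6 ^ 2)⁻¹ = - omega6 := by
    rw [inv_eq_iff_eq_inv, eq_comm, inv_eq_iff_eq_inv, eq_comm]
    refine inv_eq_of_mul_eq_one_right ?_
    linear_combination (-omega6 - 1) * omega6_sq
  rw [PeriodPair.weierstrassP, ← h.rotation.tsum_eq, PeriodPair.weierstrassP, ← tsum_mul_left]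
  congr 1; ext l
  rw [coe_rotation, ← mul_sub, mul_pow, mul_pow, ← h6]
  simp only [one_div, mul_inv]
  ring

lemma derivWeierstrassP_omega6_mul (h : IsHexagonalPeriod M v) (z : ℂ) :
    M.derivWeierstrassP (omega6 * z) = - M.derivWeierstrassP z := by
  have h6 : omega6 ^ 3 = -1 := by linear_combination (omega6 + 1) * omega6_sq
  rw [PeriodPair.derivWeierstrassP, ← h.rotation.tsum_eq, PeriodPair.derivWeierstrassP, ← tsum_neg,
    ← tsum_neg, ← tsum_neg]
  congr 1; ext l
  rw [coe_rotation, ← mul_sub, mul_pow, h6, neg_one_mul, div_neg]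

lemma weierstrassP_omega3_mul (h : IsHexagonalPeriod M v) (z : ℂ) :
    M.weierstrassP (omega3 * z) = omega3 * M.weierstrassP z := by
  rw [omega3_eq, ← omega6_sq, pow_two, mul_assoc, h.weierstrassP_omega6_mul,
    h.weierstrassP_omega6_mul]
  ring

lemma derivWeierstrassP_omega3_mul (h : IsHexagonalPeriod M v) (z : ℂ) :
    M.derivWeierstrassP (omega3 * z) = M.derivWeierstrassP z := by
  rw [omega3_eq, ← omega6_sq, pow_two, mul_assoc, h.derivWeierstrassP_omega6_mul,
    h.derivWeierstrassP_omega6_mul, neg_neg]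

/-- The same reindexing gives `G₄ = ω₆⁻⁴ G₄` with `ω₆⁻⁴ ≠ 1`. -/
lemma g₂_eq_zero (h : IsHexagonalPeriod M v) : M.g₂ = 0 := by
  have h6 : (omega6 ^ 4)⁻¹ = omega6 - 1 := by
    refine inv_eq_of_mul_eq_one_right ?_
    linear_combination (omega6 ^ 3 - omega6 - 1) * omega6_sq
  have key : M.G 4 = (omega6 - 1) * M.G 4 := by
    conv_lhs => rw [PeriodPair.G, ← h.rotation.tsum_eq]
    rw [PeriodPair.G, ← tsum_mul_left]
    congr 1; ext l
    rw [coe_rotation, mul_pow, mul_inv, h6]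
  have h2 : (2 - omega6) * M.G 4 = 0 := by linear_combination key
  rcases mul_eq_zero.1 h2 with h3 | h3
  · have : omega6 = 2 := by linear_combination -h3
    have h4 := omega6_sq
    rw [this] at h4
    norm_num at h4
  · rw [PeriodPair.g₂, h3, mul_zero]

lemma derivWeierstrassP_sq (h : IsHexagonalPeriod M v) {z : ℂ} (hz : z ∉ M.lattice) :
    M.derivWeierstrassP z ^ 2 = 4 * M.weierstrassP z ^ 3 - M.g₃ := by
  rw [M.derivWeierstrassP_sq z hz, h.g₂_eq_zero]; ring

end IsHexagonalPeriod

/-- Division by two, as a bijection `Λ ≃ ½Λ`. -/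
noncomputable def halfLatticeEquiv (L : PeriodPair) : L.lattice ≃ (halfPair L).lattice where
  toFun l := ⟨l / 2, by rw [halfPair_mem_lattice, mul_div_cancel₀ _ two_ne_zero]; exact l.2⟩
  invFun l := ⟨2 * l, halfPair_mem_lattice.1 l.2⟩
  left_inv l := Subtype.ext (by change 2 * ((l : ℂ) / 2) = l; ring)
  right_inv l := by ext; simp

lemma weierstrassP_halfPair (L : PeriodPair) (z : ℂ) :
    (halfPair L).weierstrassP z = 4 * L.weierstrassP (2 * z) := by
  rw [PeriodPair.weierstrassP, ← (halfLatticeEquiv L).tsum_eq, PeriodPair.weierstrassP,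
    ← tsum_mul_left]
  congr 1; ext l
  change 1 / (z - l / 2) ^ 2 - 1 / ((l : ℂ) / 2) ^ 2 = _
  have : (z - (l : ℂ) / 2) = (2 * z - l) / 2 := by ring
  rw [this, div_pow, div_pow, one_div_div, one_div_div]
  ring

/-! ### Elliptic functions with poles at lattice points -/

lemma eq_of_eventuallyEq_nhdsNE {f g : ℂ → ℂ} {z : ℂ} (hf : ContinuousAt f z)
    (hg : ContinuousAt g z) (h : f =ᶠ[𝓝[≠] z] g) : f z = g z :=
  tendsto_nhds_unique_of_eventuallyEq (hf.tendsto.mono_left nhdsWithin_le_nhds)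
    (hg.tendsto.mono_left nhdsWithin_le_nhds) h

/-- Liouville's theorem for doubly periodic functions with removable singularities. -/
theorem PeriodPair.exists_const_of_removable (M : PeriodPair) {F : ℂ → ℂ}
    (hper : ∀ l ∈ M.lattice, ∀ z, F (z + l) = F z)
    (hF : ∀ z, ∃ g : ℂ → ℂ, AnalyticAt ℂ g z ∧ F =ᶠ[𝓝[≠] z] g) :
    ∃ c, ∀ z, ContinuousAt F z → F z = c := by
  -- `g z` extends `F` holomorphically across `z`. Neighbouring extensions agree, so the diagonal `w
  -- ↦ g w w` is entire and periodic, and Liouville applies to it.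
  choose g hg hFg using hF
  have hG : ∀ z, ∀ᶠ w in 𝓝 z, g w w = g z w := by
    intro z
    have h1 := eventually_eventually_nhdsWithin.2 (hFg z)
    rw [eventually_nhdsWithin_iff] at h1
    filter_upwards [h1, (hg z).eventually_analyticAt] with w hw hgw
    by_cases hwz : w = z
    · rw [hwz]
    have h2 : ∀ᶠ x in 𝓝 w, F x = g z x := by
      have := hw hwz
      rwa [IsOpen.nhdsWithin_eq isOpen_compl_singleton (by exact hwz)] at this
    refine eq_of_eventuallyEq_nhdsNE (hg w).continuousAt hgw.continuousAt ?_
    filter_upwards [hFg w, h2.filter_mono nhdsWithin_le_nhds] with x hx hx'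
    rw [← hx, hx']
  have hd : Differentiable ℂ fun z => g z z := fun z =>
    ((hg z).congr (by filter_upwards [hG z] with w hw using hw.symm)).differentiableAt
  have hFG : ∀ z, F =ᶠ[𝓝[≠] z] fun z => g z z := fun z => by
    filter_upwards [hFg z, (hG z).filter_mono nhdsWithin_le_nhds] with w h1 h2
    rw [h1, h2]
  have hperG : ∀ z l, l ∈ M.lattice → g (z + l) (z + l) = g z z := by
    intro z l hl
    have hc : Continuous fun w : ℂ => w + l := by fun_prop
    refine eq_of_eventuallyEq_nhdsNE (f := fun w => g (w + l) (w + l)) (g := fun z => g z z)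
      (hd.continuous.comp hc).continuousAt hd.continuous.continuousAt ?_
    have ht : Filter.Tendsto (fun w : ℂ => w + l) (𝓝[≠] z) (𝓝[≠] (z + l)) :=
      hc.continuousAt.continuousWithinAt.tendsto_nhdsWithin fun w hw => by simpa using hw
    filter_upwards [hFG z, ht.eventually (hFG (z + l))] with w h1 h2
    rw [← h1, ← hper l hl, h2]
  refine ⟨g 0 0, fun z hz => ?_⟩
  -- Continuity at `z` is needed because `F` may have an arbitrary value at a removed singularity.
  rw [eq_of_eventuallyEq_nhdsNE hz hd.continuous.continuousAt (hFG z)]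
  exact hd.apply_eq_apply_of_bounded (IsZLattice.isCompact_range_of_periodic M.lattice _
    hd.continuous fun z w hw ↦ hperG z w hw).isBounded z 0

/-- `F` is `Λ`-periodic, and holomorphic outside `Λ`. -/
structure PeriodPair.IsEllipticOff (M : PeriodPair) (F : ℂ → ℂ) : Prop where
  periodic : ∀ l ∈ M.lattice, ∀ z, F (z + l) = F z
  analyticAt : ∀ z, z ∉ M.lattice → AnalyticAt ℂ F z

/-- `F(z) = c z⁻ⁿ + ⋯` at the origin. -/
def HasLeadingTerm (F : ℂ → ℂ) (n : ℕ) (c : ℂ) : Prop :=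
  ∃ g : ℂ → ℂ, AnalyticAt ℂ g 0 ∧ g 0 = c ∧ ∀ᶠ z in 𝓝[≠] 0, F z = g z / z ^ n

namespace HasLeadingTerm

variable {F G : ℂ → ℂ} {m n : ℕ} {c d : ℂ}

lemma mul (hF : HasLeadingTerm F m c) (hG : HasLeadingTerm G n d) :
    HasLeadingTerm (fun z => F z * G z) (m + n) (c * d) := by
  obtain ⟨f, hf, rfl, hf'⟩ := hF
  obtain ⟨g, hg, rfl, hg'⟩ := hG
  refine ⟨f * g, hf.mul hg, rfl, ?_⟩
  filter_upwards [hf', hg'] with z h1 h2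
  rw [h1, h2, Pi.mul_apply, pow_add, div_mul_div_comm]

lemma add (hF : HasLeadingTerm F n c) (hG : HasLeadingTerm G n d) :
    HasLeadingTerm (fun z => F z + G z) n (c + d) := by
  obtain ⟨f, hf, rfl, hf'⟩ := hF
  obtain ⟨g, hg, rfl, hg'⟩ := hG
  refine ⟨f + g, hf.add hg, rfl, ?_⟩
  filter_upwards [hf', hg'] with z h1 h2
  rw [h1, h2, Pi.add_apply, add_div]

lemma of_analyticAt (hF : AnalyticAt ℂ F 0) : HasLeadingTerm F 0 (F 0) :=
  ⟨F, hF, rfl, by simp⟩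

lemma const_mul (a : ℂ) (hF : HasLeadingTerm F n c) :
    HasLeadingTerm (fun z => a * F z) n (a * c) := by
  simpa using (of_analyticAt (F := fun _ => a) analyticAt_const).mul hF

lemma sub (hF : HasLeadingTerm F n c) (hG : HasLeadingTerm G n d) :
    HasLeadingTerm (fun z => F z - G z) n (c - d) := by
  simpa [sub_eq_add_neg] using hF.add (hG.const_mul (-1))

lemma pow (hF : HasLeadingTerm F m c) (k : ℕ) :
    HasLeadingTerm (fun z => F z ^ k) (k * m) (c ^ k) := by
  induction k with
  | zero => simpa using of_analyticAt (F := fun _ => (1 : ℂ)) analyticAt_const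
  | succ k ih => simpa [pow_succ, add_mul] using ih.mul hF

lemma comp_neg (hF : HasLeadingTerm F n c) :
    HasLeadingTerm (fun z => F (-z)) n ((-1) ^ n * c) := by
  obtain ⟨f, hf, rfl, hf'⟩ := hF
  refine ⟨fun z => (-1) ^ n * f (-z), ?_, by simp, ?_⟩
  · have : AnalyticAt ℂ (fun z : ℂ => f (-z)) 0 :=
      AnalyticAt.comp (g := f) (f := fun z : ℂ => -z) (by simpa using hf) (by fun_prop)
    exact analyticAt_const.mul this
  · have ht : Filter.Tendsto (fun w : ℂ => -w) (𝓝[≠] 0) (𝓝[≠] 0) := by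
      have : ContinuousAt (fun w : ℂ => -w) 0 := by fun_prop
      simpa using this.continuousWithinAt.tendsto_nhdsWithin (s := {0}ᶜ) (t := {0}ᶜ)
        (fun w hw => by simpa using hw)
    filter_upwards [ht.eventually hf'] with z hz
    have h1 : ((-1 : ℂ) ^ n)⁻¹ = (-1) ^ n :=
      inv_eq_of_mul_eq_one_right (by rw [← mul_pow]; simp)
    rw [hz, neg_pow, div_mul_eq_div_div, div_eq_mul_inv (f (-z)), h1, mul_comm (f (-z))]

lemma congr (hF : HasLeadingTerm F n c) (h : F =ᶠ[𝓝[≠] 0] G) : HasLeadingTerm G n c := by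
  obtain ⟨f, hf, rfl, hf'⟩ := hF
  refine ⟨f, hf, rfl, ?_⟩
  filter_upwards [hf', h] with z h1 h2
  rw [← h2, h1]

/-- The coefficient in `HasLeadingTerm` may be zero, in which case the numerator is divisible by
`z`. All arguments on pole orders cancel a leading coefficient and then lower the order here. -/
lemma reduce (hF : HasLeadingTerm F (n + 1) 0) : ∃ c, HasLeadingTerm F n c := by
  obtain ⟨f, hf, h0, hf'⟩ := hF
  have : (1 : ℕ) ≤ analyticOrderAt f 0 := by
    rw [Nat.cast_one, Order.one_le_iff_ne_zero, hf.analyticOrderAt_ne_zero]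
    exact h0
  obtain ⟨g, hg, hfg⟩ := (natCast_le_analyticOrderAt hf).1 this
  refine ⟨g 0, g, hg, rfl, ?_⟩
  filter_upwards [hf', hfg.filter_mono nhdsWithin_le_nhds, self_mem_nhdsWithin] with z h1 h2 h3
  have : z ≠ 0 := h3
  rw [h1, h2]
  simp only [sub_zero, pow_one, smul_eq_mul]
  field_simp
  ring

end HasLeadingTerm

namespace PeriodPair

variable (M : PeriodPair)

lemma hasLeadingTerm_weierstrassP : HasLeadingTerm M.weierstrassP 2 1 := by
  refine ⟨fun z => z ^ 2 * M.weierstrassPExcept 0 z + 1, ?_, by simp, ?_⟩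
  · have := M.analyticAt_weierstrassPExcept 0
    fun_prop
  · filter_upwards [self_mem_nhdsWithin] with z hz
    have hz : z ≠ 0 := hz
    have := M.weierstrassPExcept_add 0 z
    simp only [ZeroMemClass.coe_zero, sub_zero] at this
    rw [← this]
    field_simp
    simp

lemma hasLeadingTerm_derivWeierstrassP : HasLeadingTerm M.derivWeierstrassP 3 (-2) := by
  refine ⟨fun z => z ^ 3 * M.derivWeierstrassPExcept 0 z - 2, ?_, by simp, ?_⟩
  · have := M.analyticAt_derivWeierstrassPExcept 0
    fun_prop
  · filter_upwards [self_mem_nhdsWithin] with z hz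
    have hz : z ≠ 0 := hz
    have := M.derivWeierstrassPExcept_sub 0 z
    simp only [ZeroMemClass.coe_zero, sub_zero] at this
    rw [← this]
    field_simp

namespace IsEllipticOff

variable {M} {F G : ℂ → ℂ}

lemma add (hF : M.IsEllipticOff F) (hG : M.IsEllipticOff G) :
    M.IsEllipticOff fun z => F z + G z :=
  ⟨fun l hl z => by rw [hF.1 l hl, hG.1 l hl], fun z hz => (hF.2 z hz).add (hG.2 z hz)⟩

lemma mul (hF : M.IsEllipticOff F) (hG : M.IsEllipticOff G) :
    M.IsEllipticOff fun z => F z * G z :=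
  ⟨fun l hl z => by rw [hF.1 l hl, hG.1 l hl], fun z hz => (hF.2 z hz).mul (hG.2 z hz)⟩

lemma sub (hF : M.IsEllipticOff F) (hG : M.IsEllipticOff G) :
    M.IsEllipticOff fun z => F z - G z :=
  ⟨fun l hl z => by rw [hF.1 l hl, hG.1 l hl], fun z hz => (hF.2 z hz).sub (hG.2 z hz)⟩

lemma const (c : ℂ) : M.IsEllipticOff fun _ => c :=
  ⟨fun _ _ _ => rfl, fun _ _ => analyticAt_const⟩

lemma pow (hF : M.IsEllipticOff F) (n : ℕ) : M.IsEllipticOff fun z => F z ^ n :=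
  ⟨fun l hl z => by rw [hF.1 l hl], fun z hz => (hF.2 z hz).pow n⟩

lemma comp_neg (hF : M.IsEllipticOff F) : M.IsEllipticOff fun z => F (-z) := by
  refine ⟨fun l hl z => ?_, fun z hz => ?_⟩
  · rw [neg_add, hF.1 (-l) (neg_mem hl)]
  · exact AnalyticAt.comp (g := F) (f := fun z : ℂ => -z) (hF.2 (-z) (by simpa using hz))
      (by fun_prop)

/-- An elliptic function without poles is constant. -/
lemma exists_const (hF : M.IsEllipticOff F) {c : ℂ} (h0 : HasLeadingTerm F 0 c) :
    ∃ k, ∀ z, z ∉ M.lattice → F z = k := by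
  obtain ⟨k, hk⟩ := M.exists_const_of_removable hF.periodic (fun z => by
    by_cases hz : z ∈ M.lattice
    · obtain ⟨g, hg, -, hFg⟩ := h0
      refine ⟨fun w => g (w - z), ?_, ?_⟩
      · exact AnalyticAt.comp (g := g) (f := fun w : ℂ => w - z) (by simpa using hg) (by fun_prop)
      · have ht : Filter.Tendsto (fun w : ℂ => w - z) (𝓝[≠] z) (𝓝[≠] 0) := by
          have : ContinuousAt (fun w : ℂ => w - z) z := by fun_prop
          simpa using this.continuousWithinAt.tendsto_nhdsWithin (s := {z}ᶜ) (t := {0}ᶜ)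
            (fun w hw => by simpa [sub_eq_zero] using hw)
        filter_upwards [ht.eventually hFg] with w hw
        have := hF.periodic z hz (w - z)
        rw [sub_add_cancel] at this
        rw [this, hw, pow_zero, div_one]
    · exact ⟨F, hF.2 z hz, Filter.EventuallyEq.rfl⟩)
  exact ⟨k, fun z hz => hk z (hF.2 z hz).continuousAt⟩

/-- The simple polar parts of `F(z)` and `F(-z)` cancel, so the sum has no pole. -/
lemma exists_const_add_comp_neg (hF : M.IsEllipticOff F) {c : ℂ} (h0 : HasLeadingTerm F 1 c) :
    ∃ k, ∀ z, z ∉ M.lattice → F z + F (-z) = k := by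
  obtain ⟨d, hd⟩ := HasLeadingTerm.reduce (n := 0) (by simpa using h0.add h0.comp_neg)
  exact (hF.add hF.comp_neg).exists_const hd

end IsEllipticOff

lemma isEllipticOff_weierstrassP : M.IsEllipticOff M.weierstrassP :=
  ⟨fun l hl z => M.weierstrassP_add_coe z ⟨l, hl⟩, fun z hz => M.analyticOnNhd_weierstrassP z hz⟩

lemma isEllipticOff_derivWeierstrassP : M.IsEllipticOff M.derivWeierstrassP :=
  ⟨fun l hl z => M.derivWeierstrassP_add_coe z ⟨l, hl⟩,
    fun z hz => M.analyticOnNhd_derivWeierstrassP z hz⟩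

lemma derivWeierstrassP_half {l : ℂ} (hl : l ∈ M.lattice) : M.derivWeierstrassP (l / 2) = 0 := by
  have h := M.derivWeierstrassP_add_coe (-(l / 2)) ⟨l, hl⟩
  rw [M.derivWeierstrassP_neg, show -(l / 2) + l = l / 2 by ring] at h
  exact CharZero.eq_neg_self_iff.1 h

end PeriodPair

namespace HasLeadingTerm

variable {F G : ℂ → ℂ} {m n : ℕ} {c d : ℂ}

lemma pow_mul_self (hF : HasLeadingTerm F n c) : HasLeadingTerm (fun z => z ^ n * F z) 0 c := by
  obtain ⟨f, hf, rfl, hf'⟩ := hF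
  refine ⟨f, hf, rfl, ?_⟩
  filter_upwards [hf', self_mem_nhdsWithin] with z h1 h2
  have : z ≠ 0 := h2
  rw [h1]
  field_simp

lemma tendsto (hF : HasLeadingTerm F n c) :
    Filter.Tendsto (fun z => z ^ n * F z) (𝓝[≠] 0) (𝓝 c) := by
  obtain ⟨f, hf, rfl, hf'⟩ := hF.pow_mul_self
  refine Filter.Tendsto.congr' (f₁ := f) ?_
    (hf.continuousAt.tendsto.mono_left nhdsWithin_le_nhds)
  filter_upwards [hf'] with z h1
  rw [h1, pow_zero, div_one]

lemma unique (hF : HasLeadingTerm F n c) (hF' : HasLeadingTerm F n d) : c = d :=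
  tendsto_nhds_unique hF.tendsto hF'.tendsto

lemma eq_zero_of_even (hF : HasLeadingTerm F 1 c) (h : ∀ z, F (-z) = F z) : c = 0 := by
  have h2 := hF.comp_neg
  simp only [h, pow_one, neg_one_mul] at h2
  exact CharZero.eq_neg_self_iff.1 (hF.unique h2)

end HasLeadingTerm

/-! ### The values of `℘` at half periods. -/

namespace PeriodPair

variable (M : PeriodPair)

lemma isPreconnected_compl_lattice : IsPreconnected ((M.lattice : Set ℂ)ᶜ) := by
  refine (Set.Countable.isConnected_compl_of_one_lt_rank (by simp) ?_).2
  exact Set.countable_coe_iff.1 (inferInstanceAs (Countable M.lattice))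

variable {M} in
-- The complement of the countable lattice is connected, so by the identity theorem local vanishing
-- would spread up to the origin and kill the leading coefficient.
lemma IsEllipticOff.not_eventually_eq_zero {F : ℂ → ℂ} (hF : M.IsEllipticOff F) {n : ℕ} {c : ℂ}
    (h : HasLeadingTerm F n c) (hc : c ≠ 0) {z : ℂ} (hz : z ∉ M.lattice) :
    ¬ ∀ᶠ w in 𝓝 z, F w = 0 := by
  intro h0
  have hF0 : Set.EqOn F 0 ((M.lattice : Set ℂ)ᶜ) :=
    AnalyticOnNhd.eqOn_zero_of_preconnected_of_eventuallyEq_zero (fun z hz => hF.2 z hz)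
      M.isPreconnected_compl_lattice hz h0
  refine hc (tendsto_nhds_unique h.tendsto ?_)
  refine Filter.Tendsto.congr' (f₁ := fun _ => (0 : ℂ)) ?_ tendsto_const_nhds
  have hm := mem_nhdsWithin_of_mem_nhds (t := {0}ᶜ) (M.compl_lattice_sdiff_singleton_mem_nhds 0)
  filter_upwards [hm, self_mem_nhdsWithin] with w hw hw0
  have : w ∉ M.lattice := fun h => hw ⟨h, hw0⟩
  rw [hF0 this, Pi.zero_apply, mul_zero]

lemma sub_notMem_of_notMem {t : ℂ} (ht : t ∉ M.lattice) {z : ℂ}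
    (hz : z ∈ M.lattice) : z - t ∉ M.lattice := fun h => ht (by
  have := sub_mem hz h
  rwa [sub_sub_cancel] at this)

/-- `℘` takes the value `℘(t)` at a half period `t` only at the points congruent to `t`. -/
theorem weierstrassP_ne_of_half {t : ℂ} (ht2 : 2 * t ∈ M.lattice) (ht : t ∉ M.lattice) {z : ℂ}
    (hz : z ∉ M.lattice) (hzt : z - t ∉ M.lattice) : M.weierstrassP z ≠ M.weierstrassP t := by
  set e := M.weierstrassP t with he
  set f : ℂ → ℂ := fun z => M.weierstrassP z - e with hf
  have hfe : M.IsEllipticOff f := M.isEllipticOff_weierstrassP.sub (.const e)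
  have hf1 : HasLeadingTerm f 2 1 := by
    obtain ⟨g, hg, hg1, hPg⟩ := M.hasLeadingTerm_weierstrassP
    refine ⟨fun z => g z - z ^ 2 * e, by fun_prop, by simp [hg1], ?_⟩
    filter_upwards [hPg, self_mem_nhdsWithin] with z h1 h2
    have : z ≠ 0 := h2
    simp only [hf, h1]
    field_simp
  have hfneg : ∀ z, f (-z) = f z := fun z => by simp only [hf, M.weierstrassP_neg]
  have hshift : ∀ z, f (z + t) = f (z - t) := fun z => by
    rw [← hfe.periodic _ ht2 (z - t)]; congr 1; ring
  have hsan : ∀ z, z - t ∉ M.lattice → AnalyticAt ℂ (fun z => f (z - t)) z := fun z hz =>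
    AnalyticAt.comp (g := f) (f := fun z => z - t) (hfe.2 _ hz) (by fun_prop)
  have h0t : (0 : ℂ) - t ∉ M.lattice := M.sub_notMem_of_notMem ht (zero_mem _)
  -- As `2t` is a period, `z ↦ f(z - t)` is even; it vanishes at `0`, hence to order two. Its double
  -- zero cancels the double pole of `f`, so `f(z) f(z - t)` is free of poles and constant. A
  -- further zero of `f` would make this constant `0`.
  obtain ⟨d, hd⟩ : ∃ d, HasLeadingTerm (fun z => f (z - t) / z ^ 2) 0 d := by
    have h2 : HasLeadingTerm (fun z => f (z - t) / z ^ 2) 2 0 :=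
      ⟨_, hsan 0 h0t, by simp [hf, he, M.weierstrassP_neg], by simp⟩
    obtain ⟨c, hc⟩ := h2.reduce
    have : c = 0 := hc.eq_zero_of_even fun z => by
      rw [neg_sq, ← hfneg, ← hshift]; congr 2; ring
    rw [this] at hc
    exact hc.reduce
  have hprod : HasLeadingTerm (fun z => f z * f (z - t)) 0 (1 * d) := by
    refine (hf1.pow_mul_self.mul hd).congr ?_
    filter_upwards [self_mem_nhdsWithin] with z h2
    have : z ≠ 0 := h2
    field_simp
  obtain ⟨C, hC⟩ : ∃ C, ∀ z, ContinuousAt (fun z => f z * f (z - t)) z → f z * f (z - t) = C := by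
    have hper : ∀ l ∈ M.lattice, ∀ z, f (z + l) * f (z + l - t) = f z * f (z - t) := by
      intro l hl z
      rw [hfe.periodic l hl, add_sub_right_comm, hfe.periodic l hl]
    -- The product is invariant under translation by `t`, so the singularity at `t` is treated like
    -- the one at `0`.
    have hpt : ∀ z, f (z - t) * f (z - t - t) = f z * f (z - t) := by
      intro z
      rw [← hshift (z - t), sub_add_cancel, mul_comm]
    have key : ∀ x, (∀ z, f (z - x) * f (z - x - t) = f z * f (z - t)) →
        ∃ g : ℂ → ℂ, AnalyticAt ℂ g x ∧ (fun z => f z * f (z - t)) =ᶠ[𝓝[≠] x] g := by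
      intro x hx
      obtain ⟨g, hg, -, hFg⟩ := hprod
      refine ⟨fun w => g (w - x), ?_, ?_⟩
      · exact AnalyticAt.comp (g := g) (f := fun w : ℂ => w - x) (by simpa using hg) (by fun_prop)
      · have ht : Filter.Tendsto (fun w : ℂ => w - x) (𝓝[≠] x) (𝓝[≠] 0) := by
          have : ContinuousAt (fun w : ℂ => w - x) x := by fun_prop
          simpa using this.continuousWithinAt.tendsto_nhdsWithin (s := {x}ᶜ) (t := {0}ᶜ)
            (fun w hw => by simpa [sub_eq_zero] using hw)
        filter_upwards [ht.eventually hFg] with w hw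
        rw [← hx, hw, pow_zero, div_one]
    refine M.exists_const_of_removable hper fun x => ?_
    by_cases hx : x ∈ M.lattice
    · refine key x fun z => ?_
      have := hper x hx (z - x)
      rwa [sub_add_cancel, eq_comm] at this
    by_cases hxt : x - t ∈ M.lattice
    · refine key x fun z => ?_
      have := hper _ hxt (z - x)
      rw [show z - x + (x - t) = z - t by ring, hpt] at this
      exact this.symm
    · exact ⟨_, (hfe.2 x hx).mul (hsan x hxt), Filter.EventuallyEq.rfl⟩
  intro hzt0
  have hC0 : C = 0 := by
    rw [← hC z ((hfe.2 z hz).mul (hsan z hzt)).continuousAt]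
    simp [hf, hzt0]
  refine hfe.not_eventually_eq_zero hf1 one_ne_zero h0t ?_
  -- The product vanishes while `f` is nonzero near its pole, so the other factor vanishes near `0`:
  -- `f` is zero near `-t`, against `not_eventually_eq_zero`.
  have hev : ∀ᶠ z in 𝓝[≠] (0 : ℂ), f (z - t) = 0 := by
    have h1 : ∀ᶠ z in 𝓝[≠] (0 : ℂ), z ^ 2 * f z ≠ 0 :=
      hf1.tendsto.eventually_ne one_ne_zero
    have hm := mem_nhdsWithin_of_mem_nhds (t := {0}ᶜ) (M.compl_lattice_sdiff_singleton_mem_nhds 0)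
    have hm2 : ∀ᶠ z in 𝓝[≠] (0 : ℂ), z - t ∉ M.lattice := by
      have : ContinuousAt (fun z : ℂ => z - t) 0 := by fun_prop
      exact (this.eventually (M.isClosed_lattice.isOpen_compl.mem_nhds h0t)).filter_mono
        nhdsWithin_le_nhds
    filter_upwards [h1, hm, hm2, self_mem_nhdsWithin] with w h1 hw h2 hw0
    have hw : w ∉ M.lattice := fun h => hw ⟨h, hw0⟩
    have := hC w ((hfe.2 w hw).mul (hsan w h2)).continuousAt
    rw [hC0] at this
    exact (mul_eq_zero.1 this).resolve_left (right_ne_zero_of_mul h1)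
  have hev2 : ∀ᶠ z in 𝓝 (0 : ℂ), f (z - t) = 0 := by
    rcases (hsan 0 h0t).eventually_eq_zero_or_eventually_ne_zero with h | h
    · exact h
    · obtain ⟨w, hw⟩ := (h.and hev).exists
      exact absurd hw.2 hw.1
  have ht' : Filter.Tendsto (fun w : ℂ => w + t) (𝓝 (0 - t)) (𝓝 0) := by
    have : ContinuousAt (fun w : ℂ => w + t) (0 - t) := by fun_prop
    simpa [ContinuousAt] using this
  filter_upwards [ht'.eventually hev2] with w hw
  simpa using hw

end PeriodPair

/-! ### Elliptic functions for hexagonal lattices. -/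

namespace IsHexagonalPeriod

variable {M : PeriodPair} {v : ℂ}

lemma mem_lattice_left (h : IsHexagonalPeriod M v) : v ∈ M.lattice :=
  h.mem_iff.2 ⟨1, 0, by simp⟩

lemma omega6_mul_mem_lattice (h : IsHexagonalPeriod M v) : omega6 * v ∈ M.lattice :=
  h.omega6_mul_mem h.mem_lattice_left

lemma half_notMem (h : IsHexagonalPeriod M v) : v / 2 ∉ M.lattice := by
  simpa using h.add_mul_half_notMem (m := 1) (n := 0) (by simp)

lemma omega6_half_notMem (h : IsHexagonalPeriod M v) : omega6 * v / 2 ∉ M.lattice := by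
  simpa using h.add_mul_half_notMem (m := 0) (n := 1) (by simp)

lemma add_half_notMem (h : IsHexagonalPeriod M v) : (1 + omega6) * v / 2 ∉ M.lattice := by
  simpa using h.add_mul_half_notMem (m := 1) (n := 1) (by simp)

lemma g₃_eq (h : IsHexagonalPeriod M v) : M.g₃ = 4 * M.weierstrassP (v / 2) ^ 3 := by
  have := h.derivWeierstrassP_sq h.half_notMem
  rw [M.derivWeierstrassP_half h.mem_lattice_left] at this
  linear_combination this

/-- By the rotation laws, here `-ω₆ = ω₃²`, the values of `℘` at the three half periods are `℘(v/2)`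
times the three cube roots of unity. -/
lemma weierstrassP_omega6_half (h : IsHexagonalPeriod M v) :
    M.weierstrassP (omega6 * v / 2) = omega3 ^ 2 * M.weierstrassP (v / 2) := by
  rw [mul_div_assoc, h.weierstrassP_omega6_mul, omega3_sq, omega6_eq_add]; ring

lemma weierstrassP_add_half (h : IsHexagonalPeriod M v) :
    M.weierstrassP ((1 + omega6) * v / 2) = omega3 * M.weierstrassP (v / 2) := by
  rw [← h.weierstrassP_omega3_mul, ← M.weierstrassP_sub_coe _ ⟨v, h.mem_lattice_left⟩]
  congr 1
  rw [omega6_eq_add]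
  ring

/-- If it were zero, `℘` would take the same value at the incongruent half periods `v/2` and
`ω₆v/2`. -/
lemma weierstrassP_half_ne_zero (h : IsHexagonalPeriod M v) : M.weierstrassP (v / 2) ≠ 0 := by
  intro h0
  have hne : M.weierstrassP (omega6 * v / 2) ≠ M.weierstrassP (v / 2) := by
    refine M.weierstrassP_ne_of_half (by rw [mul_div_cancel₀ _ two_ne_zero]; exact h.mem_lattice_left)
      h.half_notMem h.omega6_half_notMem ?_
    have := h.add_mul_half_notMem (m := -1) (n := 1) (by simp)
    convert this using 2
    push_cast; ring
  rw [h.weierstrassP_omega6_half, h0] at hne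
  simp at hne

/-- With `e = ℘(v/2)`, `℘'² = 4(℘³ - e³) = 4(℘ - e)(℘ - ω₃²e)(℘ - ω₃e)`, and each factor vanishes
only at its own half period. -/
lemma derivWeierstrassP_ne_zero (h : IsHexagonalPeriod M v) {z : ℂ}
    (hz : z ∉ (halfPair M).lattice) : M.derivWeierstrassP z ≠ 0 := by
  intro h0
  have hzM : z ∉ M.lattice := fun hM => hz (mem_halfPair_of_mem hM)
  have hsub : ∀ t, 2 * t ∈ M.lattice → t ∉ M.lattice → M.weierstrassP z - M.weierstrassP t ≠ 0 := by
    intro t ht2 ht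
    refine sub_ne_zero.2 (M.weierstrassP_ne_of_half ht2 ht hzM fun hzt => hz ?_)
    have := add_mem (mem_halfPair_of_mem hzt) (halfPair_mem_lattice.2 ht2)
    rwa [sub_add_cancel] at this
  have h2 : ∀ x : ℂ, 2 * (x / 2) = x := fun x => mul_div_cancel₀ _ two_ne_zero
  have h1 := hsub (v / 2) (by rw [h2]; exact h.mem_lattice_left) h.half_notMem
  have h3 := hsub (omega6 * v / 2) (by rw [h2]; exact h.omega6_mul_mem_lattice) h.omega6_half_notMem
  have h4 := hsub ((1 + omega6) * v / 2) (by
    rw [h2, add_mul, one_mul]; exact add_mem h.mem_lattice_left h.omega6_mul_mem_lattice)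
    h.add_half_notMem
  have hsq := h.derivWeierstrassP_sq hzM
  rw [h0, h.g₃_eq] at hsq
  rw [h.weierstrassP_omega6_half] at h3
  rw [h.weierstrassP_add_half] at h4
  refine mul_ne_zero (mul_ne_zero h1 h3) h4 ?_
  set p := M.weierstrassP z
  set e := M.weierstrassP (v / 2)
  linear_combination (-1 / 4) * hsq - e * p ^ 2 * omega3_sq + (p * e ^ 2 - e ^ 3) * omega3_pow_three
     + p * e ^ 2 * omega3_sq

/-- Differentiate `℘'² = 4℘³ - g₃`, cancel `℘'` where it is nonzero, and extend by continuity, since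
`℘'` vanishes on no open set. -/
lemma deriv_derivWeierstrassP (h : IsHexagonalPeriod M v) {z : ℂ} (hz : z ∉ M.lattice) :
    deriv M.derivWeierstrassP z = 6 * M.weierstrassP z ^ 2 := by
  have hd : ∀ w, w ∉ M.lattice → HasDerivAt M.weierstrassP (M.derivWeierstrassP w) w := by
    intro w hw
    rw [← M.deriv_weierstrassP]
    exact (M.analyticOnNhd_weierstrassP w hw).differentiableAt.hasDerivAt
  have hmul : ∀ w, w ∉ M.lattice → M.derivWeierstrassP w *
      (deriv M.derivWeierstrassP w - 6 * M.weierstrassP w ^ 2) = 0 := by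
    intro w hw
    have h1 := ((M.analyticOnNhd_derivWeierstrassP w hw).differentiableAt.hasDerivAt).pow 2
    have h2 := (((hd w hw).pow 3).const_mul 4).sub_const M.g₃
    have h3 : (fun w => 4 * M.weierstrassP w ^ 3 - M.g₃) =ᶠ[𝓝 w]
        fun w => M.derivWeierstrassP w ^ 2 := by
      filter_upwards [M.isClosed_lattice.isOpen_compl.mem_nhds hw] with x hx
      rw [h.derivWeierstrassP_sq hx]
    have h4 := h1.unique (h2.congr_of_eventuallyEq h3.symm)
    simp at h4
    linear_combination h4 / 2
  rcases (M.analyticOnNhd_derivWeierstrassP z hz).eventually_eq_zero_or_eventually_ne_zero with h0 | h0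
  · exact absurd h0 (M.isEllipticOff_derivWeierstrassP.not_eventually_eq_zero
      M.hasLeadingTerm_derivWeierstrassP (by norm_num) hz)
  · refine eq_of_eventuallyEq_nhdsNE (f := deriv M.derivWeierstrassP)
      (g := fun z => 6 * M.weierstrassP z ^ 2)
      (M.analyticOnNhd_derivWeierstrassP z hz).deriv.continuousAt ?_ ?_
    · have := (M.analyticOnNhd_weierstrassP z hz).continuousAt
      fun_prop
    · filter_upwards [h0, mem_nhdsWithin_of_mem_nhds
        (M.isClosed_lattice.isOpen_compl.mem_nhds hz)] with w h1 h2
      exact sub_eq_zero.1 ((mul_eq_zero.1 (hmul w h2)).resolve_left h1)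

/-- There is no elliptic function whose only pole is simple. -/
lemma exists_const_of_simple_pole (h : IsHexagonalPeriod M v) {F : ℂ → ℂ}
    (hF : M.IsEllipticOff F) {c : ℂ} (h0 : HasLeadingTerm F 1 c) :
    ∃ k, ∀ z, z ∉ M.lattice → F z = k := by
  obtain ⟨k, hk⟩ := hF.exists_const_add_comp_neg h0
  -- Subtracting `c²℘` removes the double pole of `(F - k/2)²`; at most a simple pole remains, so
  -- the even part of the difference is again constant. At a half period `F = k/2`, because `l/2`
  -- and `-l/2` are congruent.
  have hQ : M.IsEllipticOff fun z => (F z - k / 2) ^ 2 - c ^ 2 * M.weierstrassP z :=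
    ((hF.sub (.const _)).pow 2).sub ((PeriodPair.IsEllipticOff.const _).mul
      M.isEllipticOff_weierstrassP)
  have hlead : HasLeadingTerm (fun z => (F z - k / 2) ^ 2 - c ^ 2 * M.weierstrassP z) 2 0 := by
    have h1 : HasLeadingTerm (fun z => F z - k / 2) 1 c := by
      obtain ⟨g, hg, hg1, hPg⟩ := h0
      refine ⟨fun z => g z - z * (k / 2), by fun_prop, by simp [hg1], ?_⟩
      filter_upwards [hPg, self_mem_nhdsWithin] with z h1 h2
      have : z ≠ 0 := h2
      rw [h1]
      field_simp
    have := (h1.pow 2).sub (M.hasLeadingTerm_weierstrassP.const_mul (c ^ 2))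
    simpa using this
  obtain ⟨c', hc'⟩ := hlead.reduce
  obtain ⟨d, hd⟩ := hQ.exists_const_add_comp_neg hc'
  have hodd : ∀ l ∈ M.lattice, l / 2 ∉ M.lattice → F (l / 2) = k / 2 := by
    intro l hl hl2
    have h1 := hk _ hl2
    have h2 := hF.periodic l hl (-(l / 2))
    rw [show -(l / 2) + l = l / 2 by ring] at h2
    rw [← h2] at h1
    linear_combination h1 / 2
  have e1 := hd _ h.half_notMem
  have e2 := hd _ h.omega6_half_notMem
  have hneg : ∀ l ∈ M.lattice, F (-(l / 2)) = F (l / 2) := by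
    intro l hl
    have h2 := hF.periodic l hl (-(l / 2))
    rwa [show -(l / 2) + l = l / 2 by ring, eq_comm] at h2
  simp only [M.weierstrassP_neg, hneg _ h.mem_lattice_left, hneg _ h.omega6_mul_mem_lattice,
    hodd _ h.mem_lattice_left h.half_notMem,
    hodd _ h.omega6_mul_mem_lattice h.omega6_half_notMem, h.weierstrassP_omega6_half] at e1 e2
  -- Comparing two half periods gives `c²e = c²ω₃²e` with `e = ℘(v/2) ≠ 0`.
  have hc : c = 0 := by
    have h3 : c ^ 2 * M.weierstrassP (v / 2) * (omega3 - 1) * (omega3 + 1) = 0 := by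
      linear_combination (e1 - e2) / 2
    have h4 : omega3 + 1 ≠ 0 := by rw [← omega6_eq_add]; exact omega6_ne_zero
    have h5 : omega3 - 1 ≠ 0 := sub_ne_zero.2 omega3_ne_one
    simpa [h4, h5, h.weierstrassP_half_ne_zero] using h3
  rw [hc] at h0
  obtain ⟨c'', h0⟩ := HasLeadingTerm.reduce (n := 0) h0
  exact hF.exists_const h0

/-- Elliptic functions with poles in the lattice only are polynomials in `℘` and `℘'`. -/
theorem exists_mem_adjoin (h : IsHexagonalPeriod M v) (n : ℕ) : ∀ {F : ℂ → ℂ} {c : ℂ},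
    M.IsEllipticOff F → HasLeadingTerm F n c →
    ∃ Q ∈ Algebra.adjoin ℂ {M.weierstrassP, M.derivWeierstrassP}, ∀ z, z ∉ M.lattice → F z = Q z := by
  have hconst : ∀ {F : ℂ → ℂ}, (∃ k, ∀ z, z ∉ M.lattice → F z = k) →
      ∃ Q ∈ Algebra.adjoin ℂ {M.weierstrassP, M.derivWeierstrassP},
        ∀ z, z ∉ M.lattice → F z = Q z := by
    rintro F ⟨k, hk⟩
    exact ⟨algebraMap ℂ (ℂ → ℂ) k, Subalgebra.algebraMap_mem _ _, hk⟩
  induction n with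
  | zero => exact fun hF h0 => hconst (hF.exists_const h0)
  | succ n ih =>
    intro F c hF h0
    rcases n with _ | n
    · exact hconst (h.exists_const_of_simple_pole hF h0)
    -- Every pole order at least `2` is attained by some `℘ᵃ ℘'ᵇ`, with leading coefficient `(-2)ᵇ`;
    -- order `1` was excluded by the previous case.
    obtain ⟨a, b, hab⟩ : ∃ a b : ℕ, a * 2 + b * 3 = n + 1 + 1 := by
      rcases Nat.even_or_odd' n with ⟨k, rfl | rfl⟩
      · exact ⟨k + 1, 0, by ring⟩
      · exact ⟨k, 1, by ring⟩
    have hB : HasLeadingTerm (fun z => M.weierstrassP z ^ a * M.derivWeierstrassP z ^ b) (n + 1 + 1)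
        ((-2) ^ b) := by
      rw [← hab]
      simpa using (M.hasLeadingTerm_weierstrassP.pow a).mul
        (M.hasLeadingTerm_derivWeierstrassP.pow b)
    have hBe : M.IsEllipticOff fun z => M.weierstrassP z ^ a * M.derivWeierstrassP z ^ b :=
      (M.isEllipticOff_weierstrassP.pow a).mul (M.isEllipticOff_derivWeierstrassP.pow b)
    have hsub := h0.sub (hB.const_mul (c / (-2) ^ b))
    rw [div_mul_cancel₀ _ (pow_ne_zero _ (by norm_num)), sub_self] at hsub
    obtain ⟨c', hc'⟩ := hsub.reduce
    obtain ⟨Q, hQ, hFQ⟩ := ih (hF.sub ((PeriodPair.IsEllipticOff.const _).mul hBe)) hc'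
    refine ⟨Q + (c / (-2) ^ b) • (M.weierstrassP ^ a * M.derivWeierstrassP ^ b), ?_, ?_⟩
    · exact add_mem hQ (Subalgebra.smul_mem _ (mul_mem
        (pow_mem (Algebra.subset_adjoin (by simp)) _) (pow_mem (Algebra.subset_adjoin (by simp)) _)) _)
    · intro z hz
      have := hFQ z hz
      simp only [Pi.add_apply, Pi.smul_apply, Pi.mul_apply, Pi.pow_apply, smul_eq_mul]
      linear_combination this

end IsHexagonalPeriod

/-! ### The functions `p₀`, `p₁`, `p₂` -/

lemma hasLeadingTerm_one_div {f : ℂ → ℂ} {d : ℂ} (hf : AnalyticAt ℂ f 0) (h0 : f 0 = 0)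
    (hd : deriv f 0 = d) (hd0 : d ≠ 0) : HasLeadingTerm (fun z => 1 / f z) 1 (1 / d) := by
  have : (1 : ℕ) ≤ analyticOrderAt f 0 := by
    rw [Nat.cast_one, Order.one_le_iff_ne_zero, hf.analyticOrderAt_ne_zero]
    exact h0
  obtain ⟨g, hg, hfg⟩ := (natCast_le_analyticOrderAt hf).1 this
  simp only [sub_zero, pow_one, smul_eq_mul] at hfg
  have hg0 : g 0 = d := by
    have h1 : HasDerivAt (fun z => z * g z) (1 * g 0 + 0 * deriv g 0) 0 :=
      (hasDerivAt_id (0 : ℂ)).mul hg.differentiableAt.hasDerivAt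
    have h2 := (h1.congr_of_eventuallyEq hfg).deriv
    rw [← hd, h2]
    ring
  refine ⟨fun z => 1 / g z, ?_, by simp only [hg0], ?_⟩
  · have : g 0 ≠ 0 := by rwa [hg0]
    fun_prop (disch := assumption)
  · filter_upwards [hfg.filter_mono nhdsWithin_le_nhds] with z hz
    rw [hz, pow_one, div_div, mul_comm]

lemma PeriodPair.meromorphic_recipDeriv (L : PeriodPair) : Meromorphic (recipDeriv L) := by
  intro z
  exact (MeromorphicAt.const 1 z).div (L.meromorphic_derivWeierstrassP z)

lemma recipDeriv_add {L : PeriodPair} {l : ℂ} (hl : l ∈ L.lattice) (z : ℂ) :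
    recipDeriv L (z + l) = recipDeriv L z := by
  rw [recipDeriv, recipDeriv, L.derivWeierstrassP_add_coe z ⟨l, hl⟩]

lemma recipDeriv_neg (L : PeriodPair) (z : ℂ) : recipDeriv L (-z) = -recipDeriv L z := by
  rw [recipDeriv, recipDeriv, L.derivWeierstrassP_neg, div_neg]

/-- At the origin `1/℘'` has a triple zero. It is recorded as a simple pole with coefficient `0` so
that it can be added to the translates of `1/℘'`, which do have simple poles there. -/
lemma hasLeadingTerm_recipDeriv (L : PeriodPair) : HasLeadingTerm (recipDeriv L) 1 0 := by
  obtain ⟨g, hg, hg1, hPg⟩ := L.hasLeadingTerm_derivWeierstrassP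
  refine ⟨fun z => z ^ 4 / g z, ?_, by simp, ?_⟩
  · have : g 0 ≠ 0 := by rw [hg1]; norm_num
    fun_prop (disch := assumption)
  · filter_upwards [hPg, self_mem_nhdsWithin] with z h1 h2
    have : z ≠ 0 := h2
    rw [recipDeriv, h1]
    field_simp

namespace IsHexagonalPeriod

variable {L : PeriodPair} {u : ℂ}

lemma recipDeriv_omega3_mul (h : IsHexagonalPeriod L u) (z : ℂ) :
    recipDeriv L (omega3 * z) = recipDeriv L z := by
  rw [recipDeriv, recipDeriv, h.derivWeierstrassP_omega3_mul]

lemma analyticAt_recipDeriv (h : IsHexagonalPeriod L u) {z : ℂ} (hz : z ∉ (halfPair L).lattice) :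
    AnalyticAt ℂ (recipDeriv L) z :=
  analyticAt_const.div (L.analyticOnNhd_derivWeierstrassP z fun hL => hz (mem_halfPair_of_mem hL))
    (h.derivWeierstrassP_ne_zero hz)

/-- `℘'` has a simple zero at a half period `t`, with slope `℘''(t) = 6℘(t)²`; the residue of the
reciprocal is the inverse of the slope. -/
lemma hasLeadingTerm_recipDeriv_sub (h : IsHexagonalPeriod L u) {t : ℂ} (ht2 : 2 * t ∈ L.lattice)
    (ht : t ∉ L.lattice) (h0 : L.weierstrassP t ≠ 0) :
    HasLeadingTerm (fun z => recipDeriv L (z - t)) 1 (1 / (6 * L.weierstrassP t ^ 2)) := by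
  have h1 : (0 : ℂ) - t ∉ L.lattice := L.sub_notMem_of_notMem ht (zero_mem _)
  refine hasLeadingTerm_one_div (f := fun z => L.derivWeierstrassP (z - t)) ?_ ?_ ?_ ?_
  · exact AnalyticAt.comp (g := L.derivWeierstrassP) (f := fun z => z - t)
      (L.analyticOnNhd_derivWeierstrassP _ h1) (by fun_prop)
  · have := L.derivWeierstrassP_half ht2
    rw [mul_div_cancel_left₀ _ two_ne_zero] at this
    rw [zero_sub, L.derivWeierstrassP_neg, this, neg_zero]
  · rw [deriv_comp_sub_const, h.deriv_derivWeierstrassP h1, zero_sub, L.weierstrassP_neg]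
  · exact mul_ne_zero (by norm_num) (pow_ne_zero _ h0)

lemma recipDeriv_sub_half (h : IsHexagonalPeriod L u) (z : ℂ) :
    recipDeriv L (z - u / 2 - u / 2) = recipDeriv L z := by
  rw [← recipDeriv_add h.mem_lattice_left]; congr 1; ring

lemma recipDeriv_sub_omega6_half (h : IsHexagonalPeriod L u) (z : ℂ) :
    recipDeriv L (z - omega6 * u / 2 - omega6 * u / 2) = recipDeriv L z := by
  rw [← recipDeriv_add h.omega6_mul_mem_lattice]; congr 1; ring

section shifts

/-- The sign patterns in the `pⱼ` are the characters of `½Λ/Λ`: under translation by `u/2` and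
`ω₆u/2` the signs are `(+,-)` for `p₂`, `(-,+)` for `p₁` and `(-,-)` for `p₀`. -/
lemma pTwo_sub_half (h : IsHexagonalPeriod L u) (z : ℂ) : pTwo L u (z - u / 2) = pTwo L u z := by
  rw [pTwo, pTwo, h.recipDeriv_sub_half,
    show z - u / 2 - u / 2 - omega6 * u / 2 = z - omega6 * u / 2 - u / 2 - u / 2 by ring,
    h.recipDeriv_sub_half]
  ring

lemma pTwo_sub_omega6_half (h : IsHexagonalPeriod L u) (z : ℂ) :
    pTwo L u (z - omega6 * u / 2) = - pTwo L u z := by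
  rw [pTwo, pTwo, h.recipDeriv_sub_omega6_half, sub_right_comm z (omega6 * u / 2) (u / 2),
    h.recipDeriv_sub_omega6_half]
  ring

lemma pOne_sub_half (h : IsHexagonalPeriod L u) (z : ℂ) : pOne L u (z - u / 2) = - pOne L u z := by
  rw [pOne, pOne, h.recipDeriv_sub_half,
    show z - u / 2 - u / 2 - omega6 * u / 2 = z - omega6 * u / 2 - u / 2 - u / 2 by ring,
    h.recipDeriv_sub_half]
  ring

lemma pOne_sub_omega6_half (h : IsHexagonalPeriod L u) (z : ℂ) :
    pOne L u (z - omega6 * u / 2) = pOne L u z := by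
  rw [pOne, pOne, h.recipDeriv_sub_omega6_half, sub_right_comm z (omega6 * u / 2) (u / 2),
    h.recipDeriv_sub_omega6_half]
  ring

lemma pZero_sub_half (h : IsHexagonalPeriod L u) (z : ℂ) :
    pZero L u (z - u / 2) = - pZero L u z := by
  rw [pZero, pZero, h.recipDeriv_sub_half,
    show z - u / 2 - u / 2 - omega6 * u / 2 = z - omega6 * u / 2 - u / 2 - u / 2 by ring,
    h.recipDeriv_sub_half]
  ring

lemma pZero_sub_omega6_half (h : IsHexagonalPeriod L u) (z : ℂ) :
    pZero L u (z - omega6 * u / 2) = - pZero L u z := by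
  rw [pZero, pZero, h.recipDeriv_sub_omega6_half, sub_right_comm z (omega6 * u / 2) (u / 2),
    h.recipDeriv_sub_omega6_half]
  ring

/-- Multiplication by `ω₃` fixes `1/℘'` and permutes the three nonzero classes of `½Λ/Λ` cyclically.
Hence it permutes the `pⱼ`, and only `p₂` needs analysis. -/
lemma recipDeriv_rotate (h : IsHexagonalPeriod L u) (z : ℂ) :
    recipDeriv L (omega3 * z - u / 2) = recipDeriv L (z - omega6 * u / 2) ∧
    recipDeriv L (omega3 * z - omega6 * u / 2) = recipDeriv L (z - u / 2 - omega6 * u / 2) ∧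
    recipDeriv L (omega3 * z - u / 2 - omega6 * u / 2) = recipDeriv L (z - u / 2) := by
  refine ⟨?_, ?_, ?_⟩
  · rw [← h.recipDeriv_omega3_mul (z - _), ← recipDeriv_add h.mem_lattice_left]
    congr 1
    rw [omega6_eq_add]; linear_combination (u / 2) * omega3_sq
  · rw [← h.recipDeriv_omega3_mul (z - _ - _), ← recipDeriv_add h.mem_lattice_left]
    congr 1
    rw [omega6_eq_add]; linear_combination (u / 2) * omega3_sq
  · rw [← h.recipDeriv_omega3_mul (z - _), ← recipDeriv_add h.mem_lattice_left]
    congr 1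
    rw [omega6_eq_add]; ring

lemma pTwo_omega3_mul (h : IsHexagonalPeriod L u) (z : ℂ) :
    pTwo L u (omega3 * z) = pOne L u z := by
  obtain ⟨h1, h2, h3⟩ := h.recipDeriv_rotate z
  rw [pTwo, pOne, h.recipDeriv_omega3_mul, h1, h2, h3]
  ring

lemma pOne_omega3_mul (h : IsHexagonalPeriod L u) (z : ℂ) :
    pOne L u (omega3 * z) = pZero L u z := by
  obtain ⟨h1, h2, h3⟩ := h.recipDeriv_rotate z
  rw [pOne, pZero, h.recipDeriv_omega3_mul, h1, h2, h3]
  ring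

lemma pZero_omega3_mul (h : IsHexagonalPeriod L u) (z : ℂ) :
    pZero L u (omega3 * z) = pTwo L u z := by
  obtain ⟨h1, h2, h3⟩ := h.recipDeriv_rotate z
  rw [pZero, pTwo, h.recipDeriv_omega3_mul, h1, h2, h3]
  ring

lemma pTwo_neg (h : IsHexagonalPeriod L u) (z : ℂ) : pTwo L u (-z) = -pTwo L u z := by
  have key : ∀ l ∈ L.lattice, recipDeriv L (-z - l / 2) = - recipDeriv L (z - l / 2) := by
    intro l hl
    rw [← recipDeriv_neg, ← recipDeriv_add hl]; congr 1; ring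
  have h3 := key _ (add_mem h.mem_lattice_left h.omega6_mul_mem_lattice)
  rw [add_div, ← sub_sub, ← sub_sub] at h3
  rw [pTwo, pTwo, recipDeriv_neg, key _ h.mem_lattice_left, key _ h.omega6_mul_mem_lattice, h3]
  ring

end shifts

lemma half_sub_notMem {L : PeriodPair} {z t : ℂ} (hz : z ∉ (halfPair L).lattice) (ht : t ∈ (halfPair L).lattice) :
    z - t ∉ (halfPair L).lattice := fun h => hz (by
  have := add_mem h ht
  rwa [sub_add_cancel] at this)

lemma half_mem (h : IsHexagonalPeriod L u) : u / 2 ∈ (halfPair L).lattice := h.half.mem_lattice_left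

lemma omega6_half_mem (h : IsHexagonalPeriod L u) : omega6 * u / 2 ∈ (halfPair L).lattice := by
  rw [mul_div_assoc]; exact h.half.omega6_mul_mem_lattice

lemma analyticAt_recipDeriv_sub (h : IsHexagonalPeriod L u) {z t : ℂ}
    (hz : z ∉ (halfPair L).lattice) (ht : t ∈ (halfPair L).lattice) :
    AnalyticAt ℂ (fun z => recipDeriv L (z - t)) z :=
  AnalyticAt.comp (g := recipDeriv L) (f := fun z => z - t)
      (h.analyticAt_recipDeriv (half_sub_notMem hz ht)) (by fun_prop)

lemma analyticAt_pTwo (h : IsHexagonalPeriod L u) {z : ℂ} (hz : z ∉ (halfPair L).lattice) :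
    AnalyticAt ℂ (pTwo L u) z := by
  have h3 := h.analyticAt_recipDeriv_sub hz (add_mem h.half_mem h.omega6_half_mem)
  simp only [← sub_sub] at h3
  exact (((h.analyticAt_recipDeriv hz).add (h.analyticAt_recipDeriv_sub hz h.half_mem)).sub
    (h.analyticAt_recipDeriv_sub hz h.omega6_half_mem)).sub h3

lemma meromorphic_pTwo (L : PeriodPair) (u : ℂ) : Meromorphic (pTwo L u) := by
  have key : ∀ t z : ℂ, MeromorphicAt (fun z => recipDeriv L (z - t)) z := fun t z =>
    MeromorphicAt.comp_analyticAt (f := recipDeriv L) (g := fun z => z - t)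
      (L.meromorphic_recipDeriv _) (by fun_prop)
  intro z
  have h3 := key (u / 2 + omega6 * u / 2) z
  simp only [← sub_sub] at h3
  exact (((L.meromorphic_recipDeriv z).add (key _ z)).sub (key _ z)).sub h3

lemma pTwo_add (u : ℂ) {l : ℂ} (hl : l ∈ L.lattice) (z : ℂ) :
    pTwo L u (z + l) = pTwo L u z := by
  simp only [pTwo, add_sub_right_comm _ l, recipDeriv_add hl]

/-- With `e = ℘(u/2)`, the residues at the three half periods sum to `(1 - ω₃⁻⁴ - ω₃⁻²)/(6e²)`, and
`1 - ω₃² - ω₃ = 2`. -/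
lemma hasLeadingTerm_pTwo (h : IsHexagonalPeriod L u) :
    HasLeadingTerm (pTwo L u) 1 (1 / (3 * L.weierstrassP (u / 2) ^ 2)) := by
  have h2 : ∀ x : ℂ, 2 * (x / 2) = x := fun x => mul_div_cancel₀ _ two_ne_zero
  have he := h.weierstrassP_half_ne_zero
  have hw := omega3_ne_zero
  have h1 := h.hasLeadingTerm_recipDeriv_sub (t := u / 2) (by rw [h2]; exact h.mem_lattice_left)
    h.half_notMem he
  have h3 := h.hasLeadingTerm_recipDeriv_sub (t := omega6 * u / 2)
    (by rw [h2]; exact h.omega6_mul_mem_lattice) h.omega6_half_notMem (by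
      rw [h.weierstrassP_omega6_half]; exact mul_ne_zero (pow_ne_zero _ hw) he)
  have h4 := h.hasLeadingTerm_recipDeriv_sub (t := (1 + omega6) * u / 2)
    (by rw [h2, add_mul, one_mul]; exact add_mem h.mem_lattice_left h.omega6_mul_mem_lattice)
    h.add_half_notMem (by
      rw [h.weierstrassP_add_half]; exact mul_ne_zero hw he)
  rw [h.weierstrassP_omega6_half] at h3
  rw [h.weierstrassP_add_half] at h4
  have := (((hasLeadingTerm_recipDeriv L).add h1).sub h3).sub h4
  convert this using 1
  · funext z
    rw [pTwo, add_mul, one_mul, add_div, sub_sub z]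
  · field_simp
    linear_combination 3 * (omega3 ^ 2 - omega3 + 1) * omega3_sq

lemma periodic_of_generators {M : PeriodPair} {v : ℂ} (h : IsHexagonalPeriod M v) {F : ℂ → ℂ}
    (h1 : ∀ z, F (z - v) = F z) (h2 : ∀ z, F (z - omega6 * v) = F z) :
    ∀ l ∈ M.lattice, ∀ z, F (z + l) = F z := by
  have h1' : Function.Periodic F v := fun z => by rw [← h1, add_sub_cancel_right]
  have h2' : Function.Periodic F (omega6 * v) := fun z => by rw [← h2, add_sub_cancel_right]
  intro l hl
  obtain ⟨m, n, rfl⟩ := h.mem_iff.1 hl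
  have := (h1'.int_mul m).add_period (h2'.int_mul n)
  intro z
  rw [← this z]; congr 1; ring

/-- The signs disappear on squaring, so `p₂²` is `½Λ`-periodic with a double pole. Subtracting the
right multiple of `℘` leaves at most a simple pole, hence a constant. -/
lemma pTwo_sq (h : IsHexagonalPeriod L u) {z : ℂ} (hz : z ∉ (halfPair L).lattice) :
    pTwo L u z ^ 2 = 1 / (9 * L.weierstrassP (u / 2) ^ 4) *
      ((halfPair L).weierstrassP z - 4 * L.weierstrassP (u / 2)) := by
  set s := 1 / (9 * L.weierstrassP (u / 2) ^ 4) with hs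
  have hell : (halfPair L).IsEllipticOff
      fun z => pTwo L u z ^ 2 - s * (halfPair L).weierstrassP z := by
    refine PeriodPair.IsEllipticOff.sub ⟨?_, fun z hz => (h.analyticAt_pTwo hz).pow 2⟩
      ((PeriodPair.IsEllipticOff.const _).mul (halfPair L).isEllipticOff_weierstrassP)
    refine periodic_of_generators h.half (F := fun z => pTwo L u z ^ 2) (fun z => ?_) (fun z => ?_)
    · rw [h.pTwo_sub_half]
    · rw [← mul_div_assoc, h.pTwo_sub_omega6_half, neg_sq]
  have hl := (h.hasLeadingTerm_pTwo.pow 2).sub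
    ((halfPair L).hasLeadingTerm_weierstrassP.const_mul s)
  have hl0 : (1 / (3 * L.weierstrassP (u / 2) ^ 2)) ^ 2 - s * 1 = 0 := by
    rw [hs]; have := h.weierstrassP_half_ne_zero; field_simp; norm_num
  rw [hl0] at hl
  obtain ⟨c, hc⟩ := hl.reduce
  obtain ⟨k, hk⟩ := h.half.exists_const_of_simple_pole hell hc
  have hk4 := hk _ h.half.half_notMem
  -- The constant is read off at `u/4`: `p₂` is odd and has period `u/2`, so it vanishes there,
  -- while `℘_{½Λ}(u/4) = 4℘(u/2)`.
  have hp4 : pTwo L u (u / 2 / 2) = 0 := by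
    have h1 := h.pTwo_neg (u / 2 / 2)
    rw [← h.pTwo_sub_half (u / 2 / 2), show u / 2 / 2 - u / 2 = - (u / 2 / 2) by ring] at h1
    have h2 := h.pTwo_neg (u / 2 / 2)
    rw [h2] at h1
    have := CharZero.eq_neg_self_iff.1 h1
    simpa using this
  rw [hp4, weierstrassP_halfPair, mul_div_cancel₀ _ two_ne_zero] at hk4
  linear_combination hk z hz - hk4

lemma pOne_sq (h : IsHexagonalPeriod L u) {z : ℂ} (hz : z ∉ (halfPair L).lattice) :
    pOne L u z ^ 2 = 1 / (9 * L.weierstrassP (u / 2) ^ 4) *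
      (omega3 * (halfPair L).weierstrassP z - 4 * L.weierstrassP (u / 2)) := by
  rw [← h.pTwo_omega3_mul, h.pTwo_sq (by rwa [h.half.omega3_mul_mem_iff]),
    h.half.weierstrassP_omega3_mul]

lemma pZero_sq (h : IsHexagonalPeriod L u) {z : ℂ} (hz : z ∉ (halfPair L).lattice) :
    pZero L u z ^ 2 = 1 / (9 * L.weierstrassP (u / 2) ^ 4) *
      (omega3 ^ 2 * (halfPair L).weierstrassP z - 4 * L.weierstrassP (u / 2)) := by
  rw [← h.pOne_omega3_mul, h.pOne_sq (by rwa [h.half.omega3_mul_mem_iff]),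
    h.half.weierstrassP_omega3_mul]
  ring

/-- The half-period values reduce the denominator of `β₂` to `3(ω₃ - 1)℘(u/2)³`. This form exhibits
`iκ` as `-(ω₃ - ω₃²)` times the common constant term of the `pⱼ²`. -/
lemma I_mul_kappa (h : IsHexagonalPeriod L u) :
    Complex.I * kappa L u = (omega3 - omega3 ^ 2) * (4 / (9 * L.weierstrassP (u / 2) ^ 3)) := by
  have he := h.weierstrassP_half_ne_zero
  have h1 : (L.weierstrassP (u / 2) - omega3 * L.weierstrassP (u / 2)) *
      (omega3 ^ 2 * L.weierstrassP (u / 2) - omega3 * L.weierstrassP (u / 2)) ^ 2 =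
      3 * (omega3 - 1) * L.weierstrassP (u / 2) ^ 3 := by
    linear_combination (L.weierstrassP (u / 2) ^ 3) *
      (- omega3 ^ 3 + 4 * omega3 ^ 2 - 6 * omega3 + 3) * omega3_sq
  have h2 : omega3 - 1 ≠ 0 := sub_ne_zero.2 omega3_ne_one
  rw [kappa, betaTwo, h.weierstrassP_omega6_half, h.weierstrassP_add_half, h1]
  have h3 : Complex.I * (-Complex.I * omega3 ^ 2 *
      (4 / (3 * (omega3 - 1) * L.weierstrassP (u / 2) ^ 3))) =
      omega3 ^ 2 * (4 / (3 * (omega3 - 1) * L.weierstrassP (u / 2) ^ 3)) := by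
    linear_combination (- omega3 ^ 2 * (4 / (3 * (omega3 - 1) * L.weierstrassP (u / 2) ^ 3))) *
      Complex.I_sq
  rw [h3]
  field_simp
  linear_combination 3 * omega3 * omega3_sq

lemma kappa_ne_zero (h : IsHexagonalPeriod L u) : kappa L u ≠ 0 := by
  intro h0
  have h1 := h.I_mul_kappa
  rw [h0, mul_zero, eq_comm] at h1
  have he := h.weierstrassP_half_ne_zero
  have h2 : omega3 - omega3 ^ 2 = -omega3 * (omega3 - 1) := by ring
  rw [h2] at h1
  simp [he, omega3_ne_zero, sub_eq_zero, omega3_ne_one] at h1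

end IsHexagonalPeriod

/-! ### Holomorphic maps between tori are affine -/

namespace Torus

lemma mk_eq_mk {L : PeriodPair} {z w : ℂ} : mk L z = mk L w ↔ z - w ∈ L.lattice :=
  Submodule.Quotient.eq _

lemma mk_surjective (L : PeriodPair) : Function.Surjective (mk L) :=
  Submodule.Quotient.mk_surjective _

lemma mk_zero (L : PeriodPair) : mk L 0 = 0 := rfl

lemma mk_eq_zero {L : PeriodPair} {z : ℂ} : mk L z = 0 ↔ z ∈ L.lattice :=
  Submodule.Quotient.mk_eq_zero _

lemma mk_add {L : PeriodPair} (z w : ℂ) : mk L (z + w) = mk L z + mk L w := rfl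

lemma mk_sub {L : PeriodPair} (z w : ℂ) : mk L (z - w) = mk L z - mk L w := rfl

end Torus

/-- Two lifts differ by a continuous function with values in a discrete set. -/
lemma eventually_sub_eq_of_mk_eq {M : PeriodPair} {f g : ℂ → ℂ} {w : ℂ} (hf : ContinuousAt f w)
    (hg : ContinuousAt g w) (h : ∀ᶠ x in 𝓝 w, Torus.mk M (f x) = Torus.mk M (g x)) :
    ∀ᶠ x in 𝓝 w, f x - g x = f w - g w := by
  have h1 := (hf.sub hg).eventually (M.compl_lattice_sdiff_singleton_mem_nhds _)
  filter_upwards [h, h1] with x hx hx1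
  by_contra hne
  exact hx1 ⟨Torus.mk_eq_mk.1 hx, hne⟩

lemma deriv_eq_of_mk_eq {M : PeriodPair} {f g : ℂ → ℂ} {w : ℂ} (hf : ContinuousAt f w)
    (hg : ContinuousAt g w) (h : ∀ᶠ x in 𝓝 w, Torus.mk M (f x) = Torus.mk M (g x)) :
    deriv f w = deriv g w := by
  have h1 : f =ᶠ[𝓝 w] fun x => g x + (f w - g w) := by
    filter_upwards [eventually_sub_eq_of_mk_eq hf hg h] with x hx
    rw [← hx]; ring
  rw [h1.deriv_eq, deriv_add_const]

lemma eq_of_forall_mk_affine_eq {M : PeriodPair} {a b a' b' : ℂ}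
    (h : ∀ z, Torus.mk M (a * z + b) = Torus.mk M (a' * z + b')) : a = a' := by
  have h1 := deriv_eq_of_mk_eq (w := 0) (f := fun z => a * z + b) (g := fun z => a' * z + b')
    (by fun_prop) (by fun_prop) (Filter.Eventually.of_forall h)
  simpa using h1

theorem IsHolomorphicMap.exists_affine {L M : PeriodPair} {φ : Torus L → Torus M}
    (hφ : IsHolomorphicMap L M φ) : ∃ a b : ℂ, ∀ z, φ (Torus.mk L z) = Torus.mk M (a * z + b) := by
  choose g hg hgφ using hφ
  -- Different local lifts differ locally by constants, so their derivatives glue to an entire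
  -- `Λ`-periodic function, which is constant.
  have hD : ∀ z, ∀ᶠ w in 𝓝 z, deriv (g w) w = deriv (g z) w := by
    intro z
    filter_upwards [(hgφ z).eventually_nhds, (hg z).eventually_analyticAt] with w h1 h2
    refine deriv_eq_of_mk_eq (M := M) (hg w).continuousAt h2.continuousAt ?_
    filter_upwards [h1, hgφ w] with x h3 h4
    rw [← h3, h4]
  have hd : Differentiable ℂ fun z => deriv (g z) z := fun z =>
    ((hg z).deriv.congr (by filter_upwards [hD z] with w hw using hw.symm)).differentiableAt
  have hper : ∀ z l, l ∈ L.lattice → deriv (g (z + l)) (z + l) = deriv (g z) z := by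
    intro z l hl
    have hc : ContinuousAt (fun x : ℂ => x + l) z := by fun_prop
    rw [← deriv_comp_add_const]
    refine deriv_eq_of_mk_eq (M := M) (ContinuousAt.comp (g := g (z + l)) (hg _).continuousAt hc)
      (hg z).continuousAt ?_
    filter_upwards [hc.eventually (hgφ (z + l)), hgφ z] with x h1 h2
    rw [← h1, ← h2]
    congr 1
    exact Torus.mk_eq_mk.2 (by simpa using hl)
  obtain ⟨a, ha⟩ : ∃ a, ∀ z, deriv (g z) z = a := ⟨_, fun z => hd.apply_eq_apply_of_bounded
    (IsZLattice.isCompact_range_of_periodic L.lattice _ hd.continuous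
      fun z w hw ↦ hper z w hw).isBounded z 0⟩
  -- With `a` the common derivative, subtracting `a x` leaves a map to the torus whose local lifts
  -- have derivative zero.
  have hq : IsLocallyConstant fun x => φ (Torus.mk L x) - Torus.mk M (a * x) := by
    rw [IsLocallyConstant.iff_eventually_eq]
    intro z
    have han : AnalyticAt ℂ (fun x => g z x - a * x) z := (hg z).sub (by fun_prop)
    have h0 : ∀ᶠ x in 𝓝 z, deriv (fun x => g z x - a * x) x = 0 := by
      filter_upwards [hD z, (hg z).eventually_analyticAt] with x h1 h2
      rw [ha] at h1
      rw [deriv_fun_sub h2.differentiableAt (by fun_prop), ← h1]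
      simp
    have h1 := han.analyticOrderAt_deriv_add_one
    -- An infinite vanishing order of the derivative forces the lift minus its value to vanish to
    -- infinite order, that is, identically near `z`.
    rw [analyticOrderAt_eq_top.2 h0, top_add, eq_comm, analyticOrderAt_eq_top] at h1
    filter_upwards [h1, hgφ z] with x h2 h3
    rw [h3, (hgφ z).self_of_nhds, ← Torus.mk_sub, ← Torus.mk_sub, sub_eq_zero.1 h2]
  obtain ⟨b, hb⟩ := Torus.mk_surjective M (φ (Torus.mk L 0) - Torus.mk M (a * 0))
  refine ⟨a, b, fun z => ?_⟩
  rw [Torus.mk_add, hb, ← hq.apply_eq_of_preconnectedSpace z 0, add_sub_cancel]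

/-- The linear parts of an isomorphism and its inverse are mutually inverse and carry one lattice
into the other, so `u` can be the linear part of the inverse. -/
lemma AreBiholomorphic.exists_isHexagonalPeriod {L : PeriodPair}
    (hL : AreBiholomorphic L hexagonal) : ∃ u, IsHexagonalPeriod L u := by
  obtain ⟨φ, h1, h2⟩ := hL
  obtain ⟨a, b, hab⟩ := h1.exists_affine
  obtain ⟨c, d, hcd⟩ := h2.exists_affine
  have hmem : ∀ {L M : PeriodPair} {ψ : Torus L → Torus M} {a b : ℂ},
      (∀ z, ψ (Torus.mk L z) = Torus.mk M (a * z + b)) → ∀ l ∈ L.lattice, a * l ∈ M.lattice := by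
    intro L M ψ a b h l hl
    have h1 := h l
    rw [Torus.mk_eq_mk.2 (show l - 0 ∈ L.lattice by simpa using hl), h 0, eq_comm,
      Torus.mk_eq_mk] at h1
    simpa using h1
  have hca : c * a = 1 := by
    refine eq_of_forall_mk_affine_eq (M := L) (b := c * b + d) (b' := 0) fun z => ?_
    have := hcd (a * z + b)
    rw [← hab, φ.symm_apply_apply] at this
    rw [one_mul, add_zero, this]
    congr 1; ring
  refine ⟨c, ?_⟩
  ext l
  rw [Submodule.mem_span_pair]
  simp only [zsmul_eq_mul]
  constructor
  · intro hl
    obtain ⟨m, n, hmn⟩ := PeriodPair.mem_lattice.1 (hmem hab l hl)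
    simp only [hexagonal] at hmn
    exact ⟨m, n, by linear_combination c * hmn + l * hca⟩
  · rintro ⟨m, n, rfl⟩
    have := hmem hcd (m * 1 + n * omega6) (PeriodPair.mem_lattice.2 ⟨m, n, rfl⟩)
    convert this using 1
    ring

/-! ### The group `A₄` of automorphisms of the hexagonal torus -/

namespace TorusAut

variable {L : PeriodPair}

/-- The linear part `a` of an automorphism `z ↦ a z + b` of a torus. -/
noncomputable def linearPart (L : PeriodPair) : TorusAut L →* ℂ where
  toFun φ := (IsHolomorphicMap.exists_affine φ.2.1).choose
  map_one' := by
    obtain ⟨b, hb⟩ := (IsHolomorphicMap.exists_affine (1 : TorusAut L).2.1).choose_spec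
    refine eq_of_forall_mk_affine_eq (M := L) (b := b) (b' := 0) fun z => ?_
    rw [← hb]
    simp
  map_mul' φ ψ := by
    obtain ⟨b, hb⟩ := (IsHolomorphicMap.exists_affine φ.2.1).choose_spec
    obtain ⟨c, hc⟩ := (IsHolomorphicMap.exists_affine ψ.2.1).choose_spec
    obtain ⟨d, hd⟩ := (IsHolomorphicMap.exists_affine (φ * ψ).2.1).choose_spec
    refine eq_of_forall_mk_affine_eq (M := L) (b := d)
      (b' := (IsHolomorphicMap.exists_affine φ.2.1).choose * c + b) fun z => ?_
    rw [← hd]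
    change φ.1 (ψ.1 _) = _
    rw [hc, hb]
    congr 1; ring

lemma exists_eq (φ : TorusAut L) :
    ∃ b : ℂ, ∀ z, φ.1 (Torus.mk L z) = Torus.mk L (linearPart L φ * z + b) :=
  (IsHolomorphicMap.exists_affine φ.2.1).choose_spec

lemma ext_mk {φ ψ : TorusAut L} (h : ∀ z, φ.1 (Torus.mk L z) = ψ.1 (Torus.mk L z)) : φ = ψ := by
  refine Subtype.ext (Equiv.ext fun x => ?_)
  obtain ⟨z, rfl⟩ := Torus.mk_surjective L x
  exact h z

end TorusAut

lemma kleinFour_normal : (alternatingGroup.kleinFour (Fin 4)).Normal :=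
  alternatingGroup.normal_kleinFour (by simp)

lemma kleinFour_mul_self {γ : alternatingGroup (Fin 4)}
    (hγ : γ ∈ alternatingGroup.kleinFour (Fin 4)) : γ * γ = 1 := by
  have h := Monoid.pow_exponent_eq_one (⟨γ, hγ⟩ : alternatingGroup.kleinFour (Fin 4))
  rw [alternatingGroup.exponent_kleinFour_of_card_eq_four (by simp), pow_two] at h
  exact congrArg Subtype.val h

lemma card_quotient_kleinFour :
    Nat.card (alternatingGroup (Fin 4) ⧸ alternatingGroup.kleinFour (Fin 4)) = 3 := by
  have h := Subgroup.card_eq_card_quotient_mul_card_subgroup (alternatingGroup.kleinFour (Fin 4))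
  rw [alternatingGroup.card_of_card_eq_four (by simp),
    alternatingGroup.kleinFour_card_of_card_eq_four (by simp)] at h
  omega

lemma pow_three_mem_kleinFour (γ : alternatingGroup (Fin 4)) :
    γ ^ 3 ∈ alternatingGroup.kleinFour (Fin 4) := by
  have := kleinFour_normal
  rw [← QuotientGroup.eq_one_iff, QuotientGroup.mk_pow, ← card_quotient_kleinFour,
    pow_card_eq_one']

/-- The quotient by the Klein four-group has prime order `3`, so any nontrivial class generates it.
-/
lemma exists_zpow_mul_kleinFour {γ₀ : alternatingGroup (Fin 4)}
    (h : γ₀ ∉ alternatingGroup.kleinFour (Fin 4)) (γ : alternatingGroup (Fin 4)) :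
    ∃ k : ℤ, ∃ δ ∈ alternatingGroup.kleinFour (Fin 4), γ = γ₀ ^ k * δ := by
  have := kleinFour_normal
  have : Fact (Nat.Prime 3) := ⟨by norm_num⟩
  have h1 := mem_zpowers_of_prime_card (p := 3) card_quotient_kleinFour
    (g := (γ₀ : alternatingGroup (Fin 4) ⧸ alternatingGroup.kleinFour (Fin 4)))
    (g' := (γ : alternatingGroup (Fin 4) ⧸ alternatingGroup.kleinFour (Fin 4)))
    (by rwa [Ne, QuotientGroup.eq_one_iff])
  obtain ⟨k, hk⟩ := h1
  refine ⟨k, (γ₀ ^ k)⁻¹ * γ, ?_, by group⟩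
  rw [← QuotientGroup.eq]
  simpa using hk

/-- Generators of `A₄` in its action on the hexagonal torus: `γ₀` acts by `z ↦ ω₃ z`, and
`γ₁, γ₂` generate the Klein four group, which acts by the translations by half periods. -/
structure IsA4Frame (L : PeriodPair) (u : ℂ) (σ : alternatingGroup (Fin 4) →* TorusAut L)
    (γ₀ γ₁ γ₂ : alternatingGroup (Fin 4)) : Prop where
  hex : IsHexagonalPeriod L u
  apply₀ : ∀ z, (σ γ₀).1 (Torus.mk L z) = Torus.mk L (omega3 * z)
  apply₁ : ∀ z, (σ γ₁).1 (Torus.mk L z) = Torus.mk L (z + u / 2)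
  apply₂ : ∀ z, (σ γ₂).1 (Torus.mk L z) = Torus.mk L (z + omega6 * u / 2)
  mem₁ : γ₁ ∈ alternatingGroup.kleinFour (Fin 4)
  mem₂ : γ₂ ∈ alternatingGroup.kleinFour (Fin 4)
  kleinFour : ∀ δ ∈ alternatingGroup.kleinFour (Fin 4), δ = 1 ∨ δ = γ₁ ∨ δ = γ₂ ∨ δ = γ₁ * γ₂
  exists_eq : ∀ γ, ∃ k : ℤ, ∃ δ ∈ alternatingGroup.kleinFour (Fin 4), γ = γ₀ ^ k * δ

lemma IsHexagonalPeriod.mk_half_mem {L : PeriodPair} {u : ℂ} (h : IsHexagonalPeriod L u) {b : ℂ}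
    (hb : b ∈ (halfPair L).lattice) : Torus.mk L b ∈ ({Torus.mk L 0, Torus.mk L (u / 2),
      Torus.mk L (omega6 * u / 2), Torus.mk L (u / 2 + omega6 * u / 2)} : Set (Torus L)) := by
  obtain ⟨m, n, rfl⟩ := h.half.mem_iff.1 hb
  simp only [Set.mem_insert_iff, Set.mem_singleton_iff, Torus.mk_eq_mk, h.mem_iff]
  rcases Int.even_or_odd' m with ⟨p, rfl | rfl⟩ <;> rcases Int.even_or_odd' n with ⟨q, rfl | rfl⟩
  · left; exact ⟨p, q, by push_cast; ring⟩
  · right; right; left; exact ⟨p, q, by push_cast; ring⟩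
  · right; left; exact ⟨p, q, by push_cast; ring⟩
  · right; right; right; exact ⟨p, q, by push_cast; ring⟩

theorem IsHexagonalPeriod.exists_isA4Frame {L : PeriodPair} {u : ℂ} (h : IsHexagonalPeriod L u)
    {σ : alternatingGroup (Fin 4) →* TorusAut L} (hσ : Function.Injective σ)
    (hfix : ∃ γ, γ ≠ 1 ∧ (σ γ).1 0 = 0) : ∃ γ₀ γ₁ γ₂, IsA4Frame L u σ γ₀ γ₁ γ₂ := by
  set V := alternatingGroup.kleinFour (Fin 4) with hV
  -- The Klein group is the commutator subgroup of `A₄`, and linear parts take values in a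
  -- commutative monoid; its elements are therefore translations.
  have hlin : ∀ δ ∈ V, TorusAut.linearPart L (σ δ) = 1 := by
    intro δ hδ
    rw [hV, alternatingGroup.kleinFour_eq_commutator (by simp)] at hδ
    have := Abelianization.commutator_subset_ker ((TorusAut.linearPart L).comp σ).toHomUnits hδ
    exact congrArg Units.val (MonoidHom.mem_ker.1 this)
  have htrans : ∀ δ ∈ V, ∀ z, (σ δ).1 (Torus.mk L z) = Torus.mk L z + (σ δ).1 0 := by
    intro δ hδ z
    obtain ⟨b, hb⟩ := TorusAut.exists_eq (σ δ)
    rw [hb, ← Torus.mk_zero, hb, hlin δ hδ, ← Torus.mk_add]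
    congr 1; ring
  have hinj : ∀ δ ∈ V, ∀ δ' ∈ V, (σ δ).1 0 = (σ δ').1 0 → δ = δ' := by
    intro δ hδ δ' hδ' h0
    exact hσ (TorusAut.ext_mk fun z => by rw [htrans δ hδ, htrans δ' hδ', h0])
  set T2 : Set (Torus L) := {Torus.mk L 0, Torus.mk L (u / 2),
      Torus.mk L (omega6 * u / 2), Torus.mk L (u / 2 + omega6 * u / 2)} with hT2
  have hrange : Set.range (fun δ : V => (σ δ.1).1 0) = T2 := by
    -- The translation vectors are `2`-torsion and pairwise distinct. There are four of them and at
    -- most four `2`-torsion points.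
    refine Set.eq_of_subset_of_ncard_le ?_ ?_ (Set.toFinite _)
    · rintro _ ⟨δ, rfl⟩
      obtain ⟨b, hb⟩ := Torus.mk_surjective L ((σ δ.1).1 0)
      simp only
      rw [← hb]
      refine h.mk_half_mem (halfPair_mem_lattice.2 ?_)
      have h1 : (σ (δ.1 * δ.1)).1 0 = 0 := by
        rw [kleinFour_mul_self δ.2, map_one]; rfl
      rw [map_mul] at h1
      change (σ δ.1).1 ((σ δ.1).1 0) = 0 at h1
      rw [← hb, htrans _ δ.2, ← hb, ← Torus.mk_add, Torus.mk_eq_zero] at h1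
      rwa [two_mul]
    · have hc : (Set.range (fun δ : V => (σ δ.1).1 0)).ncard = 4 := by
        rw [← Set.image_univ, Set.ncard_image_of_injective, Set.ncard_univ,
          alternatingGroup.kleinFour_card_of_card_eq_four (by simp)]
        exact fun δ δ' h0 => Subtype.ext (hinj _ δ.2 _ δ'.2 h0)
      rw [hc, hT2]
      refine (Set.ncard_insert_le _ _).trans ?_
      have := (Set.ncard_insert_le (Torus.mk L (u / 2)) {Torus.mk L (omega6 * u / 2),
        Torus.mk L (u / 2 + omega6 * u / 2)})
      have h3 := Set.ncard_insert_le (Torus.mk L (omega6 * u / 2)) {Torus.mk L (u / 2 + omega6 * u / 2)}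
      rw [Set.ncard_singleton] at h3
      omega
  obtain ⟨⟨γ₁, hγ₁⟩, h1⟩ : Torus.mk L (u / 2) ∈ Set.range (fun δ : V => (σ δ.1).1 0) := by
    rw [hrange]; simp [hT2]
  obtain ⟨⟨γ₂, hγ₂⟩, h2⟩ : Torus.mk L (omega6 * u / 2) ∈ Set.range (fun δ : V => (σ δ.1).1 0) := by
    rw [hrange]; simp [hT2]
  simp only at h1 h2
  obtain ⟨γ₀, hγ₀V, h0⟩ : ∃ γ₀, γ₀ ∉ V ∧ ∀ z, (σ γ₀).1 (Torus.mk L z) = Torus.mk L (omega3 * z) := by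
    obtain ⟨γ, hγ1, hγ0⟩ := hfix
    obtain ⟨c, hc, hγ⟩ : ∃ c, TorusAut.linearPart L (σ γ) = c ∧
        ∀ z, (σ γ).1 (Torus.mk L z) = Torus.mk L (c * z) := by
      obtain ⟨b, hb⟩ := TorusAut.exists_eq (σ γ)
      refine ⟨_, rfl, fun z => ?_⟩
      rw [← Torus.mk_zero, hb 0, mul_zero, zero_add] at hγ0
      rw [hb, Torus.mk_add, hγ0, Torus.mk_zero, add_zero]
    have hc1 : c ≠ 1 := by
      rintro rfl
      exact hγ1 (hσ (TorusAut.ext_mk fun z => by rw [hγ, map_one, one_mul]; rfl))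
    -- `γ³` lies in the Klein group, so its linear part is `1`; the multiplier `c` is thus `ω₃` or
    -- `ω₃²`.
    have hc3 : c ^ 3 = 1 := by
      rw [← hc, ← map_pow, ← map_pow, hlin _ (pow_three_mem_kleinFour γ)]
    have hc2 : (c - omega3) * (c - omega3 ^ 2) = 0 := by
      have : (c - 1) * ((c - omega3) * (c - omega3 ^ 2)) = 0 := by
        linear_combination hc3 + (-c ^ 2 + c) * omega3_sq + (c - 1) * omega3_pow_three
      exact (mul_eq_zero.1 this).resolve_left (sub_ne_zero.2 hc1)
    have hnot : ∀ γ' : alternatingGroup (Fin 4),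
        (∀ z, (σ γ').1 (Torus.mk L z) = Torus.mk L (omega3 * z)) → γ' ∉ V := by
      intro γ' h1 hV
      refine omega3_ne_one (eq_of_forall_mk_affine_eq (M := L) (b := 0) (b' := 0) fun z => ?_)
      rw [add_zero, ← h1, htrans γ' hV, ← Torus.mk_zero, h1, ← Torus.mk_add]
      congr 1; ring
    rcases mul_eq_zero.1 hc2 with h3 | h3
    · rw [sub_eq_zero.1 h3] at hγ
      exact ⟨γ, hnot _ hγ, hγ⟩
    -- For multiplier `ω₃²` the square of `γ` has multiplier `ω₃⁴ = ω₃`.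
    · have h4 : ∀ z, (σ (γ * γ)).1 (Torus.mk L z) = Torus.mk L (omega3 * z) := by
        intro z
        rw [map_mul]
        change (σ γ).1 ((σ γ).1 _) = _
        rw [hγ, hγ, sub_eq_zero.1 h3]
        congr 1; linear_combination omega3 * z * omega3_pow_three
      exact ⟨γ * γ, hnot _ h4, h4⟩
  refine ⟨γ₀, γ₁, γ₂, h, h0, fun z => ?_, fun z => ?_, hγ₁, hγ₂, fun δ hδ => ?_,
    exists_zpow_mul_kleinFour hγ₀V⟩
  · rw [htrans _ hγ₁, h1, Torus.mk_add]
  · rw [htrans _ hγ₂, h2, Torus.mk_add]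
  · have h3 : (σ δ).1 0 ∈ T2 := by rw [← hrange]; exact ⟨⟨δ, hδ⟩, rfl⟩
    have h12 : (σ (γ₁ * γ₂)).1 0 = Torus.mk L (u / 2 + omega6 * u / 2) := by
      rw [map_mul]
      change (σ γ₁).1 ((σ γ₂).1 _) = _
      rw [h2, htrans _ hγ₁, h1, ← Torus.mk_add, add_comm]
    rcases h3 with h3 | h3 | h3 | h3
    · exact Or.inl (hinj _ hδ _ (one_mem _) (by rw [h3, map_one]; rfl))
    · exact Or.inr (Or.inl (hinj _ hδ _ hγ₁ (by rw [h3, h1])))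
    · exact Or.inr (Or.inr (Or.inl (hinj _ hδ _ hγ₂ (by rw [h3, h2]))))
    · exact Or.inr (Or.inr (Or.inr (hinj _ hδ _ (mul_mem hγ₁ hγ₂) (by rw [h3, h12]))))

namespace IsA4Frame

variable {L : PeriodPair} {u : ℂ} {σ : alternatingGroup (Fin 4) →* TorusAut L}
  {γ₀ γ₁ γ₂ : alternatingGroup (Fin 4)}

lemma apply₀_zpow (h : IsA4Frame L u σ γ₀ γ₁ γ₂) (k : ℤ) : (σ (γ₀ ^ k)).1 0 = 0 := by
  have h0 : (σ γ₀).1 0 = 0 := by rw [← Torus.mk_zero, h.apply₀, mul_zero]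
  rw [map_zpow]
  exact Function.IsFixedPt.perm_zpow h0 k

lemma mem_zeroOrbit (h : IsA4Frame L u σ γ₀ γ₁ γ₂) {z : ℂ} :
    Torus.mk L z ∈ zeroOrbit σ ↔ z ∈ (halfPair L).lattice := by
  have h₁ : ∀ z, z + u / 2 ∈ (halfPair L).lattice ↔ z ∈ (halfPair L).lattice := fun z =>
    (halfPair L).lattice.add_mem_iff_left h.hex.half_mem
  have h₂ : ∀ z, z + omega6 * u / 2 ∈ (halfPair L).lattice ↔ z ∈ (halfPair L).lattice := fun z =>
    (halfPair L).lattice.add_mem_iff_left h.hex.omega6_half_mem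
  have hmem : ∀ {z w}, Torus.mk L z = Torus.mk L w → w ∈ (halfPair L).lattice →
      z ∈ (halfPair L).lattice := by
    intro z w hzw hw
    have := add_mem (mem_halfPair_of_mem (Torus.mk_eq_mk.1 hzw)) hw
    rwa [sub_add_cancel] at this
  constructor
  · rintro ⟨γ, hγ⟩
    -- Decomposing `γ⁻¹` instead of `γ` puts the power of `γ₀` first in the order of application,
    -- where it fixes the origin.
    obtain ⟨k, δ, hδ, hγ'⟩ := h.exists_eq γ⁻¹
    have h1 : (σ (δ⁻¹ * γ₀ ^ (-k))).1 0 = Torus.mk L z := by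
      rw [zpow_neg, ← mul_inv_rev, ← hγ', inv_inv]
      exact hγ
    rw [map_mul] at h1
    change (σ δ⁻¹).1 ((σ (γ₀ ^ (-k))).1 0) = _ at h1
    rw [h.apply₀_zpow, ← Torus.mk_zero] at h1
    rcases h.kleinFour _ (inv_mem hδ) with h2 | h2 | h2 | h2 <;> rw [h2] at h1
    · rw [map_one] at h1
      exact hmem h1.symm (zero_mem _)
    · rw [h.apply₁] at h1
      exact hmem h1.symm ((h₁ 0).2 (zero_mem _))
    · rw [h.apply₂] at h1
      exact hmem h1.symm ((h₂ 0).2 (zero_mem _))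
    · rw [map_mul] at h1
      change (σ γ₁).1 ((σ γ₂).1 _) = _ at h1
      rw [h.apply₂, h.apply₁] at h1
      exact hmem h1.symm ((h₁ _).2 ((h₂ 0).2 (zero_mem _)))
  · intro hz
    rcases h.hex.mk_half_mem hz with h1 | h1 | h1 | h1
    · exact ⟨1, by simp only; rw [h1, map_one]; rfl⟩
    · exact ⟨γ₁, by simp only; rw [h1, ← Torus.mk_zero, h.apply₁, zero_add]⟩
    · exact ⟨γ₂, by simp only; rw [h1, ← Torus.mk_zero, h.apply₂, zero_add]⟩
    · refine ⟨γ₁ * γ₂, ?_⟩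
      simp only
      rw [map_mul]
      change (σ γ₁).1 ((σ γ₂).1 _) = _
      rw [h1, ← Torus.mk_zero, h.apply₂, h.apply₁, zero_add, add_comm]

end IsA4Frame

/-! ### Regular functions on the punctured torus as functions of `z` -/

namespace IsGivenBy

variable {L : PeriodPair} {S : Set (Torus L)} {f g : RegularFunctions L S} {F G : ℂ → ℂ}

lemma eq_of_eq (hf : IsGivenBy f F) (hg : IsGivenBy g G)
    (h : ∀ z, Torus.mk L z ∉ S → F z = G z) : f = g := by
  refine Subtype.ext (funext fun x => ?_)
  obtain ⟨x, hx⟩ := x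
  obtain ⟨z, rfl⟩ := Torus.mk_surjective L x
  rw [hf z hx, hg z hx, h z hx]

lemma add (hf : IsGivenBy f F) (hg : IsGivenBy g G) : IsGivenBy (f + g) (F + G) := fun z hz => by
  simp [hf z hz, hg z hz]

lemma mul (hf : IsGivenBy f F) (hg : IsGivenBy g G) : IsGivenBy (f * g) (F * G) := fun z hz => by
  simp [hf z hz, hg z hz]

lemma neg (hf : IsGivenBy f F) : IsGivenBy (-f) (-F) := fun z hz => by
  simp [hf z hz]

lemma pow (hf : IsGivenBy f F) (n : ℕ) : IsGivenBy (f ^ n) (F ^ n) := fun z hz => by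
  simp [hf z hz]

lemma smul (c : ℂ) (hf : IsGivenBy f F) : IsGivenBy (c • f) (c • F) := fun z hz => by
  simp [hf z hz]

lemma algebraMap (c : ℂ) :
    IsGivenBy (algebraMap ℂ (RegularFunctions L S) c) (algebraMap ℂ (ℂ → ℂ) c) := fun _ _ => rfl

lemma pushFunction {φ : TorusAut L} (hφ : ∀ x, φ.1 x ∈ S ↔ x ∈ S) (hf : IsGivenBy f F)
    {ψ : ℂ → ℂ} (hψ : ∀ z, φ.1 (Torus.mk L (ψ z)) = Torus.mk L z) :
    IsGivenBy (pushFunction φ hφ f) (F ∘ ψ) := by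
  intro z hz
  have h1 : φ.1.symm (Torus.mk L z) = Torus.mk L (ψ z) := by
    rw [Equiv.symm_apply_eq, hψ]
  have h2 : Torus.mk L (ψ z) ∉ S := by rwa [← hφ, hψ]
  rw [Function.comp_apply, ← hf _ h2]
  exact congrArg f.1 (Subtype.ext h1)

lemma exists_mem_adjoin {f' : RegularFunctions L S} {F' : ℂ → ℂ} (hf : IsGivenBy f F)
    (hf' : IsGivenBy f' F') {Q : ℂ → ℂ} (hQ : Q ∈ Algebra.adjoin ℂ {F, F'}) :
    ∃ q ∈ Algebra.adjoin ℂ {f, f'}, IsGivenBy q Q := by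
  induction hQ using Algebra.adjoin_induction with
  | mem x hx =>
    rcases hx with rfl | rfl
    · exact ⟨f, Algebra.subset_adjoin (by simp), hf⟩
    · exact ⟨f', Algebra.subset_adjoin (by simp), hf'⟩
  | algebraMap c => exact ⟨_, Subalgebra.algebraMap_mem _ c, algebraMap c⟩
  | add x y _ _ hx hy =>
    obtain ⟨q, hq, hq'⟩ := hx
    obtain ⟨r, hr, hr'⟩ := hy
    exact ⟨q + r, add_mem hq hr, hq'.add hr'⟩
  | mul x y _ _ hx hy =>
    obtain ⟨q, hq, hq'⟩ := hx
    obtain ⟨r, hr, hr'⟩ := hy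
    exact ⟨q * r, mul_mem hq hr, hq'.mul hr'⟩

end IsGivenBy

namespace RegularFunctions

variable {L : PeriodPair} {S : Set (Torus L)}

lemma exists_isGivenBy {F : ℂ → ℂ}
    (hper : ∀ l ∈ L.lattice, ∀ z, F (z + l) = F z) (hmer : Meromorphic F)
    (han : ∀ z, Torus.mk L z ∉ S → AnalyticAt ℂ F z) :
    ∃ f : RegularFunctions L S, IsGivenBy f F := by
  have key : ∀ z, F (Function.surjInv (Torus.mk_surjective L) (Torus.mk L z)) = F z := by
    intro z
    have h1 := Function.surjInv_eq (Torus.mk_surjective L) (Torus.mk L z)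
    have := hper _ (Torus.mk_eq_mk.1 h1) z
    rw [add_sub_cancel] at this
    exact this
  refine ⟨⟨fun x => F (Function.surjInv (Torus.mk_surjective L) x.1), fun z hz => ⟨F, han z hz, ?_⟩,
    fun z _ => ⟨F, hmer z, ?_⟩⟩, fun z _ => key z⟩
  all_goals exact Filter.Eventually.of_forall fun w _ => key w

/-- The value `0` at the punctures keeps every translation symmetry by `½Λ` valid at all points.
Meromorphy is stated at `0` only, since the functions it serves are `½Λ`-periodic. -/
lemma exists_lift (hS : ∀ z, Torus.mk L z ∈ S ↔ z ∈ (halfPair L).lattice)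
    (f : RegularFunctions L S) : ∃ F : ℂ → ℂ, IsGivenBy f F ∧
      (∀ z, z ∉ (halfPair L).lattice → AnalyticAt ℂ F z) ∧ MeromorphicAt F 0 ∧
      ∀ z, z ∈ (halfPair L).lattice → F z = 0 := by
  classical
  set F : ℂ → ℂ := fun z => if h : Torus.mk L z ∈ S then 0 else f.1 ⟨Torus.mk L z, h⟩ with hF
  have hmem : ∀ z, z ∉ (halfPair L).lattice → Torus.mk L z ∉ S := fun z hz => by rwa [hS]
  refine ⟨F, fun z hz => by simp [hF, hz], fun z hz => ?_, ?_, fun z hz => by simp [hF, hS, hz]⟩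
  · obtain ⟨g, hg, hfg⟩ := f.2.1 z (hmem z hz)
    refine hg.congr ?_
    filter_upwards [hfg, (halfPair L).isClosed_lattice.isOpen_compl.mem_nhds hz] with w h1 h2
    rw [hF]
    simp only [hmem w h2, dite_false]
    exact (h1 (hmem w h2)).symm
  · obtain ⟨g, hg, hfg⟩ := f.2.2 0 ((hS 0).2 (zero_mem _))
    refine hg.congr ?_
    filter_upwards [hfg.filter_mono nhdsWithin_le_nhds, mem_nhdsWithin_of_mem_nhds
      ((halfPair L).compl_lattice_sdiff_singleton_mem_nhds 0), self_mem_nhdsWithin] with w h1 h2 h3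
    have h4 : w ∉ (halfPair L).lattice := fun h => h2 ⟨h, h3⟩
    rw [hF]
    simp only [hmem w h4, dite_false]
    exact (h1 (hmem w h4)).symm

end RegularFunctions

/-! ### Elementary algebra of invariants -/

lemma MeromorphicAt.exists_hasLeadingTerm {F : ℂ → ℂ} (hF : MeromorphicAt F 0) :
    ∃ n c, HasLeadingTerm F n c := by
  obtain ⟨n, hn⟩ := hF
  refine ⟨n, _, _, hn, rfl, ?_⟩
  filter_upwards [self_mem_nhdsWithin] with z hz
  have : z ≠ 0 := hz
  simp only [sub_zero, smul_eq_mul]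
  field_simp

/-- Since `x` is integral of degree three over `ℂ[y]`, the combinations of `1, x, x²` are closed
under multiplication. -/
lemma exists_eq_of_mem_adjoin_pair {A : Type*} [CommRing A] [Algebra ℂ A] {x y : A}
    (hx : x ^ 3 ∈ Algebra.adjoin ℂ {y}) {r : A} (hr : r ∈ Algebra.adjoin ℂ {x, y}) :
    ∃ a ∈ Algebra.adjoin ℂ {y}, ∃ b ∈ Algebra.adjoin ℂ {y}, ∃ c ∈ Algebra.adjoin ℂ {y},
      r = a + b * x + c * x ^ 2 := by
  induction hr using Algebra.adjoin_induction with
  | mem z hz =>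
    rcases hz with rfl | rfl
    · exact ⟨0, zero_mem _, 1, one_mem _, 0, zero_mem _, by ring⟩
    · exact ⟨z, Algebra.subset_adjoin rfl, 0, zero_mem _, 0, zero_mem _, by ring⟩
  | algebraMap c => exact ⟨_, Subalgebra.algebraMap_mem _ c, 0, zero_mem _, 0, zero_mem _, by ring⟩
  | add z w _ _ hz hw =>
    obtain ⟨a, ha, b, hb, c, hc, rfl⟩ := hz
    obtain ⟨a', ha', b', hb', c', hc', rfl⟩ := hw
    exact ⟨a + a', add_mem ha ha', b + b', add_mem hb hb', c + c', add_mem hc hc', by ring⟩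
  | mul z w _ _ hz hw =>
    obtain ⟨a, ha, b, hb, c, hc, rfl⟩ := hz
    obtain ⟨a', ha', b', hb', c', hc', rfl⟩ := hw
    refine ⟨a * a' + (b * c' + c * b') * x ^ 3, ?_, a * b' + b * a' + c * c' * x ^ 3, ?_,
      a * c' + b * b' + c * a', ?_, by ring⟩
    · exact add_mem (mul_mem ha ha') (mul_mem (add_mem (mul_mem hb hc') (mul_mem hc hb')) hx)
    · exact add_mem (add_mem (mul_mem ha hb') (mul_mem hb ha')) (mul_mem (mul_mem hc hc') hx)
    · exact add_mem (add_mem (mul_mem ha hc') (mul_mem hb hb')) (mul_mem hc ha')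

/-- Fourier inversion for a cyclic group of order three: `f', f''` are the successive images of `f`,
the summands `a, x, y` have eigenvalues `1, w², w`, and averaging with `t = 1/3` isolates one of
them. -/
lemma eq_of_cyclic_eigenvector {A : Type*} [CommRing A] {w t f f' f'' a x y : A}
    (hw : w ^ 2 = -w - 1) (ht : t * 3 = 1) (h₀ : f = a + x + y) (h₁ : f' = a + w ^ 2 * x + w * y)
    (h₂ : f'' = a + w * x + w ^ 2 * y) :
    (f' = f → f'' = f → f = a) ∧ (f' = w ^ 2 * f → f'' = w * f → f = x) ∧
      (f' = w * f → f'' = w ^ 2 * f → f = y) := by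
  refine ⟨fun h h' => ?_, fun h h' => ?_, fun h h' => ?_⟩
  · linear_combination t * (h₀ + h₁ + h₂) - t * h - t * h' + t * (x + y) * hw - (f - a) * ht
  · linear_combination t * (h₀ + w * h₁ + w ^ 2 * h₂) - t * w * h - t * w ^ 2 * h' - (f - x) * ht
      + t * ((2 * x - 2 * f) * (w - 1) + a + y * (w ^ 2 - w + 1)) * hw
  · linear_combination t * (h₀ + w ^ 2 * h₁ + w * h₂) - t * w ^ 2 * h - t * w * h' - (f - y) * ht
      + t * ((2 * y - 2 * f) * (w - 1) + a + x * (w ^ 2 - w + 1)) * hw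

namespace IsA4Frame

variable {L : PeriodPair} {u : ℂ} {σ : alternatingGroup (Fin 4) →* TorusAut L}
  {γ₀ γ₁ γ₂ : alternatingGroup (Fin 4)}

/-- Phrased for an abstract action `T` because it is used both for functions and for the current
algebra. -/
lemma kleinFour_apply_eq (h : IsA4Frame L u σ γ₀ γ₁ γ₂) {X : Type*}
    {T : alternatingGroup (Fin 4) → X → X} (h1 : ∀ x, T 1 x = x)
    (hmul : ∀ γ γ' x, T (γ * γ') x = T γ (T γ' x)) {x : X} (hx₁ : T γ₁ x = x) (hx₂ : T γ₂ x = x)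
    {δ : alternatingGroup (Fin 4)} (hδ : δ ∈ alternatingGroup.kleinFour (Fin 4)) : T δ x = x := by
  rcases h.kleinFour δ hδ with rfl | rfl | rfl | rfl
  · exact h1 x
  · exact hx₁
  · exact hx₂
  · rw [hmul, hx₂, hx₁]

lemma apply_eq (h : IsA4Frame L u σ γ₀ γ₁ γ₂) {X : Type*}
    {T : alternatingGroup (Fin 4) → X → X} (h1 : ∀ x, T 1 x = x)
    (hmul : ∀ γ γ' x, T (γ * γ') x = T γ (T γ' x)) {x : X} (hx₀ : T γ₀ x = x)
    (hx₁ : T γ₁ x = x) (hx₂ : T γ₂ x = x) (γ : alternatingGroup (Fin 4)) : T γ x = x := by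
  let H : Subgroup (alternatingGroup (Fin 4)) :=
    { carrier := {γ | T γ x = x}
      one_mem' := h1 x
      mul_mem' := fun {a b} ha hb => by
        rw [Set.mem_ofPred_eq] at ha hb ⊢
        rw [hmul, hb, ha]
      inv_mem' := fun {a} ha => by
        rw [Set.mem_ofPred_eq] at ha ⊢
        conv_lhs => rw [← ha]
        rw [← hmul, inv_mul_cancel, h1] }
  obtain ⟨k, δ, hδ, rfl⟩ := h.exists_eq γ
  exact H.mul_mem (H.zpow_mem hx₀ k) (h.kleinFour_apply_eq h1 hmul hx₁ hx₂ hδ)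

lemma mk_notMem (h : IsA4Frame L u σ γ₀ γ₁ γ₂) {z : ℂ} :
    Torus.mk L z ∉ zeroOrbit σ ↔ z ∉ (halfPair L).lattice := h.mem_zeroOrbit.not

lemma push_one (f : RegularFunctions L (zeroOrbit σ)) :
    pushFunction (σ 1) (zeroOrbit_invariant σ 1) f = f := by
  refine Subtype.ext (funext fun x => ?_)
  change f.1 ⟨(σ 1).1.symm x.1, _⟩ = f.1 x
  refine congrArg f.1 (Subtype.ext ?_)
  rw [Equiv.symm_apply_eq, map_one]; rfl

lemma push_mul (γ γ' : alternatingGroup (Fin 4)) (f : RegularFunctions L (zeroOrbit σ)) :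
    pushFunction (σ (γ * γ')) (zeroOrbit_invariant σ (γ * γ')) f =
      pushFunction (σ γ) (zeroOrbit_invariant σ γ)
        (pushFunction (σ γ') (zeroOrbit_invariant σ γ') f) := by
  refine Subtype.ext (funext fun x => ?_)
  change f.1 ⟨(σ (γ * γ')).1.symm x.1, _⟩ = f.1 ⟨(σ γ').1.symm ((σ γ).1.symm x.1), _⟩
  refine congrArg f.1 (Subtype.ext ?_)
  rw [Equiv.symm_apply_eq, map_mul]
  change _ = (σ γ).1 ((σ γ').1 _)
  simp only [Equiv.apply_symm_apply]

section push

variable {f : RegularFunctions L (zeroOrbit σ)} {F : ℂ → ℂ}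

lemma push₀ (h : IsA4Frame L u σ γ₀ γ₁ γ₂) (hf : IsGivenBy f F) :
    IsGivenBy (pushFunction (σ γ₀) (zeroOrbit_invariant σ γ₀) f)
      (F ∘ fun z => omega3 ^ 2 * z) :=
  hf.pushFunction _ fun z => by
    rw [h.apply₀]; congr 1; linear_combination z * omega3_pow_three

lemma push₁ (h : IsA4Frame L u σ γ₀ γ₁ γ₂) (hf : IsGivenBy f F) :
    IsGivenBy (pushFunction (σ γ₁) (zeroOrbit_invariant σ γ₁) f) (F ∘ fun z => z - u / 2) :=
  hf.pushFunction _ fun z => by rw [h.apply₁, sub_add_cancel]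

lemma push₂ (h : IsA4Frame L u σ γ₀ γ₁ γ₂) (hf : IsGivenBy f F) :
    IsGivenBy (pushFunction (σ γ₂) (zeroOrbit_invariant σ γ₂) f)
      (F ∘ fun z => z - omega6 * u / 2) :=
  hf.pushFunction _ fun z => by rw [h.apply₂, sub_add_cancel]

end push

/-- The regular functions `P = ℘_{½Λ}`, `P' = ℘'_{½Λ}`, `p₀`, `p₁`, `p₂`. -/
structure _root_.IsFunctionFrame (L : PeriodPair) (u : ℂ)
    (σ : alternatingGroup (Fin 4) →* TorusAut L)
    (P P' p₀ p₁ p₂ : RegularFunctions L (zeroOrbit σ)) : Prop where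
  givenP : IsGivenBy P (halfPair L).weierstrassP
  givenP' : IsGivenBy P' (halfPair L).derivWeierstrassP
  given₀ : IsGivenBy p₀ (pZero L u)
  given₁ : IsGivenBy p₁ (pOne L u)
  given₂ : IsGivenBy p₂ (pTwo L u)

lemma exists_isFunctionFrame (h : IsA4Frame L u σ γ₀ γ₁ γ₂) :
    ∃ P P' p₀ p₁ p₂, IsFunctionFrame L u σ P P' p₀ p₁ p₂ := by
  have hper : ∀ {F : ℂ → ℂ}, (∀ l ∈ (halfPair L).lattice, ∀ z, F (z + l) = F z) →
      ∀ l ∈ L.lattice, ∀ z, F (z + l) = F z := fun h l hl => h l (mem_halfPair_of_mem hl)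
  obtain ⟨P, hP⟩ := RegularFunctions.exists_isGivenBy (S := zeroOrbit σ)
    (hper (halfPair L).isEllipticOff_weierstrassP.periodic) (halfPair L).meromorphic_weierstrassP
    fun z hz => (halfPair L).isEllipticOff_weierstrassP.analyticAt z (h.mk_notMem.1 hz)
  obtain ⟨P', hP'⟩ := RegularFunctions.exists_isGivenBy (S := zeroOrbit σ)
    (hper (halfPair L).isEllipticOff_derivWeierstrassP.periodic)
    (halfPair L).meromorphic_derivWeierstrassP
    fun z hz => (halfPair L).isEllipticOff_derivWeierstrassP.analyticAt z (h.mk_notMem.1 hz)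
  obtain ⟨p₂, h₂⟩ := RegularFunctions.exists_isGivenBy (S := zeroOrbit σ)
    (fun l => IsHexagonalPeriod.pTwo_add u) (IsHexagonalPeriod.meromorphic_pTwo L u)
    fun z hz => h.hex.analyticAt_pTwo (h.mk_notMem.1 hz)
  -- Only `p₂` is constructed directly; `p₀` and `p₁` are its images under the rotation, applied
  -- once and twice.
  refine ⟨P, P', pushFunction (σ γ₀) (zeroOrbit_invariant σ γ₀) p₂,
    pushFunction (σ γ₀) (zeroOrbit_invariant σ γ₀)
      (pushFunction (σ γ₀) (zeroOrbit_invariant σ γ₀) p₂), p₂, hP, hP', ?_, ?_, h₂⟩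
  · convert h.push₀ h₂ using 1
    funext z
    rw [Function.comp_apply, ← h.hex.pZero_omega3_mul]
    congr 1; linear_combination -z * omega3_pow_three
  · convert h.push₀ (h.push₀ h₂) using 1
    funext z
    rw [Function.comp_apply, Function.comp_apply, ← h.hex.pTwo_omega3_mul]
    congr 1; linear_combination -z * omega3 * omega3_pow_three

end IsA4Frame

/-- The action of `A₄` on the regular functions. -/
abbrev orbitPush {L : PeriodPair} (σ : alternatingGroup (Fin 4) →* TorusAut L)
    (γ : alternatingGroup (Fin 4)) :
    RegularFunctions L (zeroOrbit σ) →ₐ[ℂ] RegularFunctions L (zeroOrbit σ) :=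
  pushFunction (σ γ) (zeroOrbit_invariant σ γ)

/-! ### The action of `A₄` on the functions, and the two rings of invariants. -/

namespace IsFunctionFrame

variable {L : PeriodPair} {u : ℂ} {σ : alternatingGroup (Fin 4) →* TorusAut L}
  {γ₀ γ₁ γ₂ : alternatingGroup (Fin 4)} {P P' p₀ p₁ p₂ : RegularFunctions L (zeroOrbit σ)}

lemma push₀ (hp : IsFunctionFrame L u σ P P' p₀ p₁ p₂) (h : IsA4Frame L u σ γ₀ γ₁ γ₂) :
    orbitPush σ γ₀ P = omega3 ^ 2 • P ∧ orbitPush σ γ₀ P' = P' ∧ orbitPush σ γ₀ p₀ = p₁ ∧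
      orbitPush σ γ₀ p₁ = p₂ ∧ orbitPush σ γ₀ p₂ = p₀ := by
  have hz : ∀ z : ℂ, omega3 ^ 2 * z = omega3 * (omega3 * z) := fun z => by ring
  have hz' : ∀ z : ℂ, omega3 * (omega3 * (omega3 * z)) = z := fun z => by
    linear_combination z * omega3_pow_three
  refine ⟨(h.push₀ hp.givenP).eq_of_eq (hp.givenP.smul _) fun z _ => ?_,
    (h.push₀ hp.givenP').eq_of_eq hp.givenP' fun z _ => ?_,
    (h.push₀ hp.given₀).eq_of_eq hp.given₁ fun z _ => ?_,
    (h.push₀ hp.given₁).eq_of_eq hp.given₂ fun z _ => ?_,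
    (h.push₀ hp.given₂).eq_of_eq hp.given₀ fun z _ => ?_⟩
  · simp only [Function.comp_apply, hz, h.hex.half.weierstrassP_omega3_mul, Pi.smul_apply,
      smul_eq_mul]
  · simp only [Function.comp_apply, hz, h.hex.half.derivWeierstrassP_omega3_mul]
  · rw [Function.comp_apply, hz, ← h.hex.pOne_omega3_mul, hz']
  · rw [Function.comp_apply, hz, ← h.hex.pTwo_omega3_mul, hz']
  · rw [Function.comp_apply, hz, ← h.hex.pZero_omega3_mul, hz']

lemma push₁ (hp : IsFunctionFrame L u σ P P' p₀ p₁ p₂) (h : IsA4Frame L u σ γ₀ γ₁ γ₂) :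
    orbitPush σ γ₁ P = P ∧ orbitPush σ γ₁ P' = P' ∧ orbitPush σ γ₁ p₀ = -p₀ ∧
      orbitPush σ γ₁ p₁ = -p₁ ∧ orbitPush σ γ₁ p₂ = p₂ := by
  refine ⟨(h.push₁ hp.givenP).eq_of_eq hp.givenP fun z _ => ?_,
    (h.push₁ hp.givenP').eq_of_eq hp.givenP' fun z _ => ?_,
    (h.push₁ hp.given₀).eq_of_eq hp.given₀.neg fun z _ => h.hex.pZero_sub_half z,
    (h.push₁ hp.given₁).eq_of_eq hp.given₁.neg fun z _ => h.hex.pOne_sub_half z,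
    (h.push₁ hp.given₂).eq_of_eq hp.given₂ fun z _ => h.hex.pTwo_sub_half z⟩
  · exact (halfPair L).weierstrassP_sub_coe z ⟨_, h.hex.half_mem⟩
  · exact (halfPair L).derivWeierstrassP_sub_coe z ⟨_, h.hex.half_mem⟩

lemma push₂ (hp : IsFunctionFrame L u σ P P' p₀ p₁ p₂) (h : IsA4Frame L u σ γ₀ γ₁ γ₂) :
    orbitPush σ γ₂ P = P ∧ orbitPush σ γ₂ P' = P' ∧ orbitPush σ γ₂ p₀ = -p₀ ∧
      orbitPush σ γ₂ p₁ = p₁ ∧ orbitPush σ γ₂ p₂ = -p₂ := by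
  refine ⟨(h.push₂ hp.givenP).eq_of_eq hp.givenP fun z _ => ?_,
    (h.push₂ hp.givenP').eq_of_eq hp.givenP' fun z _ => ?_,
    (h.push₂ hp.given₀).eq_of_eq hp.given₀.neg fun z _ => h.hex.pZero_sub_omega6_half z,
    (h.push₂ hp.given₁).eq_of_eq hp.given₁ fun z _ => h.hex.pOne_sub_omega6_half z,
    (h.push₂ hp.given₂).eq_of_eq hp.given₂.neg fun z _ => h.hex.pTwo_sub_omega6_half z⟩
  · exact (halfPair L).weierstrassP_sub_coe z ⟨_, h.hex.omega6_half_mem⟩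
  · exact (halfPair L).derivWeierstrassP_sub_coe z ⟨_, h.hex.omega6_half_mem⟩

lemma pow_three_eq (hp : IsFunctionFrame L u σ P P' p₀ p₁ p₂) (h : IsA4Frame L u σ γ₀ γ₁ γ₂) :
    P ^ 3 = (1 / 4 : ℂ) • (P' ^ 2 + algebraMap ℂ _ (halfPair L).g₃) := by
  refine (hp.givenP.pow 3).eq_of_eq
    (((hp.givenP'.pow 2).add (IsGivenBy.algebraMap _)).smul _) fun z hz => ?_
  have := h.hex.half.derivWeierstrassP_sq (h.mk_notMem.1 hz)
  simp only [Pi.pow_apply, Pi.smul_apply, Pi.add_apply, smul_eq_mul, this]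
  simp

lemma sq_eq (hp : IsFunctionFrame L u σ P P' p₀ p₁ p₂) (h : IsA4Frame L u σ γ₀ γ₁ γ₂) :
    ∃ s b : ℂ, Complex.I * kappa L u = -(omega3 - omega3 ^ 2) * b ∧
      p₀ ^ 2 = (omega3 ^ 2 * s) • P + algebraMap ℂ _ b ∧
      p₁ ^ 2 = (omega3 * s) • P + algebraMap ℂ _ b ∧ p₂ ^ 2 = s • P + algebraMap ℂ _ b := by
  have he := h.hex.weierstrassP_half_ne_zero
  refine ⟨1 / (9 * L.weierstrassP (u / 2) ^ 4), -4 / (9 * L.weierstrassP (u / 2) ^ 3), ?_,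
    (hp.given₀.pow 2).eq_of_eq ((hp.givenP.smul _).add (IsGivenBy.algebraMap _)) fun z hz => ?_,
    (hp.given₁.pow 2).eq_of_eq ((hp.givenP.smul _).add (IsGivenBy.algebraMap _)) fun z hz => ?_,
    (hp.given₂.pow 2).eq_of_eq ((hp.givenP.smul _).add (IsGivenBy.algebraMap _)) fun z hz => ?_⟩
  · rw [h.hex.I_mul_kappa]; ring
  all_goals
    have hz' := h.mk_notMem.1 hz
    simp only [Pi.pow_apply, Pi.smul_apply, Pi.add_apply, smul_eq_mul, h.hex.pZero_sq hz',
      h.hex.pOne_sq hz', h.hex.pTwo_sq hz', Pi.algebraMap_apply, Algebra.algebraMap_self_apply]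
    field_simp
    try ring

/-- A polynomial relation would confine `℘'` to finitely many values. Then `z³℘'(z)` would tend to
`0` at the origin, whereas it tends to `-2`. -/
theorem aeval_eq_zero (hp : IsFunctionFrame L u σ P P' p₀ p₁ p₂)
    (h : IsA4Frame L u σ γ₀ γ₁ γ₂) {q : Polynomial ℂ} (hq : Polynomial.aeval P' q = 0) : q = 0 := by
  by_contra hq0
  have hroot : ∀ z, z ∉ (halfPair L).lattice → (halfPair L).derivWeierstrassP z ∈ q.rootSet ℂ := by
    intro z hz
    have hz' := h.mk_notMem.2 hz
    rw [Polynomial.mem_rootSet]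
    refine ⟨hq0, ?_⟩
    have h1 := Polynomial.aeval_algHom_apply ((Pi.evalAlgHom ℂ (fun _ => ℂ) ⟨Torus.mk L z, hz'⟩).comp
      (RegularFunctions L (zeroOrbit σ)).val) P' q
    rw [hq, map_zero] at h1
    rw [← hp.givenP' z hz']
    exact h1
  obtain ⟨C, hC⟩ := (q.rootSet_finite ℂ).isBounded.exists_norm_le
  have hlim := (halfPair L).hasLeadingTerm_derivWeierstrassP.tendsto
  have h0 : Filter.Tendsto (fun z : ℂ => z ^ 3 * (halfPair L).derivWeierstrassP z) (𝓝[≠] 0) (𝓝 0) := by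
    refine squeeze_zero_norm' (a := fun z : ℂ => ‖z‖ ^ 3 * C) ?_ ?_
    · filter_upwards [mem_nhdsWithin_of_mem_nhds
        ((halfPair L).compl_lattice_sdiff_singleton_mem_nhds 0), self_mem_nhdsWithin] with w h2 h3
      have h4 : w ∉ (halfPair L).lattice := fun h => h2 ⟨h, h3⟩
      rw [norm_mul, norm_pow]
      gcongr
      exact hC _ (hroot w h4)
    · have : Continuous fun z : ℂ => ‖z‖ ^ 3 * C := by fun_prop
      have := this.tendsto 0
      simp only [norm_zero, ne_eq, OfNat.ofNat_ne_zero, not_false_eq_true, zero_pow, zero_mul] at this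
      exact this.mono_left nhdsWithin_le_nhds
  have := tendsto_nhds_unique hlim h0
  norm_num at this

/-- Invariance under the two translations makes the lift `½Λ`-periodic with poles only in `½Λ`, and
`exists_mem_adjoin` applies to the lattice `½Λ`. -/
theorem kleinFour_invariants (hp : IsFunctionFrame L u σ P P' p₀ p₁ p₂)
    (h : IsA4Frame L u σ γ₀ γ₁ γ₂) :
    invariantFunctions (σ.comp (alternatingGroup.kleinFour (Fin 4)).subtype)
      (fun γ => zeroOrbit_invariant σ γ.1) = Algebra.adjoin ℂ {P, P'} := by
  refine le_antisymm (fun f hf => ?_) (Algebra.adjoin_le ?_)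
  · obtain ⟨F, hfF, han, hmer, hF0⟩ := RegularFunctions.exists_lift (fun z => h.mem_zeroOrbit) f
    have hper : (halfPair L).IsEllipticOff F := by
      refine ⟨IsHexagonalPeriod.periodic_of_generators h.hex.half (fun z => ?_) fun z => ?_, han⟩
      all_goals by_cases hz : z ∈ (halfPair L).lattice
      · rw [hF0 z hz, hF0 _ (sub_mem hz h.hex.half_mem)]
      · have h1 := h.push₁ hfF z (h.mk_notMem.2 hz)
        have h2 : orbitPush σ γ₁ f = f := hf ⟨γ₁, h.mem₁⟩
        rw [h2, hfF] at h1
        exact h1.symm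
      · rw [hF0 z hz, hF0 _ (sub_mem hz h.hex.half.omega6_mul_mem_lattice)]
      · have h1 := h.push₂ hfF z (h.mk_notMem.2 hz)
        have h2 : orbitPush σ γ₂ f = f := hf ⟨γ₂, h.mem₂⟩
        rw [h2, hfF] at h1
        rw [← mul_div_assoc]
        exact h1.symm
    obtain ⟨n, c, hc⟩ := hmer.exists_hasLeadingTerm
    obtain ⟨Q, hQ, hFQ⟩ := h.hex.half.exists_mem_adjoin n hper hc
    obtain ⟨q, hq, hqQ⟩ := hp.givenP.exists_mem_adjoin hp.givenP' hQ
    rwa [hfF.eq_of_eq hqQ fun z hz => hFQ z (h.mk_notMem.1 hz)]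
  · rintro f (rfl | rfl) ⟨δ, hδ⟩
    · exact h.kleinFour_apply_eq (T := fun γ f => orbitPush σ γ f) IsA4Frame.push_one
        IsA4Frame.push_mul (hp.push₁ h).1 (hp.push₂ h).1 hδ
    · exact h.kleinFour_apply_eq (T := fun γ f => orbitPush σ γ f) IsA4Frame.push_one
        IsA4Frame.push_mul (hp.push₁ h).2.1 (hp.push₂ h).2.1 hδ

lemma mem_adjoin_of_push (hp : IsFunctionFrame L u σ P P' p₀ p₁ p₂)
    (h : IsA4Frame L u σ γ₀ γ₁ γ₂) {f : RegularFunctions L (zeroOrbit σ)}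
    (h1 : orbitPush σ γ₁ f = f) (h2 : orbitPush σ γ₂ f = f) : f ∈ Algebra.adjoin ℂ {P, P'} := by
  rw [← hp.kleinFour_invariants h]
  exact fun δ => h.kleinFour_apply_eq (T := fun γ f => orbitPush σ γ f) IsA4Frame.push_one
    IsA4Frame.push_mul h1 h2 δ.2

lemma push₀_of_mem_adjoin (hp : IsFunctionFrame L u σ P P' p₀ p₁ p₂)
    (h : IsA4Frame L u σ γ₀ γ₁ γ₂) {q : RegularFunctions L (zeroOrbit σ)}
    (hq : q ∈ Algebra.adjoin ℂ {P'}) : orbitPush σ γ₀ q = q := by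
  have : Algebra.adjoin ℂ {P'} ≤ AlgHom.equalizer (orbitPush σ γ₀) (AlgHom.id ℂ _) :=
    Algebra.adjoin_le (by rintro _ rfl; exact (hp.push₀ h).2.1)
  exact (AlgHom.mem_equalizer _ _ _).1 (this hq)

lemma pow_three_mem (hp : IsFunctionFrame L u σ P P' p₀ p₁ p₂) (h : IsA4Frame L u σ γ₀ γ₁ γ₂) :
    P ^ 3 ∈ Algebra.adjoin ℂ {P'} := by
  rw [hp.pow_three_eq h]
  refine Subalgebra.smul_mem _ (add_mem (pow_mem ?_ 2) (Subalgebra.algebraMap_mem _ _)) _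
  exact Algebra.subset_adjoin (Set.mem_singleton P')

/-- The eigenspaces of the rotation on the functions invariant under the Klein four group. -/
lemma exists_eq_of_push₀ (hp : IsFunctionFrame L u σ P P' p₀ p₁ p₂)
    (h : IsA4Frame L u σ γ₀ γ₁ γ₂) {f : RegularFunctions L (zeroOrbit σ)}
    (hf : f ∈ Algebra.adjoin ℂ {P, P'}) :
    (orbitPush σ γ₀ f = f → f ∈ Algebra.adjoin ℂ {P'}) ∧
    (orbitPush σ γ₀ f = omega3 ^ 2 • f → ∃ q ∈ Algebra.adjoin ℂ {P'}, f = q * P) ∧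
    (orbitPush σ γ₀ f = omega3 • f → ∃ q ∈ Algebra.adjoin ℂ {P'}, f = q * P ^ 2) := by
  obtain ⟨a, ha, b, hb, c, hc, hfabc⟩ := exists_eq_of_mem_adjoin_pair (hp.pow_three_mem h) hf
  have h1 : orbitPush σ γ₀ f = a + omega3 ^ 2 • (b * P) + omega3 • (c * P ^ 2) := by
    rw [hfabc]
    simp only [map_add, map_mul, map_pow, hp.push₀_of_mem_adjoin h ha, hp.push₀_of_mem_adjoin h hb,
      hp.push₀_of_mem_adjoin h hc, (hp.push₀ h).1]
    rw [smul_pow, mul_smul_comm, mul_smul_comm]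
    congr 2
    linear_combination omega3 * omega3_pow_three
  have h2 : orbitPush σ γ₀ (orbitPush σ γ₀ f) = a + omega3 • (b * P) + omega3 ^ 2 • (c * P ^ 2) := by
    have hP := (hp.push₀ h).1
    rw [h1]
    simp only [map_add, map_smul, map_mul, map_pow, hp.push₀_of_mem_adjoin h ha,
      hp.push₀_of_mem_adjoin h hb, hp.push₀_of_mem_adjoin h hc, hP]
    rw [smul_pow, mul_smul_comm, mul_smul_comm, smul_smul, smul_smul]
    congr 2
    · congr 1; linear_combination omega3 * omega3_pow_three
    · linear_combination omega3 ^ 2 * omega3_pow_three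
  have hw : algebraMap ℂ (RegularFunctions L (zeroOrbit σ)) omega3 ^ 2 =
      -algebraMap ℂ (RegularFunctions L (zeroOrbit σ)) omega3 - 1 := by
    rw [← map_pow, omega3_sq, map_sub, map_neg, map_one]
  have ht : algebraMap ℂ (RegularFunctions L (zeroOrbit σ)) (1 / 3) * 3 = 1 := by
    rw [← map_ofNat (algebraMap ℂ (RegularFunctions L (zeroOrbit σ))) 3, ← map_mul]
    norm_num
  simp only [Algebra.smul_def, map_pow] at h1 h2
  obtain ⟨k0, k1, k2⟩ := eq_of_cyclic_eigenvector hw ht hfabc h1 h2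
  refine ⟨fun h0 => ?_, fun h0 => ⟨b, hb, k1 ?_ ?_⟩, fun h0 => ⟨c, hc, k2 ?_ ?_⟩⟩
  · rw [k0 h0 (by rw [h0, h0])]; exact ha
  · rw [h0, Algebra.smul_def, map_pow]
  · rw [h0, map_smul, h0, smul_smul, Algebra.smul_def]
    congr 2; linear_combination omega3 * omega3_pow_three
  · rw [h0, Algebra.smul_def]
  · rw [h0, map_smul, h0, smul_smul, ← pow_two, Algebra.smul_def, map_pow]

theorem invariantFunctions_eq (hp : IsFunctionFrame L u σ P P' p₀ p₁ p₂)
    (h : IsA4Frame L u σ γ₀ γ₁ γ₂) :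
    invariantFunctions σ (zeroOrbit_invariant σ) = Algebra.adjoin ℂ {P'} := by
  refine le_antisymm (fun f hf => ?_) (Algebra.adjoin_le ?_)
  · exact (hp.exists_eq_of_push₀ h (hp.mem_adjoin_of_push h (hf γ₁) (hf γ₂))).1 (hf γ₀)
  · rintro f rfl γ
    exact h.apply_eq (T := fun γ f => orbitPush σ γ f) IsA4Frame.push_one IsA4Frame.push_mul
      (hp.push₀ h).2.1 (hp.push₁ h).2.1 (hp.push₂ h).2.1 γ

end IsFunctionFrame

/-! ### Automorphisms of `sl₂` -/

namespace Sl2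

lemma eq_sum (x : Sl2) : x = x.1 0 0 • Sl2.h + x.1 0 1 • Sl2.e + x.1 1 0 • Sl2.f := by
  have htr : x.1 0 0 + x.1 1 1 = 0 := by
    have : Matrix.trace x.1 = 0 := x.2
    rwa [Matrix.trace_fin_two] at this
  ext i j
  fin_cases i <;> fin_cases j <;> simp [Sl2.h, Sl2.e, Sl2.f]
  linear_combination htr

lemma lie_h_e : ⁅Sl2.h, Sl2.e⁆ = (2 : ℂ) • Sl2.e := by
  ext i j
  fin_cases i <;> fin_cases j <;> simp [Sl2.h, Sl2.e, Ring.lie_def]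
  norm_num

lemma lie_h_f : ⁅Sl2.h, Sl2.f⁆ = (-2 : ℂ) • Sl2.f := by
  ext i j
  fin_cases i <;> fin_cases j <;> simp [Sl2.h, Sl2.f, Ring.lie_def]
  norm_num

lemma lie_e_f : ⁅Sl2.e, Sl2.f⁆ = Sl2.h := by
  ext i j
  fin_cases i <;> fin_cases j <;> simp [Sl2.h, Sl2.e, Sl2.f, Ring.lie_def]

lemma e_ne_zero : Sl2.e ≠ 0 := by
  intro h
  have := congrFun (congrFun (congrArg Subtype.val h) 0) 1
  simp [Sl2.e] at this

/-- The linear map with `h ↦ H`, `e ↦ E`, `f ↦ F`. -/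
noncomputable def lift (H E F : Sl2) : Sl2 →ₗ[ℂ] Sl2 where
  toFun x := x.1 0 0 • H + x.1 0 1 • E + x.1 1 0 • F
  map_add' x y := by
    change (x.1 0 0 + y.1 0 0) • H + (x.1 0 1 + y.1 0 1) • E + (x.1 1 0 + y.1 1 0) • F = _
    module
  map_smul' c x := by
    change (c * x.1 0 0) • H + (c * x.1 0 1) • E + (c * x.1 1 0) • F = _
    rw [RingHom.id_apply]
    module

lemma lift_injective {H E F : Sl2}
    (hli : ∀ a b c : ℂ, a • H + b • E + c • F = 0 → a = 0 ∧ b = 0 ∧ c = 0) :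
    Function.Injective (lift H E F) := by
  rw [injective_iff_map_eq_zero]
  intro x hx
  obtain ⟨h1, h2, h3⟩ := hli _ _ _ hx
  rw [eq_sum x, h1, h2, h3]
  simp

lemma exists_aut {H E F : Sl2} (hHE : ⁅H, E⁆ = (2 : ℂ) • E) (hHF : ⁅H, F⁆ = (-2 : ℂ) • F)
    (hEF : ⁅E, F⁆ = H)
    (hli : ∀ a b c : ℂ, a • H + b • E + c • F = 0 → a = 0 ∧ b = 0 ∧ c = 0) :
    ∃ θ : Sl2Aut, θ Sl2.h = H ∧ θ Sl2.e = E ∧ θ Sl2.f = F := by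
  have hinj := lift_injective hli
  have hT : ∀ x, lift H E F x = x.1 0 0 • H + x.1 0 1 • E + x.1 1 0 • F := fun _ => rfl
  have hEH : ⁅E, H⁆ = -((2 : ℂ) • E) := by rw [← lie_skew, hHE]
  have hFH : ⁅F, H⁆ = -((-2 : ℂ) • F) := by rw [← lie_skew, hHF]
  have hFE : ⁅F, E⁆ = -H := by rw [← lie_skew, hEF]
  let T : Sl2 →ₗ⁅ℂ⁆ Sl2 :=
    { lift H E F with
      map_lie' := by
        intro x y
        change lift H E F ⁅x, y⁆ = ⁅lift H E F x, lift H E F y⁆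
        conv_lhs => rw [eq_sum x, eq_sum y]
        have hh : lift H E F Sl2.h = H := by simp [hT, Sl2.h]
        have he : lift H E F Sl2.e = E := by simp [hT, Sl2.e]
        have hf : lift H E F Sl2.f = F := by simp [hT, Sl2.f]
        have l1 : ⁅Sl2.e, Sl2.h⁆ = -((2 : ℂ) • Sl2.e) := by rw [← lie_skew, lie_h_e]
        have l2 : ⁅Sl2.f, Sl2.h⁆ = -((-2 : ℂ) • Sl2.f) := by rw [← lie_skew, lie_h_f]
        have l3 : ⁅Sl2.f, Sl2.e⁆ = -Sl2.h := by rw [← lie_skew, lie_e_f]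
        rw [hT x, hT y]
        simp only [lie_add, add_lie, lie_smul, smul_lie, lie_self, lie_h_e, lie_h_f, lie_e_f, l1, l2,
          l3, map_add, map_smul, map_neg, hh, he, hf, hHE, hHF, hEF, hEH, hFH, hFE, smul_zero,
          map_zero] }
  refine ⟨LieEquiv.ofBijective T ⟨hinj, LinearMap.injective_iff_surjective.1 hinj⟩, ?_, ?_, ?_⟩
  · change lift H E F _ = _; simp [hT, Sl2.h]
  · change lift H E F _ = _; simp [hT, Sl2.e]
  · change lift H E F _ = _; simp [hT, Sl2.f]

end Sl2

/-- A basis of `sl₂` in which `A₄` acts in the standard way, and the automorphism `θ` which maps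
`h, e + f, i (e - f)` to it. -/
structure IsSl2Frame (ρ : alternatingGroup (Fin 4) →* Sl2Aut) (γ₀ γ₁ γ₂ : alternatingGroup (Fin 4))
    (Y : Module.Basis (Fin 3) ℂ Sl2) (θ : Sl2Aut) : Prop where
  map_h : θ Sl2.h = Y 2
  map_e : θ Sl2.e = (1 / 2 : ℂ) • (Y 0 - Complex.I • Y 1)
  map_f : θ Sl2.f = (1 / 2 : ℂ) • (Y 0 + Complex.I • Y 1)
  lie₀₁ : ⁅Y 0, Y 1⁆ = (-2 * Complex.I) • Y 2
  lie₁₂ : ⁅Y 1, Y 2⁆ = (-2 * Complex.I) • Y 0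
  lie₂₀ : ⁅Y 2, Y 0⁆ = (-2 * Complex.I) • Y 1
  map₀ : ρ γ₀ (Y 0) = Y 1 ∧ ρ γ₀ (Y 1) = Y 2 ∧ ρ γ₀ (Y 2) = Y 0
  map₁ : ρ γ₁ (Y 0) = -Y 0 ∧ ρ γ₁ (Y 1) = -Y 1 ∧ ρ γ₁ (Y 2) = Y 2
  map₂ : ρ γ₂ (Y 0) = -Y 0 ∧ ρ γ₂ (Y 1) = Y 1 ∧ ρ γ₂ (Y 2) = -Y 2

namespace Sl2Aut

variable {R A B : Sl2Aut}

/-- The relations make `R` move the sign pairs of `(A, B)` by `(-,-) → (-,+) → (+,-)`. A vector `x -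
Ax` with sign `-` for `A` either has a nonzero part `y + By` of type `(-,+)`, or is itself of type
`(-,-)`; one or two applications of `R` finish. -/
lemma exists_eigenvector (hRA : ∀ x, R (A x) = A (B (R x))) (hRB : ∀ x, R (B x) = A (R x))
    (hA : ∀ x, A (A x) = x) (hB : ∀ x, B (B x) = x) (hAB : ∀ x, A (B x) = B (A x)) (hA1 : A ≠ 1) :
    ∃ y : Sl2, y ≠ 0 ∧ A y = y ∧ B y = -y := by
  have hR : ∀ y : Sl2, y ≠ 0 → R y ≠ 0 := fun y hy h => hy (R.injective (show R y = R 0 by rw [h, map_zero]))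
  have step₁ : ∀ y, A y = -y → B y = y → A (R y) = R y ∧ B (R y) = -(R y) := by
    intro y h1 h2
    have h3 : A (R y) = R y := by rw [← hRB, h2]
    refine ⟨h3, ?_⟩
    have h4 := hRA y
    rw [hAB, h3, h1, map_neg] at h4
    exact h4.symm
  have step₀ : ∀ y, A y = -y → B y = -y → A (R y) = -R y ∧ B (R y) = R y := by
    intro y h1 h2
    have h3 : A (R y) = -R y := by rw [← hRB, h2, map_neg]
    refine ⟨h3, ?_⟩
    have h4 := hRA y
    rw [hAB, h3, h1, map_neg, map_neg] at h4
    exact (neg_injective h4).symm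
  obtain ⟨x, hx⟩ : ∃ x, A x ≠ x := by
    by_contra! h
    exact hA1 (LieEquiv.ext h)
  have hy0 : x - A x ≠ 0 := sub_ne_zero.2 (Ne.symm hx)
  have hAy : A (x - A x) = -(x - A x) := by rw [map_sub, hA, neg_sub]
  set y := x - A x
  by_cases h1 : y + B y = 0
  · have hBy : B y = -y := (neg_eq_of_add_eq_zero_right h1).symm
    obtain ⟨h2, h3⟩ := step₀ y hAy hBy
    exact ⟨R (R y), hR _ (hR _ hy0), step₁ _ h2 h3⟩
  · refine ⟨R (y + B y), hR _ h1, step₁ _ ?_ ?_⟩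
    · rw [map_add, hAB, hAy, map_neg, neg_add]
    · rw [map_add, hB, add_comm]

/-- An eigenvector and its images under `R` have three distinct sign pairs. The bracket of two of
them has the sign pair of the third, so it is a multiple of it, and the cyclic symmetry makes the
factor `c` the same for all three. -/
lemma exists_frame (hRA : ∀ x, R (A x) = A (B (R x))) (hRB : ∀ x, R (B x) = A (R x))
    (hA : ∀ x, A (A x) = x) (hB : ∀ x, B (B x) = x) (hAB : ∀ x, A (B x) = B (A x)) (hA1 : A ≠ 1)
    (hR : ∀ x, R (R (R x)) = x) :
    ∃ Y₀ Y₁ Y₂ : Sl2, (∀ a b c : ℂ, a • Y₀ + b • Y₁ + c • Y₂ = 0 → a = 0 ∧ b = 0 ∧ c = 0) ∧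
      (R Y₀ = Y₁ ∧ R Y₁ = Y₂ ∧ R Y₂ = Y₀) ∧ (A Y₀ = -Y₀ ∧ A Y₁ = -Y₁ ∧ A Y₂ = Y₂) ∧
      (B Y₀ = -Y₀ ∧ B Y₁ = Y₁ ∧ B Y₂ = -Y₂) ∧ ⁅Y₀, Y₁⁆ = (-2 * Complex.I) • Y₂ := by
  obtain ⟨y, hy0, hAy, hBy⟩ := exists_eigenvector hRA hRB hA hB hAB hA1
  have hRne : ∀ y : Sl2, y ≠ 0 → R y ≠ 0 := fun y hy h => hy (R.injective (show R y = R 0 by rw [h, map_zero]))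
  have a0 : A (R y) = -R y := by rw [← hRB, hBy, map_neg]
  have b0 : B (R y) = -R y := by
    have h4 := hRA y
    rw [hAB, a0, hAy, map_neg] at h4
    exact (neg_eq_iff_eq_neg.2 h4).symm
  have a1 : A (R (R y)) = -R (R y) := by rw [← hRB, b0, map_neg]
  have b1 : B (R (R y)) = R (R y) := by
    have h4 := hRA (R y)
    rw [hAB, a1, a0, map_neg, map_neg] at h4
    exact (neg_injective h4).symm
  have hli : ∀ a b c : ℂ, a • R y + b • R (R y) + c • y = 0 → a = 0 ∧ b = 0 ∧ c = 0 := by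
    intro a b c h0
    have h1 := congrArg A h0
    have h2 := congrArg B h0
    simp only [map_add, map_smul, map_zero, a0, a1, hAy, b0, b1, hBy] at h1 h2
    -- Adding the relation and its images under `A` and `B` in pairs isolates one weight vector at a
    -- time.
    have e1 : (2 * c) • y = 0 := by linear_combination (norm := module) h0 + h1
    have e2 : (2 * b) • R (R y) = 0 := by linear_combination (norm := module) h0 + h2
    have e3 : (-2 * a) • R y = 0 := by linear_combination (norm := module) h1 + h2
    have n0 := hRne y hy0
    have n1 := hRne _ n0
    simp only [smul_eq_zero, hy0, n0, n1, or_false, mul_eq_zero] at e1 e2 e3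
    norm_num at e1 e2 e3
    exact ⟨e3, e2, e1⟩
  have hsurj := LinearMap.injective_iff_surjective.1 (Sl2.lift_injective hli)
  obtain ⟨c, hc⟩ : ∃ c : ℂ, ⁅R y, R (R y)⁆ = c • y := by
    obtain ⟨x, hx⟩ := hsurj ⁅R y, R (R y)⁆
    refine ⟨x.1 1 0, ?_⟩
    have hx' : x.1 0 0 • R y + x.1 0 1 • R (R y) + x.1 1 0 • y = ⁅R y, R (R y)⁆ := hx
    have h1 := congrArg A hx'
    have h2 := congrArg B hx'
    simp only [map_add, map_smul, LieEquiv.map_lie, a0, a1, hAy, b0, b1, hBy, neg_lie, lie_neg,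
      neg_neg] at h1 h2
    rw [← hx'] at h1 h2
    obtain ⟨e0, e1, -⟩ := hli (x.1 0 0) (x.1 0 1) 0
      (by linear_combination (norm := module) (-1 / 2 : ℂ) • h1)
    rw [← hx', e0, e1]
    simp
  have hc1 : ⁅R (R y), y⁆ = c • R y := by
    have := congrArg R hc
    rwa [LieEquiv.map_lie, map_smul, hR] at this
  have hc2 : ⁅y, R y⁆ = c • R (R y) := by
    have := congrArg R hc1
    rwa [LieEquiv.map_lie, map_smul, hR] at this
  -- For `c = 0` all brackets would vanish, contradicting `[h, e] = 2e ≠ 0`.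
  have hc0 : c ≠ 0 := by
    rintro rfl
    obtain ⟨x, hx⟩ := hsurj Sl2.h
    obtain ⟨x', hx'⟩ := hsurj Sl2.e
    have h1 : x.1 0 0 • R y + x.1 0 1 • R (R y) + x.1 1 0 • y = Sl2.h := hx
    have h2 : x'.1 0 0 • R y + x'.1 0 1 • R (R y) + x'.1 1 0 • y = Sl2.e := hx'
    have h3 := Sl2.lie_h_e
    rw [zero_smul] at hc hc1 hc2
    have s0 : ⁅R (R y), R y⁆ = 0 := by rw [← lie_skew, hc, neg_zero]
    have s1 : ⁅y, R (R y)⁆ = 0 := by rw [← lie_skew, hc1, neg_zero]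
    have s2 : ⁅R y, y⁆ = 0 := by rw [← lie_skew, hc2, neg_zero]
    rw [← h1, ← h2] at h3
    simp only [lie_add, add_lie, lie_smul, smul_lie, lie_self, hc, hc1, hc2, s0, s1, s2, smul_zero,
      add_zero] at h3
    rw [h2, eq_comm, smul_eq_zero] at h3
    exact Sl2.e_ne_zero (h3.resolve_left two_ne_zero)
  -- Scaling all three vectors by `l` multiplies the structure constant by `l`; the choice makes it
  -- `-2i`, as for `e + f`, `i(e - f)`, `h`.
  set l : ℂ := -2 * Complex.I / c with hl
  have hl0 : l ≠ 0 := by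
    rw [hl]; exact div_ne_zero (mul_ne_zero (by norm_num) Complex.I_ne_zero) hc0
  have hlc : l * c = -2 * Complex.I := div_mul_cancel₀ _ hc0
  refine ⟨l • R y, l • R (R y), l • y, fun a b c h0 => ?_, ⟨map_smul _ _ _, ?_, map_smul _ _ _⟩,
    ⟨?_, ?_, ?_⟩, ⟨?_, ?_, ?_⟩, ?_⟩
  · simp only [smul_smul] at h0
    simpa [hl0] using hli _ _ _ h0
  · rw [map_smul, hR]
  · rw [map_smul, a0, smul_neg]
  · rw [map_smul, a1, smul_neg]
  · rw [map_smul, hAy]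
  · rw [map_smul, b0, smul_neg]
  · rw [map_smul, b1]
  · rw [map_smul, hBy, smul_neg]
  · rw [lie_smul, smul_lie, hc, smul_smul, smul_smul, smul_smul]
    congr 1
    linear_combination l * hlc

end Sl2Aut

/-- Injectivity of `σ` lets the relations of `A₄` be checked on affine maps of the torus. They carry
over to `ρ`, whose injectivity makes `ρ γ₁` nontrivial, and `Sl2Aut.exists_frame` applies. -/
theorem IsA4Frame.exists_isSl2Frame {L : PeriodPair} {u : ℂ}
    {σ : alternatingGroup (Fin 4) →* TorusAut L} {γ₀ γ₁ γ₂ : alternatingGroup (Fin 4)}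
    (h : IsA4Frame L u σ γ₀ γ₁ γ₂) (hσ : Function.Injective σ)
    {ρ : alternatingGroup (Fin 4) →* Sl2Aut} (hρ : Function.Injective ρ) :
    ∃ Y θ, IsSl2Frame ρ γ₀ γ₁ γ₂ Y θ := by
  have hmul : ∀ γ γ' x, (σ (γ * γ')).1 x = (σ γ).1 ((σ γ').1 x) := fun γ γ' x => by
    rw [map_mul]; rfl
  have e1 : γ₀ * γ₁ = γ₁ * γ₂ * γ₀ := by
    refine hσ (TorusAut.ext_mk fun z => ?_)
    rw [hmul, hmul, hmul, h.apply₁, h.apply₀, h.apply₀, h.apply₂, h.apply₁, eq_comm, ← sub_eq_zero,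
      ← Torus.mk_sub, Torus.mk_eq_zero]
    convert h.hex.mem_lattice_left using 1
    rw [omega6_eq_add]; ring
  have e2 : γ₀ * γ₂ = γ₁ * γ₀ := by
    refine hσ (TorusAut.ext_mk fun z => ?_)
    rw [hmul, hmul, h.apply₂, h.apply₀, h.apply₀, h.apply₁, eq_comm, ← sub_eq_zero,
      ← Torus.mk_sub, Torus.mk_eq_zero]
    convert h.hex.mem_lattice_left using 1
    rw [omega6_eq_add]; linear_combination (-u / 2) * omega3_sq
  have e3 : γ₀ * (γ₀ * γ₀) = 1 := by
    refine hσ (TorusAut.ext_mk fun z => ?_)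
    rw [hmul, hmul, h.apply₀, h.apply₀, h.apply₀, map_one]
    change _ = Torus.mk L z
    congr 1; linear_combination z * omega3_pow_three
  have e4 : γ₁ * γ₂ = γ₂ * γ₁ := by
    refine hσ (TorusAut.ext_mk fun z => ?_)
    rw [hmul, hmul, h.apply₂, h.apply₁, h.apply₁, h.apply₂]
    congr 1; ring
  have hne : γ₁ ≠ 1 := by
    rintro h1
    have h2 := h.apply₁ 0
    rw [h1, map_one] at h2
    have h3 : Torus.mk L (u / 2) = 0 := by rw [← zero_add (u / 2), ← h2]; rfl
    exact h.hex.half_notMem (Torus.mk_eq_zero.1 h3)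
  have hρm : ∀ γ γ' x, ρ γ (ρ γ' x) = ρ (γ * γ') x := fun γ γ' x => by rw [map_mul]; rfl
  have hρ1 : ∀ x, ρ 1 x = x := fun x => by rw [map_one]; rfl
  obtain ⟨Y₀, Y₁, Y₂, hli, hR, hA, hB, h01⟩ := Sl2Aut.exists_frame (R := ρ γ₀) (A := ρ γ₁)
    (B := ρ γ₂) (fun x => by rw [hρm, hρm, hρm, e1, mul_assoc])
    (fun x => by rw [hρm, hρm, e2])
    (fun x => by rw [hρm, kleinFour_mul_self h.mem₁, hρ1])
    (fun x => by rw [hρm, kleinFour_mul_self h.mem₂, hρ1])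
    (fun x => by rw [hρm, hρm, e4])
    (fun h1 => hne (hρ (by rw [h1, map_one])))
    (fun x => by rw [hρm, hρm, mul_assoc, e3, hρ1])
  have h12 : ⁅Y₁, Y₂⁆ = (-2 * Complex.I) • Y₀ := by
    have := congrArg (ρ γ₀) h01
    rwa [LieEquiv.map_lie, map_smul, hR.1, hR.2.1, hR.2.2] at this
  have h20 : ⁅Y₂, Y₀⁆ = (-2 * Complex.I) • Y₁ := by
    have := congrArg (ρ γ₀) h12
    rwa [LieEquiv.map_lie, map_smul, hR.1, hR.2.1, hR.2.2] at this
  have hI := Complex.I_sq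
  have s01 : ⁅Y₁, Y₀⁆ = -((-2 * Complex.I) • Y₂) := by rw [← lie_skew, h01]
  have s12 : ⁅Y₂, Y₁⁆ = -((-2 * Complex.I) • Y₀) := by rw [← lie_skew, h12]
  obtain ⟨θ, hθh, hθe, hθf⟩ := Sl2.exists_aut (H := Y₂)
    (E := (1 / 2 : ℂ) • (Y₀ - Complex.I • Y₁)) (F := (1 / 2 : ℂ) • (Y₀ + Complex.I • Y₁))
    (by
      rw [lie_smul, lie_sub, lie_smul, h20, s12]
      match_scalars <;> first | ring1 | linear_combination hI | linear_combination -hI)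
    (by
      rw [lie_smul, lie_add, lie_smul, h20, s12]
      match_scalars <;> first | ring1 | linear_combination hI)
    (by
      simp only [lie_smul, smul_lie, lie_add, sub_lie, lie_self, h01, s01]
      match_scalars; linear_combination -hI)
    (by
      intro a b c h0
      obtain ⟨k0, k1, k2⟩ := hli ((b + c) / 2) (Complex.I * (c - b) / 2) a (by
        rw [← h0]; module)
      have k3 : c - b = 0 := by simpa using k1
      refine ⟨k2, ?_, ?_⟩
      · linear_combination k0 - k3 / 2
      · linear_combination k0 + k3 / 2)
  have hli' : LinearIndependent ℂ ![Y₀, Y₁, Y₂] := by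
    rw [Fintype.linearIndependent_iff]
    intro g hg
    rw [Fin.sum_univ_three] at hg
    obtain ⟨k0, k1, k2⟩ := hli _ _ _ hg
    intro i
    fin_cases i
    · exact k0
    · exact k1
    · exact k2
  have hspan : ⊤ ≤ Submodule.span ℂ (Set.range ![Y₀, Y₁, Y₂]) := by
    intro y _
    obtain ⟨x, rfl⟩ := LinearMap.injective_iff_surjective.1 (Sl2.lift_injective hli) y
    have hm : ∀ i, ![Y₀, Y₁, Y₂] i ∈ Submodule.span ℂ (Set.range ![Y₀, Y₁, Y₂]) :=
      fun i => Submodule.subset_span ⟨i, rfl⟩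
    exact add_mem (add_mem (Submodule.smul_mem _ _ (hm 0)) (Submodule.smul_mem _ _ (hm 1)))
      (Submodule.smul_mem _ _ (hm 2))
  refine ⟨Module.Basis.mk hli' hspan, θ, ?_⟩
  constructor <;> simp only [Module.Basis.mk_apply, Matrix.cons_val_zero, Matrix.cons_val_one,
    Matrix.cons_val]
  all_goals assumption

/-! ### Free triples in current algebras of `sl₂` -/

section FreeTriple

variable {A C : Type*} [CommRing A] [LieRing C] [LieAlgebra A C]

/-- An `sl₂`-triple which is an `A`-basis of `C`. -/
structure IsFreeTriple (A : Type*) {C : Type*} [CommRing A] [LieRing C] [LieAlgebra A C]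
    (e f h : C) : Prop where
  lie_h_e : ⁅h, e⁆ = (2 : A) • e
  lie_h_f : ⁅h, f⁆ = (-2 : A) • f
  lie_e_f : ⁅e, f⁆ = h
  exists_eq : ∀ a : C, ∃ α β η : A, a = α • e + β • f + η • h
  eq_zero : ∀ α β η : A, α • e + β • f + η • h = 0 → α = 0 ∧ β = 0 ∧ η = 0

lemma IsFreeTriple.eq_of_eq {e f h : C} (ht : IsFreeTriple A e f h) {α β η α' β' η' : A}
    (heq : α • e + β • f + η • h = α' • e + β' • f + η' • h) : α = α' ∧ β = β' ∧ η = η' := by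
  have := ht.eq_zero (α - α') (β - β') (η - η') (by
    rw [← sub_eq_zero.2 heq]; module)
  simpa only [sub_eq_zero] using this

/-- The element with coordinates `a`, `b`, `c`. -/
def coordVec (y : Fin 3 → C) (a b c : A) : C := a • y 0 + b • y 1 + c • y 2

/-- In such a basis the bracket is `-2i` times the cross product, so identities between brackets
become polynomial identities in the coordinates. -/
lemma lie_coordVec {y : Fin 3 → C} {i : A} (h₀₁ : ⁅y 0, y 1⁆ = (-2 * i) • y 2)
    (h₁₂ : ⁅y 1, y 2⁆ = (-2 * i) • y 0) (h₂₀ : ⁅y 2, y 0⁆ = (-2 * i) • y 1) (a b c a' b' c' : A) :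
    ⁅coordVec y a b c, coordVec y a' b' c'⁆ = coordVec y (-2 * i * (b * c' - c * b'))
      (-2 * i * (c * a' - a * c')) (-2 * i * (a * b' - b * a')) := by
  have s₀₁ : ⁅y 1, y 0⁆ = -((-2 * i) • y 2) := by rw [← lie_skew, h₀₁]
  have s₁₂ : ⁅y 2, y 1⁆ = -((-2 * i) • y 0) := by rw [← lie_skew, h₁₂]
  have s₂₀ : ⁅y 0, y 2⁆ = -((-2 * i) • y 1) := by rw [← lie_skew, h₂₀]
  simp only [coordVec, lie_add, add_lie, lie_smul, smul_lie, lie_self, h₀₁, h₁₂, h₂₀, s₀₁, s₁₂, s₂₀]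
  module

lemma smul_coordVec (y : Fin 3 → C) (r a b c : A) :
    r • coordVec y a b c = coordVec y (r * a) (r * b) (r * c) := by
  simp only [coordVec]; module

lemma add_coordVec (y : Fin 3 → C) (a b c a' b' c' : A) :
    coordVec y a b c + coordVec y a' b' c' = coordVec y (a + a') (b + b') (c + c') := by
  simp only [coordVec]; module

/-- Elements `i`, `w`, `k`, `q` playing the role of `√-1`, a primitive cube root of unity, `1 / κ`
and `1 / 4`, and square roots of the three linear forms `w² x + b`, `w x + b` and `x + b`. -/
structure IsCoefficientFrame (i w k b q x p₀ p₁ p₂ : A) : Prop where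
  i_sq : i ^ 2 = -1
  w_sq : w ^ 2 = -w - 1
  k_mul : k * (i * (w - w ^ 2) * b) = 1
  q_mul : 4 * q = 1
  sq₀ : p₀ ^ 2 = w ^ 2 * x + b
  sq₁ : p₁ ^ 2 = w * x + b
  sq₂ : p₂ ^ 2 = x + b

/-- The vector `e'`. -/
def tripleE (y : Fin 3 → C) (w k b q x p₀ p₁ p₂ : A) : C :=
  coordVec y (-(q * k ^ 2 * (w * p₀ * (x - 2 * w * b))))
    (-(q * k ^ 2 * (w ^ 2 * p₁ * (x - 2 * w ^ 2 * b)))) (-(q * k ^ 2 * (p₂ * (x - 2 * b))))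

/-- The vector `f'`. -/
def tripleF (y : Fin 3 → C) (w p₀ p₁ p₂ : A) : C := coordVec y (w * p₀) (w ^ 2 * p₁) p₂

/-- The vector `h'`. -/
def tripleH (y : Fin 3 → C) (k p₀ p₁ p₂ : A) : C :=
  coordVec y (-(k * (p₁ * p₂))) (-(k * (p₀ * p₂))) (-(k * (p₀ * p₁)))

variable {i w k b q x p₀ p₁ p₂ : A}

/-- For the standard symmetric bilinear form in the coordinates, `h·h = 1`, `e·f = 1/2` and all
other products vanish, by the square relations. The vectors `2f`, `2e`, `h` are then dual to `e`,
`f`, `h`, which gives existence and uniqueness of coordinates. -/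
theorem IsCoefficientFrame.isFreeTriple (hc : IsCoefficientFrame i w k b q x p₀ p₁ p₂)
    (y : Module.Basis (Fin 3) A C) (h₀₁ : ⁅y 0, y 1⁆ = (-2 * i) • y 2)
    (h₁₂ : ⁅y 1, y 2⁆ = (-2 * i) • y 0) (h₂₀ : ⁅y 2, y 0⁆ = (-2 * i) • y 1) :
    IsFreeTriple A (tripleE y w k b q x p₀ p₁ p₂) (tripleF y w p₀ p₁ p₂)
      (tripleH y k p₀ p₁ p₂) := by
  obtain ⟨hi, hw, hk, hq, h0, h1, h2⟩ := hc
  constructor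
  · rw [tripleE, tripleH, lie_coordVec h₀₁ h₁₂ h₂₀, smul_coordVec]
    congr 1 <;> grind
  · rw [tripleF, tripleH, lie_coordVec h₀₁ h₁₂ h₂₀, smul_coordVec]
    congr 1 <;> grind
  · rw [tripleE, tripleF, tripleH, lie_coordVec h₀₁ h₁₂ h₂₀]
    congr 1 <;> grind
  · intro a
    have ha : a = coordVec y (y.repr a 0) (y.repr a 1) (y.repr a 2) := by
      conv_lhs => rw [← y.sum_repr a]
      rw [Fin.sum_univ_three, coordVec]
    set a₀ := y.repr a 0
    set a₁ := y.repr a 1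
    set a₂ := y.repr a 2
    set e₀ := -(q * k ^ 2 * (w * p₀ * (x - 2 * w * b))) with he₀
    set e₁ := -(q * k ^ 2 * (w ^ 2 * p₁ * (x - 2 * w ^ 2 * b))) with he₁
    set e₂ := -(q * k ^ 2 * (p₂ * (x - 2 * b))) with he₂
    -- Entries of the completeness relation `h hᵀ + 2(e fᵀ + f eᵀ) = 1`; the coefficients of `a` are
    -- accordingly `2 a·f`, `2 a·e` and `a·h`.
    have d00 : (k * (p₁ * p₂)) ^ 2 + 4 * (w * p₀) * e₀ = 1 := by grind
    have d11 : (k * (p₀ * p₂)) ^ 2 + 4 * (w ^ 2 * p₁) * e₁ = 1 := by grind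
    have d22 : (k * (p₀ * p₁)) ^ 2 + 4 * p₂ * e₂ = 1 := by grind
    have d01 : (k * (p₁ * p₂)) * (k * (p₀ * p₂)) + 2 * (w * p₀) * e₁ + 2 * (w ^ 2 * p₁) * e₀ = 0 := by
      grind
    have d02 : (k * (p₁ * p₂)) * (k * (p₀ * p₁)) + 2 * (w * p₀) * e₂ + 2 * p₂ * e₀ = 0 := by
      grind
    have d12 : (k * (p₀ * p₂)) * (k * (p₀ * p₁)) + 2 * (w ^ 2 * p₁) * e₂ + 2 * p₂ * e₁ = 0 := by
      grind
    refine ⟨2 * (a₀ * (w * p₀) + a₁ * (w ^ 2 * p₁) + a₂ * p₂),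
      2 * (a₀ * e₀ + a₁ * e₁ + a₂ * e₂),
      -(a₀ * (k * (p₁ * p₂)) + a₁ * (k * (p₀ * p₂)) + a₂ * (k * (p₀ * p₁))), ?_⟩
    rw [tripleE, tripleF, tripleH, smul_coordVec, smul_coordVec, smul_coordVec, add_coordVec,
      add_coordVec]
    conv_lhs => rw [ha]
    rw [← he₀, ← he₁, ← he₂]
    congr 1
    · linear_combination -a₀ * d00 - a₁ * d01 - a₂ * d02
    · linear_combination -a₀ * d01 - a₁ * d11 - a₂ * d12
    · linear_combination -a₀ * d02 - a₁ * d12 - a₂ * d22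
  · set e₀ := -(q * k ^ 2 * (w * p₀ * (x - 2 * w * b))) with he₀
    set e₁ := -(q * k ^ 2 * (w ^ 2 * p₁ * (x - 2 * w ^ 2 * b))) with he₁
    set e₂ := -(q * k ^ 2 * (p₂ * (x - 2 * b))) with he₂
    have ohh : (k * (p₁ * p₂)) ^ 2 + (k * (p₀ * p₂)) ^ 2 + (k * (p₀ * p₁)) ^ 2 = 1 := by grind
    have ohe : k * (p₁ * p₂) * e₀ + k * (p₀ * p₂) * e₁ + k * (p₀ * p₁) * e₂ = 0 := by grind
    have ohf : k * (p₁ * p₂) * (w * p₀) + k * (p₀ * p₂) * (w ^ 2 * p₁) + k * (p₀ * p₁) * p₂ = 0 := by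
      grind
    have oee : e₀ ^ 2 + e₁ ^ 2 + e₂ ^ 2 = 0 := by grind
    have off : (w * p₀) ^ 2 + (w ^ 2 * p₁) ^ 2 + p₂ ^ 2 = 0 := by grind
    have oef : 2 * (e₀ * (w * p₀) + e₁ * (w ^ 2 * p₁) + e₂ * p₂) = 1 := by grind
    intro α β η h
    rw [tripleE, tripleF, tripleH, smul_coordVec, smul_coordVec, smul_coordVec, add_coordVec,
      add_coordVec, coordVec, ← he₀, ← he₁, ← he₂] at h
    have hli := Fintype.linearIndependent_iff.1 y.linearIndependent
      ![_, _, _] (by rw [Fin.sum_univ_three]; exact h)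
    have z0 := hli 0
    have z1 := hli 1
    have z2 := hli 2
    simp only [Matrix.cons_val_zero, Matrix.cons_val_one, Matrix.cons_val] at z0 z1 z2
    refine ⟨?_, ?_, ?_⟩
    · linear_combination 2 * ((w * p₀) * z0 + (w ^ 2 * p₁) * z1 + p₂ * z2) - 2 * β * off
        + 2 * η * ohf - α * oef
    · linear_combination 2 * (e₀ * z0 + e₁ * z1 + e₂ * z2) - 2 * α * oee + 2 * η * ohe - β * oef
    · linear_combination -(k * (p₁ * p₂) * z0 + k * (p₀ * p₂) * z1 + k * (p₀ * p₁) * z2) - η * ohh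
        + α * ohe + β * ohf

end FreeTriple

/-! ### The diagonal action on the current algebra -/

section DiagonalAction

variable {L : PeriodPair} {σ : alternatingGroup (Fin 4) →* TorusAut L}
  {ρ : alternatingGroup (Fin 4) →* Sl2Aut}

/-- The diagonal action of `A₄` on the current algebra. -/
abbrev orbitAction (ρ : alternatingGroup (Fin 4) →* Sl2Aut)
    (σ : alternatingGroup (Fin 4) →* TorusAut L) (γ : alternatingGroup (Fin 4)) :
    CurrentAlgebra L (zeroOrbit σ) →ₗ[ℂ] CurrentAlgebra L (zeroOrbit σ) :=
  diagonalAction ρ σ (zeroOrbit_invariant σ) γ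

lemma orbitAction_tmul (γ : alternatingGroup (Fin 4)) (f : RegularFunctions L (zeroOrbit σ))
    (x : Sl2) : orbitAction ρ σ γ (f ⊗ₜ x) = orbitPush σ γ f ⊗ₜ ρ γ x := rfl

lemma orbitAction_one (a : CurrentAlgebra L (zeroOrbit σ)) : orbitAction ρ σ 1 a = a := by
  induction a using TensorProduct.induction_on with
  | zero => rw [map_zero]
  | add a b ha hb => rw [map_add, ha, hb]
  | tmul f x =>
    rw [orbitAction_tmul, IsA4Frame.push_one, map_one]
    rfl

lemma orbitAction_mul (γ γ' : alternatingGroup (Fin 4)) (a : CurrentAlgebra L (zeroOrbit σ)) :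
    orbitAction ρ σ (γ * γ') a = orbitAction ρ σ γ (orbitAction ρ σ γ' a) := by
  induction a using TensorProduct.induction_on with
  | zero => simp only [map_zero]
  | add a b ha hb => simp only [map_add, ha, hb]
  | tmul f x =>
    rw [orbitAction_tmul, IsA4Frame.push_mul, map_mul]
    rfl

lemma orbitAction_smul (γ : alternatingGroup (Fin 4)) (f : RegularFunctions L (zeroOrbit σ))
    (a : CurrentAlgebra L (zeroOrbit σ)) :
    orbitAction ρ σ γ (f • a) = orbitPush σ γ f • orbitAction ρ σ γ a := by
  induction a using TensorProduct.induction_on with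
  | zero => simp only [smul_zero, map_zero]
  | add a b ha hb => simp only [smul_add, map_add, ha, hb]
  | tmul g x =>
    rw [TensorProduct.smul_tmul', orbitAction_tmul, orbitAction_tmul, TensorProduct.smul_tmul',
      smul_eq_mul, map_mul, smul_eq_mul]

end DiagonalAction

namespace IsSl2Frame

variable {L : PeriodPair} {σ : alternatingGroup (Fin 4) →* TorusAut L}
  {ρ : alternatingGroup (Fin 4) →* Sl2Aut} {γ₀ γ₁ γ₂ : alternatingGroup (Fin 4)}
  {Y : Module.Basis (Fin 3) ℂ Sl2} {θ : Sl2Aut}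

/-- The basis of the current algebra given by a basis of `sl₂`. -/
noncomputable abbrev _root_.currentBasis (σ : alternatingGroup (Fin 4) →* TorusAut L)
    (Y : Module.Basis (Fin 3) ℂ Sl2) :
    Module.Basis (Fin 3) (RegularFunctions L (zeroOrbit σ)) (CurrentAlgebra L (zeroOrbit σ)) :=
  Algebra.TensorProduct.basis (RegularFunctions L (zeroOrbit σ)) Y

variable {a b c : RegularFunctions L (zeroOrbit σ)}

lemma lie_currentBasis {j k l : Fin 3} (hl : ⁅Y j, Y k⁆ = (-2 * Complex.I) • Y l) :
    ⁅currentBasis σ Y j, currentBasis σ Y k⁆ =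
      (-2 * algebraMap ℂ (RegularFunctions L (zeroOrbit σ)) Complex.I) • currentBasis σ Y l := by
  simp only [currentBasis, Algebra.TensorProduct.basis_apply]
  rw [LieAlgebra.ExtendScalars.bracket_tmul, hl, TensorProduct.tmul_smul, ← algebraMap_smul
    (RegularFunctions L (zeroOrbit σ)), map_mul, map_neg, map_ofNat, mul_one]

lemma currentElement_eq (hY : IsSl2Frame ρ γ₀ γ₁ γ₂ Y θ) :
    currentElement θ a b c = coordVec (currentBasis σ Y) ((1 / 2 : ℂ) • (b + c))
      ((Complex.I / 2) • (c - b)) a := by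
  have hsm : ∀ (f : RegularFunctions L (zeroOrbit σ)) j, f • currentBasis σ Y j = f ⊗ₜ Y j := by
    intro f j
    rw [currentBasis, Algebra.TensorProduct.basis_apply, TensorProduct.smul_tmul', smul_eq_mul,
      mul_one]
  rw [coordVec, hsm, hsm, hsm, currentElement, hY.map_h, hY.map_e, hY.map_f]
  simp only [TensorProduct.tmul_smul, TensorProduct.tmul_add, TensorProduct.tmul_sub,
    ← TensorProduct.smul_tmul', TensorProduct.add_tmul, TensorProduct.sub_tmul]
  module

lemma orbitAction₀ (hY : IsSl2Frame ρ γ₀ γ₁ γ₂ Y θ) :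
    orbitAction ρ σ γ₀ (coordVec (currentBasis σ Y) a b c) = coordVec (currentBasis σ Y)
      (orbitPush σ γ₀ c) (orbitPush σ γ₀ a) (orbitPush σ γ₀ b) := by
  simp only [coordVec, map_add, orbitAction_smul, currentBasis, Algebra.TensorProduct.basis_apply,
    orbitAction_tmul, map_one, hY.map₀]
  abel

lemma orbitAction₁ (hY : IsSl2Frame ρ γ₀ γ₁ γ₂ Y θ) :
    orbitAction ρ σ γ₁ (coordVec (currentBasis σ Y) a b c) = coordVec (currentBasis σ Y)
      (-orbitPush σ γ₁ a) (-orbitPush σ γ₁ b) (orbitPush σ γ₁ c) := by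
  simp only [coordVec, map_add, orbitAction_smul, currentBasis, Algebra.TensorProduct.basis_apply,
    orbitAction_tmul, map_one, hY.map₁, TensorProduct.tmul_neg, smul_neg, neg_smul]

lemma orbitAction₂ (hY : IsSl2Frame ρ γ₀ γ₁ γ₂ Y θ) :
    orbitAction ρ σ γ₂ (coordVec (currentBasis σ Y) a b c) = coordVec (currentBasis σ Y)
      (-orbitPush σ γ₂ a) (orbitPush σ γ₂ b) (-orbitPush σ γ₂ c) := by
  simp only [coordVec, map_add, orbitAction_smul, currentBasis, Algebra.TensorProduct.basis_apply,
    orbitAction_tmul, map_one, hY.map₂, TensorProduct.tmul_neg, smul_neg, neg_smul]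

end IsSl2Frame

/-- An `sl₂`-triple which is a basis of the current algebra over the regular functions, and on
which the Klein four group acts trivially and the rotation `γ₀` by cube roots of unity. -/
structure IsEquivariantTriple {L : PeriodPair} (ρ : alternatingGroup (Fin 4) →* Sl2Aut)
    (σ : alternatingGroup (Fin 4) →* TorusAut L) (γ₀ γ₁ γ₂ : alternatingGroup (Fin 4))
    (e f h : CurrentAlgebra L (zeroOrbit σ)) : Prop
    extends IsFreeTriple (RegularFunctions L (zeroOrbit σ)) e f h where
  map₀ : orbitAction ρ σ γ₀ e = algebraMap ℂ (RegularFunctions L (zeroOrbit σ)) omega3 • e ∧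
    orbitAction ρ σ γ₀ f = algebraMap ℂ (RegularFunctions L (zeroOrbit σ)) omega3 ^ 2 • f ∧
    orbitAction ρ σ γ₀ h = h
  map₁ : orbitAction ρ σ γ₁ e = e ∧ orbitAction ρ σ γ₁ f = f ∧ orbitAction ρ σ γ₁ h = h
  map₂ : orbitAction ρ σ γ₂ e = e ∧ orbitAction ρ σ γ₂ f = f ∧ orbitAction ρ σ γ₂ h = h

/-- Passing from `θh, θe, θf` to `Y₀, Y₁, Y₂` brings the columns of `Ψ` into a form in which the
cyclic symmetry is visible. Here `k = κ⁻¹` and `x = s℘`, with `s, b` from `sq_eq`. -/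
lemma IsFunctionFrame.exists_eq_triple {L : PeriodPair} {u : ℂ}
    {σ : alternatingGroup (Fin 4) →* TorusAut L} {ρ : alternatingGroup (Fin 4) →* Sl2Aut}
    {γ₀ γ₁ γ₂ : alternatingGroup (Fin 4)} {P P' p₀ p₁ p₂ : RegularFunctions L (zeroOrbit σ)}
    {Y : Module.Basis (Fin 3) ℂ Sl2} {θ : Sl2Aut}
    (hp : IsFunctionFrame L u σ P P' p₀ p₁ p₂) (h : IsA4Frame L u σ γ₀ γ₁ γ₂)
    (hY : IsSl2Frame ρ γ₀ γ₁ γ₂ Y θ) :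
    ∃ s b k : ℂ, IsCoefficientFrame (algebraMap ℂ (RegularFunctions L (zeroOrbit σ)) Complex.I)
        (algebraMap ℂ _ omega3) (algebraMap ℂ _ k) (algebraMap ℂ _ b) (algebraMap ℂ _ (1 / 4))
        (algebraMap ℂ _ s * P) p₀ p₁ p₂ ∧
      -psiF θ (kappa L u) p₀ p₁ p₂ = tripleE (currentBasis σ Y) (algebraMap ℂ _ omega3)
        (algebraMap ℂ _ k) (algebraMap ℂ _ b) (algebraMap ℂ _ (1 / 4)) (algebraMap ℂ _ s * P)
        p₀ p₁ p₂ ∧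
      -psiE θ p₀ p₁ p₂ = tripleF (currentBasis σ Y) (algebraMap ℂ _ omega3) p₀ p₁ p₂ ∧
      -psiH θ (kappa L u) p₀ p₁ p₂ = tripleH (currentBasis σ Y) (algebraMap ℂ _ k) p₀ p₁ p₂ := by
  obtain ⟨s, b, hb, h0, h1, h2⟩ := hp.sq_eq h
  have hκ := h.hex.kappa_ne_zero
  set κ := kappa L u
  set φ := algebraMap ℂ (RegularFunctions L (zeroOrbit σ)) with hφ
  have hw : φ omega3 ^ 2 = -φ omega3 - 1 := by
    rw [← map_pow, omega3_sq, map_sub, map_neg, map_one]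
  have hi : φ Complex.I ^ 2 = -1 := by rw [← map_pow, Complex.I_sq, map_neg, map_one]
  have hb' : φ Complex.I * φ κ = -(φ omega3 - φ omega3 ^ 2) * φ b := by
    rw [← map_mul, hb, map_mul, map_neg, map_sub, map_pow]
  have hk : φ κ⁻¹ * φ κ = 1 := by rw [← map_mul, inv_mul_cancel₀ hκ, map_one]
  have hq : 4 * φ (1 / 4) = 1 := by
    rw [← map_ofNat φ 4, ← map_mul]; norm_num
  have ht : 2 * φ (1 / 2) = 1 := by
    rw [← map_ofNat φ 2, ← map_mul]; norm_num
  have hit : φ (Complex.I / 2) = φ Complex.I * φ (1 / 2) := by rw [← map_mul]; congr 1; ring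
  have hqk : φ (4 * κ ^ 2)⁻¹ = φ (1 / 4) * φ κ⁻¹ ^ 2 := by
    rw [← map_pow, ← map_mul]; congr 1; field_simp
  rw [Algebra.smul_def, ← hφ] at h0 h1 h2
  rw [map_mul, mul_assoc] at h0 h1
  rw [map_pow] at h0
  have hkm : φ κ⁻¹ * (φ Complex.I * (φ omega3 - φ omega3 ^ 2) * φ b) = 1 := by
    linear_combination φ κ⁻¹ * φ Complex.I * hb' + hk - φ κ⁻¹ * φ κ * hi
  have hc : IsCoefficientFrame (φ Complex.I) (φ omega3) (φ κ⁻¹) (φ b) (φ (1 / 4)) (φ s * P)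
      p₀ p₁ p₂ := ⟨hi, hw, hkm, hq, h0, h1, h2⟩
  have hH : -psiH θ κ p₀ p₁ p₂ = tripleH (currentBasis σ Y) (φ κ⁻¹) p₀ p₁ p₂ := by
    rw [psiH, hY.currentElement_eq, ← neg_one_smul (RegularFunctions L (zeroOrbit σ)),
      smul_coordVec, tripleH]
    simp only [Algebra.smul_def, map_neg, hit, ← hφ]
    congr 1
    · linear_combination -(φ κ⁻¹ * p₁ * p₂) * ht
    · linear_combination 2 * φ (1 / 2) * φ κ⁻¹ * p₀ * p₂ * hi - φ κ⁻¹ * p₀ * p₂ * ht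
    · ring
  have hE : -psiE θ p₀ p₁ p₂ = tripleF (currentBasis σ Y) (φ omega3) p₀ p₁ p₂ := by
    rw [psiE, hY.currentElement_eq, ← neg_one_smul (RegularFunctions L (zeroOrbit σ)),
      smul_coordVec, tripleF]
    simp only [Algebra.smul_def, map_neg, map_mul, map_pow, hit, ← hφ]
    congr 1
    · linear_combination φ omega3 * p₀ * ht
    · linear_combination -2 * φ (1 / 2) * φ omega3 ^ 2 * p₁ * hi + φ omega3 ^ 2 * p₁ * ht
    · ring
  -- The relation `iκ = -(ω₃ - ω₃²)b` turns `p₁² - iκ` into `ω₃(x - 2ω₃b)` and `p₀² + iκ` into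
  -- `ω₃²(x - 2ω₃²b)`; moreover `p₀² + p₁² = -(x - 2b)`.
  have hF : -psiF θ κ p₀ p₁ p₂ = tripleE (currentBasis σ Y) (φ omega3) (φ κ⁻¹) (φ b) (φ (1 / 4))
      (φ s * P) p₀ p₁ p₂ := by
    rw [psiF, hY.currentElement_eq, ← neg_one_smul (RegularFunctions L (zeroOrbit σ)),
      smul_coordVec, tripleE]
    simp only [Algebra.smul_def, map_neg, hit, hqk, ← hφ]
    congr 1
    · linear_combination -(φ (1 / 4) * φ κ⁻¹ ^ 2) * p₀ * (h1 - hb' + φ b * hw) - φ (1 / 4) * φ κ⁻¹ ^ 2 * p₀ * (p₁ ^ 2 - φ Complex.I * φ κ) * ht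
    · linear_combination 2 * φ (1 / 2) * φ (1 / 4) * φ κ⁻¹ ^ 2 * p₁ * p₀ ^ 2 * hi - φ (1 / 4) * φ κ⁻¹ ^ 2 * p₁ * (p₀ ^ 2 + φ Complex.I * φ κ) * ht
        - φ (1 / 4) * φ κ⁻¹ ^ 2 * p₁ * (h0 + hb' + φ b * (1 + 2 * φ omega3 * (φ omega3 - 1)) * hw)
    · linear_combination φ (1 / 4) * φ κ⁻¹ ^ 2 * p₂ * (h0 + h1 + (φ s * P) * hw)
  exact ⟨s, b, κ⁻¹, hc, hF, hE, hH⟩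

/-- The coordinate at `Yⱼ` is `pⱼ` times a `V`-invariant function, or the product of the other two
`p`'s; both have the same signs as `Yⱼ` under `V`, so these cancel. The rotation permutes the `Yⱼ`
and the `pⱼ` alike, leaving only a cube root of unity. -/
theorem IsFunctionFrame.isEquivariantTriple {L : PeriodPair} {u : ℂ}
    {σ : alternatingGroup (Fin 4) →* TorusAut L} {ρ : alternatingGroup (Fin 4) →* Sl2Aut}
    {γ₀ γ₁ γ₂ : alternatingGroup (Fin 4)} {P P' p₀ p₁ p₂ : RegularFunctions L (zeroOrbit σ)}
    {Y : Module.Basis (Fin 3) ℂ Sl2} {θ : Sl2Aut}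
    (hp : IsFunctionFrame L u σ P P' p₀ p₁ p₂) (h : IsA4Frame L u σ γ₀ γ₁ γ₂)
    (hY : IsSl2Frame ρ γ₀ γ₁ γ₂ Y θ) :
    IsEquivariantTriple ρ σ γ₀ γ₁ γ₂ (-psiF θ (kappa L u) p₀ p₁ p₂) (-psiE θ p₀ p₁ p₂)
      (-psiH θ (kappa L u) p₀ p₁ p₂) := by
  obtain ⟨s, b, k, hc, hF, hE, hH⟩ := hp.exists_eq_triple h hY
  set φ := algebraMap ℂ (RegularFunctions L (zeroOrbit σ)) with hφ
  have hw := hc.w_sq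
  have hx₀ : orbitPush σ γ₀ (φ s * P) = φ omega3 ^ 2 * (φ s * P) := by
    rw [map_mul, (hp.push₀ h).1, hφ, AlgHom.commutes, Algebra.smul_def, map_pow]; ring
  have hx₁ : orbitPush σ γ₁ (φ s * P) = φ s * P := by
    rw [map_mul, (hp.push₁ h).1, hφ, AlgHom.commutes]
  have hx₂ : orbitPush σ γ₂ (φ s * P) = φ s * P := by
    rw [map_mul, (hp.push₂ h).1, hφ, AlgHom.commutes]
  have hcm : ∀ γ c, orbitPush σ γ (φ c) = φ c := fun γ c => AlgHom.commutes _ _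
  obtain ⟨-, -, q0, q1, q2⟩ := hp.push₀ h
  obtain ⟨-, -, r0, r1, r2⟩ := hp.push₁ h
  obtain ⟨-, -, s0, s1, s2⟩ := hp.push₂ h
  rw [hH, hE, hF]
  refine ⟨hc.isFreeTriple _ (IsSl2Frame.lie_currentBasis hY.lie₀₁) (IsSl2Frame.lie_currentBasis hY.lie₁₂)
    (IsSl2Frame.lie_currentBasis hY.lie₂₀), ⟨?_, ?_, ?_⟩, ⟨?_, ?_, ?_⟩, ?_, ?_, ?_⟩
  · rw [tripleE, hY.orbitAction₀, smul_coordVec]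
    simp only [map_neg, map_mul, map_sub, map_pow, map_ofNat, hcm, hx₀, q0, q1, q2]
    congr 1
    · linear_combination -2 * φ (1 / 4) * φ k ^ 2 * p₀ * φ b * (φ omega3 - 1) * hw
    · linear_combination -2 * φ (1 / 4) * φ k ^ 2 * p₁ * φ b * φ omega3 ^ 2 * (φ omega3 - 1) * hw
    · linear_combination -(φ (1 / 4) * φ k ^ 2) * p₂ * ((φ s * P) - 2 * φ b) *
        φ omega3 * (φ omega3 - 1) * hw
  · rw [tripleF, hY.orbitAction₀, smul_coordVec]
    simp only [map_mul, map_pow, hcm, q0, q1, q2]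
    congr 1
    · linear_combination -p₀ * (φ omega3 - 1) * hw
    · linear_combination -p₁ * φ omega3 * (φ omega3 - 1) * hw
  · rw [tripleH, hY.orbitAction₀]
    simp only [map_neg, map_mul, hcm, q0, q1, q2]
    congr 1 <;> ring
  · rw [tripleE, hY.orbitAction₁]
    simp only [map_neg, map_mul, map_sub, map_pow, map_ofNat, hcm, hx₁, r0, r1, r2]
    congr 1 <;> ring
  · rw [tripleF, hY.orbitAction₁]
    simp only [map_mul, map_pow, hcm, r0, r1, r2]
    congr 1 <;> ring
  · rw [tripleH, hY.orbitAction₁]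
    simp only [map_neg, map_mul, hcm, r0, r1, r2]
    congr 1 <;> ring
  · rw [tripleE, hY.orbitAction₂]
    simp only [map_neg, map_mul, map_sub, map_pow, map_ofNat, hcm, hx₂, s0, s1, s2]
    congr 1 <;> ring
  · rw [tripleF, hY.orbitAction₂]
    simp only [map_mul, map_pow, hcm, s0, s1, s2]
    congr 1 <;> ring
  · rw [tripleH, hY.orbitAction₂]
    simp only [map_neg, map_mul, hcm, s0, s1, s2]
    congr 1 <;> ring

lemma IsFreeTriple.lie_smul_smul {A C : Type*} [CommRing A] [LieRing C] [LieAlgebra A C]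
    {e f h : C} (ht : IsFreeTriple A e f h) (r s : A) :
    ⁅h, r • e⁆ = (2 : A) • r • e ∧ ⁅h, s • f⁆ = (-2 : A) • s • f ∧ ⁅r • e, s • f⁆ = (r * s) • h := by
  refine ⟨?_, ?_, ?_⟩
  · rw [lie_smul, ht.lie_h_e, smul_comm]
  · rw [lie_smul, ht.lie_h_f, smul_comm]
  · rw [smul_lie, lie_smul, ht.lie_e_f, smul_smul]

lemma linearIndependent_triple {R M : Type*} [Ring R] [AddCommGroup M] [Module R M] {x y z : M}
    (h : ∀ a b c : R, a • x + b • y + c • z = 0 → a = 0 ∧ b = 0 ∧ c = 0) :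
    LinearIndependent R ![x, y, z] := by
  rw [Fintype.linearIndependent_iff]
  intro g hg
  rw [Fin.sum_univ_three] at hg
  obtain ⟨k0, k1, k2⟩ := h _ _ _ hg
  intro i
  fin_cases i
  exacts [k0, k1, k2]

/-! ### Normal forms over the two rings of invariants. -/

namespace IsEquivariantTriple

variable {L : PeriodPair} {u : ℂ} {σ : alternatingGroup (Fin 4) →* TorusAut L}
  {ρ : alternatingGroup (Fin 4) →* Sl2Aut} {γ₀ γ₁ γ₂ : alternatingGroup (Fin 4)}
  {P P' p₀ p₁ p₂ : RegularFunctions L (zeroOrbit σ)} {e f h : CurrentAlgebra L (zeroOrbit σ)}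

local instance currentModule :
    Module (RegularFunctions L (zeroOrbit σ)) (CurrentAlgebra L (zeroOrbit σ)) :=
  TensorProduct.leftModule

local instance currentMulAction :
    MulAction (RegularFunctions L (zeroOrbit σ)) (CurrentAlgebra L (zeroOrbit σ)) :=
  currentModule.toMulAction

lemma two_smul_eq (a : CurrentAlgebra L (zeroOrbit σ)) :
    (2 : RegularFunctions L (zeroOrbit σ)) • a = (2 : ℂ) • a ∧
      (-2 : RegularFunctions L (zeroOrbit σ)) • a = (-2 : ℂ) • a := by
  rw [neg_smul, neg_smul, two_smul, two_smul]
  exact ⟨rfl, rfl⟩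

/-- The coefficients of an element invariant under the Klein four group are invariant. -/
lemma coeff_mem (ht : IsEquivariantTriple ρ σ γ₀ γ₁ γ₂ e f h)
    (hp : IsFunctionFrame L u σ P P' p₀ p₁ p₂) (hσ : IsA4Frame L u σ γ₀ γ₁ γ₂)
    {α β η : RegularFunctions L (zeroOrbit σ)}
    (h1 : orbitAction ρ σ γ₁ (α • e + β • f + η • h) = α • e + β • f + η • h)
    (h2 : orbitAction ρ σ γ₂ (α • e + β • f + η • h) = α • e + β • f + η • h) :
    α ∈ Algebra.adjoin ℂ {P, P'} ∧ β ∈ Algebra.adjoin ℂ {P, P'} ∧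
      η ∈ Algebra.adjoin ℂ {P, P'} := by
  simp only [map_add, orbitAction_smul, ht.map₁, ht.map₂] at h1 h2
  obtain ⟨a1, b1, c1⟩ := ht.eq_of_eq h1
  obtain ⟨a2, b2, c2⟩ := ht.eq_of_eq h2
  exact ⟨hp.mem_adjoin_of_push hσ a1 a2, hp.mem_adjoin_of_push hσ b1 b2,
    hp.mem_adjoin_of_push hσ c1 c2⟩

theorem isNormalForm_kleinFour (ht : IsEquivariantTriple ρ σ γ₀ γ₁ γ₂ e f h)
    (hp : IsFunctionFrame L u σ P P' p₀ p₁ p₂) (hσ : IsA4Frame L u σ γ₀ γ₁ γ₂) :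
    IsNormalForm
      (automorphicLieAlgebra (ρ.comp (alternatingGroup.kleinFour (Fin 4)).subtype)
        (σ.comp (alternatingGroup.kleinFour (Fin 4)).subtype)
        (fun γ => zeroOrbit_invariant σ γ.1))
      (Algebra.adjoin ℂ {P, P'}) e f h 1 := by
  refine ⟨?_, fun a => ⟨fun ha => ?_, fun ha => ?_⟩, ?_, ?_, ?_, one_mem _⟩
  · refine linearIndependent_triple (R := Algebra.adjoin ℂ {P, P'})
      (M := CurrentAlgebra L (zeroOrbit σ)) fun a b c habc => ?_
    obtain ⟨k0, k1, k2⟩ := ht.eq_zero a b c habc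
    exact ⟨Subtype.ext k0, Subtype.ext k1, Subtype.ext k2⟩
  · obtain ⟨α, β, η, rfl⟩ := ht.exists_eq a
    obtain ⟨hα, hβ, hη⟩ := ht.coeff_mem hp hσ (ha ⟨γ₁, hσ.mem₁⟩) (ha ⟨γ₂, hσ.mem₂⟩)
    exact Submodule.mem_span_triple.2 ⟨⟨α, hα⟩, ⟨β, hβ⟩, ⟨η, hη⟩, rfl⟩
  · obtain ⟨⟨α, hα⟩, ⟨β, hβ⟩, ⟨η, hη⟩, rfl⟩ := Submodule.mem_span_triple.1 ha
    rw [← hp.kleinFour_invariants hσ] at hα hβ hη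
    change ∀ γ : alternatingGroup.kleinFour (Fin 4), orbitAction ρ σ γ.1 (α • e + β • f + η • h) =
      α • e + β • f + η • h
    intro γ
    refine hσ.kleinFour_apply_eq (T := fun γ a => orbitAction ρ σ γ a) orbitAction_one
      orbitAction_mul ?_ ?_ γ.2
    · have k0 : orbitPush σ γ₁ α = α := hα ⟨γ₁, hσ.mem₁⟩
      have k1 : orbitPush σ γ₁ β = β := hβ ⟨γ₁, hσ.mem₁⟩
      have k2 : orbitPush σ γ₁ η = η := hη ⟨γ₁, hσ.mem₁⟩
      simp only [map_add, orbitAction_smul, ht.map₁, k0, k1, k2]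
    · have k0 : orbitPush σ γ₂ α = α := hα ⟨γ₂, hσ.mem₂⟩
      have k1 : orbitPush σ γ₂ β = β := hβ ⟨γ₂, hσ.mem₂⟩
      have k2 : orbitPush σ γ₂ η = η := hη ⟨γ₂, hσ.mem₂⟩
      simp only [map_add, orbitAction_smul, ht.map₂, k0, k1, k2]
  · rw [ht.lie_h_e, (two_smul_eq e).1]
  · rw [ht.lie_h_f, (two_smul_eq f).2]
  · rw [ht.lie_e_f, one_smul]

/-- `℘³` is a nonzero polynomial in `℘'`, and `℘'` is transcendental, so the cancellation takes
place in a polynomial ring. -/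
lemma eq_zero_of_mul_pow_eq_zero (hp : IsFunctionFrame L u σ P P' p₀ p₁ p₂)
    (hσ : IsA4Frame L u σ γ₀ γ₁ γ₂) {q : RegularFunctions L (zeroOrbit σ)}
    (hq : q ∈ Algebra.adjoin ℂ {P'}) (h0 : q * P ^ 3 = 0) : q = 0 := by
  obtain ⟨r, rfl⟩ : ∃ r, Polynomial.aeval P' r = q := by
    rwa [Algebra.adjoin_singleton_eq_range_aeval, AlgHom.mem_range] at hq
  have h1 : P ^ 3 = Polynomial.aeval P'
      (Polynomial.C (1 / 4) * (Polynomial.X ^ 2 + Polynomial.C (halfPair L).g₃)) := by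
    rw [hp.pow_three_eq hσ, map_mul, map_add, map_pow, Polynomial.aeval_X, Polynomial.aeval_C,
      Polynomial.aeval_C, Algebra.smul_def]
  rw [h1, ← map_mul] at h0
  rcases mul_eq_zero.1 (hp.aeval_eq_zero hσ h0) with h2 | h2
  · rw [h2, map_zero]
  · have h3 := congrArg (Polynomial.coeff · 2) h2
    simp at h3

/-- The rotation scales `e'` by `ω₃`, `f'` by `ω₃²` and `℘` by `ω₃²`. Hence the coefficients of `e',
f', h'` in an invariant element lie in the eigenspaces `R℘`, `R℘²` and `R`. -/
theorem isNormalForm (ht : IsEquivariantTriple ρ σ γ₀ γ₁ γ₂ e f h)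
    (hp : IsFunctionFrame L u σ P P' p₀ p₁ p₂) (hσ : IsA4Frame L u σ γ₀ γ₁ γ₂) :
    IsNormalForm (automorphicLieAlgebra ρ σ (zeroOrbit_invariant σ)) (Algebra.adjoin ℂ {P'})
      (P • e) (P ^ 2 • f) h (P ^ 3) := by
  refine ⟨?_, fun a => ⟨fun ha => ?_, fun ha => ?_⟩, ?_, ?_, ?_, hp.pow_three_mem hσ⟩
  · refine linearIndependent_triple (R := Algebra.adjoin ℂ {P'})
      (M := CurrentAlgebra L (zeroOrbit σ)) fun a b c habc => ?_
    have habc' : (a.1 * P) • e + (b.1 * P ^ 2) • f + c.1 • h = 0 := by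
      rw [mul_smul, mul_smul]; exact habc
    obtain ⟨k0, k1, k2⟩ := ht.eq_zero _ _ _ habc'
    -- Multiplying by the missing power of `℘` completes it to `℘³`, which can be cancelled.
    exact ⟨Subtype.ext (eq_zero_of_mul_pow_eq_zero hp hσ a.2 (by linear_combination P ^ 2 * k0)),
      Subtype.ext (eq_zero_of_mul_pow_eq_zero hp hσ b.2 (by linear_combination P * k1)),
      Subtype.ext k2⟩
  · obtain ⟨α, β, η, rfl⟩ := ht.exists_eq a
    obtain ⟨hα, hβ, hη⟩ := ht.coeff_mem hp hσ (ha γ₁) (ha γ₂)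
    have h0 : orbitAction ρ σ γ₀ (α • e + β • f + η • h) = α • e + β • f + η • h := ha γ₀
    simp only [map_add, orbitAction_smul, ht.map₀, smul_smul] at h0
    obtain ⟨a0, b0, c0⟩ := ht.eq_of_eq h0
    have h3 : algebraMap ℂ (RegularFunctions L (zeroOrbit σ)) omega3 ^ 3 = 1 := by
      rw [← map_pow, omega3_pow_three, map_one]
    obtain ⟨q, hq, rfl⟩ := (hp.exists_eq_of_push₀ hσ hα).2.1 (by
      rw [Algebra.smul_def, map_pow]
      linear_combination algebraMap ℂ (RegularFunctions L (zeroOrbit σ)) omega3 ^ 2 * a0 -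
        orbitPush σ γ₀ α * h3)
    obtain ⟨r, hr, rfl⟩ := (hp.exists_eq_of_push₀ hσ hβ).2.2 (by
      rw [Algebra.smul_def]
      linear_combination algebraMap ℂ (RegularFunctions L (zeroOrbit σ)) omega3 * b0 -
        orbitPush σ γ₀ β * h3)
    refine Submodule.mem_span_triple.2
      ⟨⟨q, hq⟩, ⟨r, hr⟩, ⟨η, (hp.exists_eq_of_push₀ hσ hη).1 c0⟩, ?_⟩
    change q • P • e + r • P ^ 2 • f + η • h = _
    rw [mul_smul, mul_smul]
  · obtain ⟨⟨α, hα⟩, ⟨β, hβ⟩, ⟨η, hη⟩, rfl⟩ := Submodule.mem_span_triple.1 ha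
    rw [← hp.invariantFunctions_eq hσ] at hα hβ hη
    change ∀ γ, orbitAction ρ σ γ (α • P • e + β • P ^ 2 • f + η • h) =
      α • P • e + β • P ^ 2 • f + η • h
    intro γ
    refine hσ.apply_eq (T := fun γ a => orbitAction ρ σ γ a) orbitAction_one orbitAction_mul
      ?_ ?_ ?_ γ
    · have k0 : orbitPush σ γ₀ α = α := hα γ₀
      have k1 : orbitPush σ γ₀ β = β := hβ γ₀
      have k2 : orbitPush σ γ₀ η = η := hη γ₀
      have h3 : algebraMap ℂ (RegularFunctions L (zeroOrbit σ)) omega3 ^ 3 = 1 := by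
        rw [← map_pow, omega3_pow_three, map_one]
      simp only [map_add, map_mul, map_pow, orbitAction_smul, ht.map₀, (hp.push₀ hσ).1, k0, k1, k2,
        smul_smul, Algebra.smul_def]
      congr 3
      · linear_combination α * P * h3
      · linear_combination β * P ^ 2 *
          (1 + algebraMap ℂ (RegularFunctions L (zeroOrbit σ)) omega3 ^ 3) * h3
    · have k0 : orbitPush σ γ₁ α = α := hα γ₁
      have k1 : orbitPush σ γ₁ β = β := hβ γ₁
      have k2 : orbitPush σ γ₁ η = η := hη γ₁
      simp only [map_add, map_pow, orbitAction_smul, ht.map₁, (hp.push₁ hσ).1, k0, k1, k2]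
    · have k0 : orbitPush σ γ₂ α = α := hα γ₂
      have k1 : orbitPush σ γ₂ β = β := hβ γ₂
      have k2 : orbitPush σ γ₂ η = η := hη γ₂
      simp only [map_add, map_pow, orbitAction_smul, ht.map₂, (hp.push₂ hσ).1, k0, k1, k2]
  · rw [(ht.lie_smul_smul P (P ^ 2)).1, (two_smul_eq _).1]
  · rw [(ht.lie_smul_smul P (P ^ 2)).2.1, (two_smul_eq _).2]
  · rw [(ht.lie_smul_smul P (P ^ 2)).2.2, ← pow_succ']

end IsEquivariantTriple

/-! ### Chebyshev polynomials -/

namespace Polynomial.Chebyshev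

variable (R : Type*) [CommRing R]

/-- With `X = cos x` this is the addition formula for `cos`, as `U_{k-1}(cos x) sin x = sin kx`;
`U_sub_sub_one` is that for `sin`. Integer indices are needed because the `A_k` are indexed by `ℤ`.
-/
theorem T_add (k m : ℤ) : T R (k + m) = T R k * T R m + (X ^ 2 - 1) * U R (k - 1) * U R (m - 1) := by
  induction k using Polynomial.Chebyshev.induct with
  | zero => simp
  | one =>
    have := T_eq_X_mul_T_sub_pol_U R (m - 1)
    rw [show m - 1 + 2 = 1 + m by ring, sub_add_cancel] at this
    rw [this, T_one, sub_self, U_zero]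
    ring
  | add_two n h1 h0 =>
    have e1 := T_add_two R (n + m)
    have e2 := T_add_two R n
    have e3 := U_add_two R ((n : ℤ) - 1)
    rw [show (n : ℤ) + m + 2 = n + 2 + m by ring, show (n : ℤ) + m + 1 = n + 1 + m by ring] at e1
    rw [show (n : ℤ) - 1 + 2 = n + 2 - 1 by ring, show (n : ℤ) - 1 + 1 = n + 1 - 1 by ring] at e3
    rw [e1, h1, h0, e2, e3]
    ring
  | neg_add_one n h0 h1 =>
    have e1 := T_sub_one R (-n + m)
    have e2 := T_sub_one R (-n)
    have e3 := U_sub_one R (-(n : ℤ) - 1)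
    rw [show -(n : ℤ) + m - 1 = -n - 1 + m by ring, show -(n : ℤ) + m + 1 = -n + 1 + m by ring] at e1
    rw [show -(n : ℤ) - 1 + 1 = -n + 1 - 1 by ring] at e3
    rw [e1, h1, h0, e2, e3]
    ring

theorem U_sub_sub_one (k l : ℤ) : U R (k - l - 1) = U R (k - 1) * T R l - T R k * U R (l - 1) := by
  induction k using Polynomial.Chebyshev.induct with
  | zero => rw [zero_sub, zero_sub, U_neg_sub_one, U_neg_one, T_zero]; ring
  | one =>
    have := U_add_one R (l - 1)
    rw [sub_add_cancel, sub_sub] at this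
    rw [sub_self, U_zero, T_one, T_eq_U_sub_X_mul_U, show 1 - l - 1 = -l by ring, U_neg, this]
    norm_num
    ring
  | add_two n h1 h0 =>
    have e1 := U_add_two R (n - l - 1)
    have e2 := T_add_two R n
    have e3 := U_add_two R ((n : ℤ) - 1)
    rw [show (n : ℤ) - l - 1 + 2 = n + 2 - l - 1 by ring,
      show (n : ℤ) - l - 1 + 1 = n + 1 - l - 1 by ring] at e1
    rw [show (n : ℤ) - 1 + 2 = n + 2 - 1 by ring, show (n : ℤ) - 1 + 1 = n + 1 - 1 by ring] at e3
    rw [e1, h1, h0, e2, e3]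
    ring
  | neg_add_one n h0 h1 =>
    have e1 := U_sub_one R (-n - l - 1)
    have e2 := T_sub_one R (-n)
    have e3 := U_sub_one R (-(n : ℤ) - 1)
    rw [show -(n : ℤ) - l - 1 - 1 = -n - 1 - l - 1 by ring,
      show -(n : ℤ) - l - 1 + 1 = -n + 1 - l - 1 by ring] at e1
    rw [show -(n : ℤ) - 1 + 1 = -n + 1 - 1 by ring] at e3
    rw [e1, h1, h0, e2, e3]
    ring

theorem U_add_sub_one (k m : ℤ) : U R (k + m - 1) = U R (k - 1) * T R m + T R k * U R (m - 1) := by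
  rw [← sub_neg_eq_add k m, U_sub_sub_one, T_neg, U_neg_sub_one]
  ring

theorem T_sub (k m : ℤ) : T R (k - m) = T R k * T R m - (X ^ 2 - 1) * U R (k - 1) * U R (m - 1) := by
  rw [sub_eq_add_neg, T_add, T_neg, U_neg_sub_one]
  ring

/-- The Chebyshev polynomials of the first kind as a basis. -/
noncomputable def basisT (F : Type*) [Field F] [NeZero (2 : F)] : Module.Basis ℕ F F[X] :=
  Sequence.basis ⟨fun n => T F n, fun n => by rw [degree_T, Int.natAbs_natCast]⟩
    fun _ => (leadingCoeff_ne_zero.2 (Sequence.ne_zero _ _)).isUnit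

/-- The Chebyshev polynomials of the second kind as a basis. -/
noncomputable def basisU (F : Type*) [Field F] [NeZero (2 : F)] : Module.Basis ℕ F F[X] :=
  Sequence.basis ⟨fun n => U F n, fun n => degree_U_natCast F n⟩
    fun _ => (leadingCoeff_ne_zero.2 (Sequence.ne_zero _ _)).isUnit

lemma basisT_apply (F : Type*) [Field F] [NeZero (2 : F)] (n : ℕ) : basisT F n = T F n :=
  Sequence.basis_eq_self _ _ _

lemma basisU_apply (F : Type*) [Field F] [NeZero (2 : F)] (n : ℕ) : basisU F n = U F n :=
  Sequence.basis_eq_self _ _ _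

end Polynomial.Chebyshev

/-! ### The Onsager algebra in terms of Chebyshev polynomials -/

namespace OnsagerAlgebra

open Polynomial Polynomial.Chebyshev

/-- `A k ↦ (2 T_k, U_{k-1}, 0)` and `G m ↦ (0, 0, U_{m-1})`. -/
noncomputable def toPoly : OnsagerAlgebra →ₗ[ℂ] ℂ[X] × ℂ[X] × ℂ[X] :=
  (Finsupp.linearCombination ℂ (Sum.elim (fun k : ℤ => ((2 * T ℂ k, U ℂ (k - 1), 0) : ℂ[X] × ℂ[X] × ℂ[X]))
    fun m : ℕ+ => (0, 0, U ℂ ((m : ℤ) - 1))) : ((ℤ ⊕ ℕ+) →₀ ℂ) →ₗ[ℂ] ℂ[X] × ℂ[X] × ℂ[X])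

lemma toPoly_A (k : ℤ) : toPoly (A k) = (2 * T ℂ k, U ℂ (k - 1), 0) := by
  unfold toPoly A
  erw [Finsupp.linearCombination_single, one_smul]
  rfl

lemma int_eq_zero_or (m : ℤ) : m = 0 ∨ (∃ n : ℕ, m = n + 1) ∨ ∃ n : ℕ, m = -(n + 1) := by
  rcases lt_trichotomy m 0 with h | h | h
  · exact Or.inr (Or.inr ⟨(-m - 1).toNat, by omega⟩)
  · exact Or.inl h
  · exact Or.inr (Or.inl ⟨(m - 1).toNat, by omega⟩)

lemma G_natCast_add_one (n : ℕ) :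
    G ((n : ℤ) + 1) = (Finsupp.single (Sum.inr n.succPNat) (1 : ℂ) : (ℤ ⊕ ℕ+) →₀ ℂ) := rfl

lemma toPoly_G (m : ℤ) : toPoly (G m) = (0, 0, U ℂ (m - 1)) := by
  have key : ∀ n : ℕ, toPoly (G ((n : ℤ) + 1)) = (0, 0, U ℂ ((n : ℤ) + 1 - 1)) := by
    intro n
    rw [G_natCast_add_one]
    unfold toPoly
    erw [Finsupp.linearCombination_single, one_smul]
    simp
  rcases int_eq_zero_or m with rfl | ⟨n, rfl⟩ | ⟨n, rfl⟩
  · rw [show G 0 = 0 from rfl, map_zero, zero_sub, U_neg_one]; rfl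
  · exact key n
  · rw [G_neg, map_neg, key, U_neg_sub_one]; simp

/-- The inverse of `toPoly`. -/
noncomputable def ofPoly : ℂ[X] × ℂ[X] × ℂ[X] →ₗ[ℂ] OnsagerAlgebra :=
  LinearMap.coprod ((basisT ℂ).constr ℂ fun n => (1 / 4 : ℂ) • (A n + A (-n)))
    (LinearMap.coprod
      ((basisU ℂ).constr ℂ fun n => (1 / 2 : ℂ) • (A ((n : ℤ) + 1) - A (-((n : ℤ) + 1))))
      ((basisU ℂ).constr ℂ fun n => G ((n : ℤ) + 1)))

/-- Replacing `k` by `-k` fixes `T_k` and negates `U_{k-1}`. So `A_k + A_{-k}` maps to `(4T_k, 0,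
0)` and `A_k - A_{-k}` to `(0, 2U_{k-1}, 0)`, whence the factors `1/4` and `1/2`. -/
lemma ofPoly_T (k : ℤ) : ofPoly (T ℂ k, 0, 0) = (1 / 4 : ℂ) • (A k + A (-k)) := by
  have key : ∀ n : ℕ, ofPoly (T ℂ n, 0, 0) = (1 / 4 : ℂ) • (A n + A (-n)) := by
    intro n
    rw [← basisT_apply]
    simp [ofPoly]
  obtain ⟨n, rfl | rfl⟩ := k.eq_nat_or_neg
  · exact key n
  · rw [T_neg, key, neg_neg, add_comm]

lemma ofPoly_U (k : ℤ) : ofPoly (0, U ℂ (k - 1), 0) = (1 / 2 : ℂ) • (A k - A (-k)) := by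
  have key : ∀ n : ℕ, ofPoly (0, U ℂ ((n : ℤ) + 1 - 1), 0) =
      (1 / 2 : ℂ) • (A ((n : ℤ) + 1) - A (-((n : ℤ) + 1))) := by
    intro n
    rw [add_sub_cancel_right, ← basisU_apply]
    simp [ofPoly]
  rcases int_eq_zero_or k with rfl | ⟨n, rfl⟩ | ⟨n, rfl⟩
  · rw [zero_sub, U_neg_one, neg_zero, sub_self, smul_zero]
    exact map_zero ofPoly
  · exact key n
  · rw [U_neg_sub_one, neg_neg, ← neg_sub (A ((n : ℤ) + 1)),
      smul_neg, ← key, ← map_neg]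
    simp

lemma ofPoly_U' (k : ℤ) : ofPoly (0, 0, U ℂ (k - 1)) = G k := by
  have key : ∀ n : ℕ, ofPoly (0, 0, U ℂ ((n : ℤ) + 1 - 1)) = G ((n : ℤ) + 1) := by
    intro n
    rw [add_sub_cancel_right, ← basisU_apply]
    simp [ofPoly]
  rcases int_eq_zero_or k with rfl | ⟨n, rfl⟩ | ⟨n, rfl⟩
  · rw [zero_sub, U_neg_one]
    exact map_zero ofPoly
  · exact key n
  · rw [U_neg_sub_one, G_neg, ← key, ← map_neg]
    simp

lemma ofPoly_toPoly (x : OnsagerAlgebra) : ofPoly (toPoly x) = x := by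
  induction x using induction_basis with
  | h0 => simp
  | hadd x y hx hy => rw [map_add, map_add, hx, hy]
  | hsmul c x hx => rw [map_smul, map_smul, hx]
  | hA k =>
    have : ((2 * T ℂ k, U ℂ (k - 1), 0) : ℂ[X] × ℂ[X] × ℂ[X]) =
        (2 : ℂ) • (T ℂ k, 0, 0) + (0, U ℂ (k - 1), 0) := by
      simp [two_mul, two_smul]
    rw [toPoly_A, this, map_add, map_smul, ofPoly_T, ofPoly_U]
    module
  | hG m => rw [toPoly_G, ofPoly_U']

lemma toPoly_ofPoly (x : ℂ[X] × ℂ[X] × ℂ[X]) : toPoly (ofPoly x) = x := by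
  have h : toPoly ∘ₗ ofPoly = LinearMap.id := by
    refine LinearMap.prod_ext ((basisT ℂ).ext fun n => ?_)
      (LinearMap.prod_ext ((basisU ℂ).ext fun n => ?_) ((basisU ℂ).ext fun n => ?_))
    · have := ofPoly_T n
      simp only [LinearMap.comp_apply, LinearMap.inl_apply, LinearMap.id_apply, basisT_apply]
      change toPoly (ofPoly (T ℂ n, 0, 0)) = (T ℂ n, 0, 0)
      rw [this, map_smul, map_add, toPoly_A, toPoly_A, T_neg, U_neg_sub_one]
      ext : 1
      · rw [Prod.smul_fst, Prod.fst_add, show 2 * T ℂ n + 2 * T ℂ n = (4 : ℂ) • T ℂ n by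
          rw [Algebra.smul_def, map_ofNat]; ring, smul_smul]
        norm_num
      · simp
    · have := ofPoly_U (n + 1)
      simp only [LinearMap.comp_apply, LinearMap.inl_apply, LinearMap.inr_apply, LinearMap.id_apply,
        basisU_apply]
      rw [add_sub_cancel_right] at this
      rw [this, map_smul, map_sub, toPoly_A, toPoly_A, T_neg, U_neg_sub_one, add_sub_cancel_right]
      ext : 1
      · simp
      · simp only [Prod.smul_mk, Prod.mk_sub_mk, sub_self, smul_zero, Prod.mk.injEq, and_true]
        module
    · have := ofPoly_U' (n + 1)
      simp only [LinearMap.comp_apply, LinearMap.inr_apply, LinearMap.id_apply, basisU_apply]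
      rw [add_sub_cancel_right] at this
      rw [this, toPoly_G, add_sub_cancel_right]
  exact LinearMap.congr_fun h x

variable {O C : Type*} [CommRing O] [Algebra ℂ O] [LieRing C] [LieAlgebra O C] [LieAlgebra ℂ C]
  [IsScalarTower ℂ O C]

/-- The combinations of `H`, `X`, `Y` with coefficients polynomials in `t`. -/
noncomputable def combination (t : O) (H X Y : C) : ℂ[X] × ℂ[X] × ℂ[X] →ₗ[ℂ] C where
  toFun x := aeval t x.1 • H + aeval t x.2.1 • X + aeval t x.2.2 • Y
  map_add' x y := by
    simp only [Prod.fst_add, Prod.snd_add, map_add]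
    module
  map_smul' c x := by
    simp only [Prod.smul_fst, Prod.smul_snd, map_smul, smul_assoc, RingHom.id_apply, smul_add]

lemma combination_apply (t : O) (H X Y : C) (p q r : ℂ[X]) :
    combination t H X Y (p, q, r) = aeval t p • H + aeval t q • X + aeval t r • Y := rfl

lemma lie_combination {t : O} {H X Y : C} (hHX : ⁅H, X⁆ = (-2 : O) • Y)
    (hHY : ⁅H, Y⁆ = (-2 : O) • X) (hXY : ⁅X, Y⁆ = (-8 * (t ^ 2 - 1)) • H) (p q r p' q' r' : ℂ[X]) :
    ⁅combination t H X Y (p, q, r), combination t H X Y (p', q', r')⁆ =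
      combination t H X Y (-8 * (Polynomial.X ^ 2 - 1) * (q * r' - r * q'), -2 * (p * r' - r * p'),
        -2 * (p * q' - q * p')) := by
  have hXH : ⁅X, H⁆ = -((-2 : O) • Y) := by rw [← lie_skew, hHX]
  have hYH : ⁅Y, H⁆ = -((-2 : O) • X) := by rw [← lie_skew, hHY]
  have hYX : ⁅Y, X⁆ = -((-8 * (t ^ 2 - 1)) • H) := by rw [← lie_skew, hXY]
  simp only [combination_apply, lie_add, add_lie, lie_smul, smul_lie, lie_self, hHX, hHY, hXY, hXH,
    hYH, hYX, map_mul, map_sub, map_neg, map_ofNat, map_pow, aeval_X, map_one]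
  module

/-- On basis vectors the three components of the bracket are the formulas for `T_{k-m} - T_{k+m}`,
`U_{k-m-1} - U_{k+m-1}` and `U_{k-l-1}`. -/
lemma combination_toPoly_lie {t : O} {H X Y : C} (hHX : ⁅H, X⁆ = (-2 : O) • Y)
    (hHY : ⁅H, Y⁆ = (-2 : O) • X) (hXY : ⁅X, Y⁆ = (-8 * (t ^ 2 - 1)) • H) (x y : OnsagerAlgebra) :
    combination t H X Y (toPoly (bracketBilin x y)) =
      ⁅combination t H X Y (toPoly x), combination t H X Y (toPoly y)⁆ := by
  have key := lie_combination hHX hHY hXY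
  have hAG : ∀ k m, combination t H X Y (toPoly (bracketBilin (A k) (G m))) =
      ⁅combination t H X Y (toPoly (A k)), combination t H X Y (toPoly (G m))⁆ := by
    intro k m
    rw [bracket_A_G, map_smul, map_sub, toPoly_A, toPoly_A, toPoly_A, toPoly_G, key, T_add, T_sub,
      U_sub_sub_one, U_add_sub_one]
    simp only [Prod.smul_mk, Prod.mk_sub_mk]
    simp only [Algebra.smul_def, map_ofNat]
    refine congrArg _ (Prod.mk_inj.2 ⟨?_, Prod.mk_inj.2 ⟨?_, ?_⟩⟩) <;> ring
  induction x using induction_basis with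
  | h0 => simp
  | hadd x x' h h' => simp only [map_add, LinearMap.add_apply, h, h', add_lie]
  | hsmul c x h => simp only [map_smul, LinearMap.smul_apply, h, smul_lie]
  | hA k =>
    induction y using induction_basis with
    | h0 => simp
    | hadd x x' h h' => simp only [map_add, h, h', lie_add]
    | hsmul c x h => simp only [map_smul, h, lie_smul]
    | hA l =>
      rw [bracket_A_A, map_smul, toPoly_A, toPoly_A, toPoly_G, key, U_sub_sub_one]
      simp only [Prod.smul_mk]
      simp only [Algebra.smul_def, map_ofNat]
      refine congrArg _ (Prod.mk_inj.2 ⟨?_, Prod.mk_inj.2 ⟨?_, ?_⟩⟩) <;> ring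
    | hG m => exact hAG k m
  | hG m =>
    induction y using induction_basis with
    | h0 => simp
    | hadd x x' h h' => simp only [map_add, h, h', lie_add]
    | hsmul c x h => simp only [map_smul, h, lie_smul]
    | hA l => rw [bracket_skew, map_neg, map_neg, hAG, lie_skew]
    | hG n =>
      rw [bracket_G_G, toPoly_G, toPoly_G, key]
      simp only [mul_zero, zero_mul, sub_self]
      rw [map_zero, map_zero]
      exact (map_zero (combination t H X Y)).symm

/-- A Lie algebra which is free over the polynomials in `t` on `H`, `X`, `Y` with
`[H, X] = -2 Y`, `[H, Y] = -2 X` and `[X, Y] = -8 (t ^ 2 - 1) H` is the Onsager algebra. -/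
theorem nonempty_lieEquiv {t : O} {H X Y : C} (hHX : ⁅H, X⁆ = (-2 : O) • Y)
    (hHY : ⁅H, Y⁆ = (-2 : O) • X) (hXY : ⁅X, Y⁆ = (-8 * (t ^ 2 - 1)) • H)
    (hinj : Function.Injective (combination t H X Y)) (K : LieSubalgebra ℂ C)
    (hK : ∀ a, a ∈ K ↔ ∃ x, combination t H X Y x = a) : Nonempty (K ≃ₗ⁅ℂ⁆ OnsagerAlgebra) := by
  let F : OnsagerAlgebra →ₗ⁅ℂ⁆ K :=
    { toLinearMap := (combination t H X Y ∘ₗ toPoly).codRestrict K.toSubmodule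
        fun x => (hK _).2 ⟨toPoly x, rfl⟩
      map_lie' := fun {x y} => Subtype.ext (combination_toPoly_lie hHX hHY hXY x y) }
  have hF : ∀ x, (F x).1 = combination t H X Y (toPoly x) := fun _ => rfl
  refine ⟨(LieEquiv.ofBijective F ⟨fun x y hxy => ?_, fun a => ?_⟩).symm⟩
  · have := hinj (congrArg Subtype.val hxy)
    rw [← ofPoly_toPoly x, ← ofPoly_toPoly y]
    exact congrArg ofPoly this
  · obtain ⟨x, hx⟩ := (hK a.1).1 a.2
    exact ⟨ofPoly x, Subtype.ext (by rw [hF, toPoly_ofPoly, hx])⟩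

end OnsagerAlgebra

/-! ### From a normal form to the Onsager algebra. -/

namespace OnsagerAlgebra

open Polynomial

variable {O C : Type*} [CommRing O] [Algebra ℂ O] [LieRing C] [LieAlgebra O C] [LieAlgebra ℂ C]
  [IsScalarTower ℂ O C]

/-- A Lie algebra with a normal form over the polynomials in `s`, in which the bracket of the two
root vectors is `(s ^ 2 - c ^ 2) / 4` for some `c ≠ 0`, is the Onsager algebra. -/
theorem nonempty_lieEquiv_of_normalForm {s : O} {E F H : C} {c : ℂ} (hc : c ≠ 0)
    (hs : ∀ q : ℂ[X], aeval s q = 0 → q = 0)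
    (hind : ∀ p q r : ℂ[X], aeval s p • E + aeval s q • F + aeval s r • H = 0 →
      aeval s p = 0 ∧ aeval s q = 0 ∧ aeval s r = 0)
    (hHE : ⁅H, E⁆ = (2 : O) • E) (hHF : ⁅H, F⁆ = (-2 : O) • F)
    (hEF : ⁅E, F⁆ = (algebraMap ℂ O (1 / 4) * (s ^ 2 - algebraMap ℂ O c ^ 2)) • H)
    (K : LieSubalgebra ℂ C)
    (hK : ∀ a, a ∈ K ↔ ∃ p q r : ℂ[X], aeval s p • E + aeval s q • F + aeval s r • H = a) :
    Nonempty (K ≃ₗ⁅ℂ⁆ OnsagerAlgebra) := by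
  set d := algebraMap ℂ O c⁻¹ with hd
  have hdc : d * algebraMap ℂ O c = 1 := by rw [hd, ← map_mul, inv_mul_cancel₀ hc, map_one]
  have hq : 4 * algebraMap ℂ O (1 / 4) = 1 := by
    rw [← map_ofNat (algebraMap ℂ O) 4, ← map_mul]; norm_num
  -- With `X = E + βF` and `Y = -E + βF` one gets `[X, Y] = 2β(s² - c²)/4 · H`; this is `-8(t² -
  -- 1)H` for `t = s/c` exactly when `β = -16/c²`.
  set β := -16 * d ^ 2 with hβ
  have hβ' : β * (-algebraMap ℂ O (1 / 4) ^ 2 * algebraMap ℂ O c ^ 2) = 1 := by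
    rw [hβ]
    linear_combination (d * algebraMap ℂ O c) ^ 2 * (4 * algebraMap ℂ O (1 / 4) + 1) * hq +
      (d * algebraMap ℂ O c + 1) * hdc
  have hβC : aeval s (Polynomial.C (-16 * c⁻¹ ^ 2)) = β := by
    rw [aeval_C, map_mul, map_pow, map_neg, map_ofNat]
  have hto : ∀ p : ℂ[X], aeval (d * s) p = aeval s (p.comp (Polynomial.C c⁻¹ * X)) := fun p => by
    rw [aeval_comp, map_mul, aeval_C, aeval_X]
  have hfrom : ∀ p : ℂ[X], aeval (d * s) (p.comp (Polynomial.C c * X)) = aeval s p := fun p => by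
    rw [aeval_comp, map_mul, aeval_C, aeval_X, ← mul_assoc, mul_comm (algebraMap ℂ O c), hdc, one_mul]
  have hcomp : ∀ p : ℂ[X], aeval (d * s) p = 0 → p = 0 := by
    intro p hp
    rw [hto] at hp
    have h1 := congrArg (fun q => q.comp (Polynomial.C c * X)) (hs _ hp)
    simp only [comp_assoc, mul_comp, C_comp, X_comp, zero_comp] at h1
    rwa [← mul_assoc, ← map_mul, inv_mul_cancel₀ hc, map_one, one_mul, comp_X] at h1
  have hFE : ⁅F, E⁆ = -((algebraMap ℂ O (1 / 4) * (s ^ 2 - algebraMap ℂ O c ^ 2)) • H) := by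
    rw [← lie_skew, hEF]
  refine nonempty_lieEquiv (t := d * s) (H := H) (X := E + β • F) (Y := -E + β • F) ?_ ?_ ?_ ?_ K ?_
  · rw [lie_add, lie_smul, hHE, hHF]; module
  · rw [lie_add, lie_neg, lie_smul, hHE, hHF]; module
  · simp only [lie_add, add_lie, lie_neg, lie_smul, smul_lie, lie_self, hEF, hFE]
    match_scalars
    rw [hβ]
    linear_combination -8 * (d ^ 2 * s ^ 2 - (d * algebraMap ℂ O c) ^ 2) * hq +
      8 * (d * algebraMap ℂ O c + 1) * hdc
  · rw [injective_iff_map_eq_zero]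
    rintro ⟨p, q, r⟩ h0
    rw [combination_apply, hto, hto, hto, ← hβC] at h0
    obtain ⟨k0, k1, k2⟩ := hind ((q - r).comp (Polynomial.C c⁻¹ * X))
      (Polynomial.C (-16 * c⁻¹ ^ 2) * (q + r).comp (Polynomial.C c⁻¹ * X))
      (p.comp (Polynomial.C c⁻¹ * X)) (by
        rw [← h0, sub_comp, add_comp, map_sub, map_mul, map_add]; module)
    rw [← hto] at k0 k2
    rw [map_mul, ← hto, hβC] at k1
    have k1' : aeval (d * s) (q + r) = 0 := by
      linear_combination (-algebraMap ℂ O (1 / 4) ^ 2 * algebraMap ℂ O c ^ 2) * k1 -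
        aeval (d * s) (q + r) * hβ'
    have e0 := hcomp _ k0
    have e1 := hcomp _ k1'
    have e2 := hcomp _ k2
    have e3 : (2 : ℂ[X]) * q = 0 := by linear_combination e0 + e1
    have e4 : q = 0 := (mul_eq_zero.1 e3).resolve_left two_ne_zero
    rw [e4, zero_add] at e1
    rw [e2, e4, e1]
    rfl
  · intro a
    rw [hK]
    constructor
    · rintro ⟨p, q, r, rfl⟩
      -- `v` is the inverse of `β`, and the coefficients below come from `E = (X - Y)/2`, `F = v(X +
      -- Y)/2`.
      set v := -algebraMap ℂ O (1 / 4) ^ 2 * algebraMap ℂ O c ^ 2 with hv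
      obtain ⟨ν, hν⟩ : ∃ ν : ℂ[X], aeval (d * s) ν = v :=
        ⟨Polynomial.C (-(1 / 4) ^ 2 * c ^ 2), by rw [aeval_C, map_mul, map_pow, map_neg, map_pow]⟩
      obtain ⟨τ, hτ⟩ : ∃ τ : ℂ[X], 2 * aeval (d * s) τ = 1 :=
        ⟨Polynomial.C (1 / 2), by
          rw [aeval_C, ← map_ofNat (algebraMap ℂ O) 2, ← map_mul]; norm_num⟩
      refine ⟨(r.comp (Polynomial.C c * X),
        τ * (p.comp (Polynomial.C c * X) + ν * q.comp (Polynomial.C c * X)),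
        τ * (-p.comp (Polynomial.C c * X) + ν * q.comp (Polynomial.C c * X))), ?_⟩
      rw [combination_apply]
      simp only [map_mul, map_add, map_neg, hfrom, hν]
      match_scalars
      · ring
      · linear_combination aeval s p * hτ
      · linear_combination β * v * aeval s q * hτ + aeval s q * hβ'
    · rintro ⟨⟨p, q, r⟩, rfl⟩
      refine ⟨(q - r).comp (Polynomial.C c⁻¹ * X),
        Polynomial.C (-16 * c⁻¹ ^ 2) * (q + r).comp (Polynomial.C c⁻¹ * X),
        p.comp (Polynomial.C c⁻¹ * X), ?_⟩
      rw [combination_apply, map_mul, ← hto, ← hto, ← hto, hβC, map_sub, map_add]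
      module

end OnsagerAlgebra

section AdjoinSingleton

open Polynomial

variable {A M : Type*} [CommRing A] [Algebra ℂ A] [AddCommGroup M] [Module A M] {s : A} {x y z a : M}

lemma mem_span_adjoin_triple : a ∈ Submodule.span (Algebra.adjoin ℂ {s}) {x, y, z} ↔
    ∃ p q r : ℂ[X], aeval s p • x + aeval s q • y + aeval s r • z = a := by
  rw [Submodule.mem_span_triple]
  constructor
  · rintro ⟨p, q, r, rfl⟩
    obtain ⟨p', hp⟩ := (Algebra.adjoin_singleton_eq_range_aeval ℂ s).le p.2
    obtain ⟨q', hq⟩ := (Algebra.adjoin_singleton_eq_range_aeval ℂ s).le q.2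
    obtain ⟨r', hr⟩ := (Algebra.adjoin_singleton_eq_range_aeval ℂ s).le r.2
    exact ⟨p', q', r', congrArg₂ _ (congrArg₂ _ (congrArg (· • x) hp) (congrArg (· • y) hq))
      (congrArg (· • z) hr)⟩
  · rintro ⟨p, q, r, rfl⟩
    exact ⟨⟨_, aeval_mem_adjoin_singleton ℂ s⟩, ⟨_, aeval_mem_adjoin_singleton ℂ s⟩,
      ⟨_, aeval_mem_adjoin_singleton ℂ s⟩, rfl⟩

lemma LinearIndependent.aeval_eq_zero (hli : LinearIndependent (Algebra.adjoin ℂ {s}) ![x, y, z])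
    {p q r : ℂ[X]} (h0 : aeval s p • x + aeval s q • y + aeval s r • z = 0) :
    aeval s p = 0 ∧ aeval s q = 0 ∧ aeval s r = 0 := by
  have := Fintype.linearIndependent_iff.1 hli
    (![⟨_, aeval_mem_adjoin_singleton ℂ s⟩, ⟨_, aeval_mem_adjoin_singleton ℂ s⟩,
      ⟨_, aeval_mem_adjoin_singleton ℂ s⟩] : Fin 3 → Algebra.adjoin ℂ {s})
    (by rw [Fin.sum_univ_three]; exact h0)
  exact ⟨congrArg Subtype.val (this 0), congrArg Subtype.val (this 1),
    congrArg Subtype.val (this 2)⟩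

end AdjoinSingleton

/-! ### The isomorphism with the Onsager algebra, and the theorem. -/

namespace IsEquivariantTriple

variable {L : PeriodPair} {u : ℂ} {σ : alternatingGroup (Fin 4) →* TorusAut L}
  {ρ : alternatingGroup (Fin 4) →* Sl2Aut} {γ₀ γ₁ γ₂ : alternatingGroup (Fin 4)}
  {P P' p₀ p₁ p₂ : RegularFunctions L (zeroOrbit σ)} {e f h : CurrentAlgebra L (zeroOrbit σ)}

set_option maxHeartbeats 1000000 in
theorem nonempty_lieEquiv_onsagerAlgebra (ht : IsEquivariantTriple ρ σ γ₀ γ₁ γ₂ e f h)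
    (hp : IsFunctionFrame L u σ P P' p₀ p₁ p₂) (hσ : IsA4Frame L u σ γ₀ γ₁ γ₂) :
    Nonempty (automorphicLieAlgebra ρ σ (zeroOrbit_invariant σ) ≃ₗ⁅ℂ⁆ OnsagerAlgebra) := by
  -- `c² = -g₃` puts `℘³ = (℘'² + g₃)/4` in the form `(s² - c²)/4` with `s = ℘'`; `g₃` is four times
  -- the cube of a nonzero half-period value.
  obtain ⟨c, hc⟩ := IsAlgClosed.exists_pow_nat_eq (-(halfPair L).g₃) two_pos
  have hc0 : c ≠ 0 := by
    rintro rfl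
    have h0 : (halfPair L).g₃ = 0 := by simpa using hc.symm
    rw [hσ.hex.half.g₃_eq] at h0
    exact mul_ne_zero (by norm_num) (pow_ne_zero 3 hσ.hex.half.weierstrassP_half_ne_zero) h0
  obtain ⟨hli, hm, -, -, -, -⟩ := ht.isNormalForm hp hσ
  obtain ⟨l1, l2, l3⟩ := ht.lie_smul_smul P (P ^ 2)
  refine OnsagerAlgebra.nonempty_lieEquiv_of_normalForm (s := P') (E := P • e) (F := P ^ 2 • f)
    (H := h) hc0 (fun q => hp.aeval_eq_zero hσ) (fun p q r => hli.aeval_eq_zero) l1 l2 ?_ _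
    fun a => (hm a).trans mem_span_adjoin_triple
  rw [l3, ← pow_succ', hp.pow_three_eq hσ, Algebra.smul_def, ← map_pow, hc, map_neg, sub_neg_eq_add]

end IsEquivariantTriple

theorem mainTheorem6 (L : PeriodPair) (hL : AreBiholomorphic L hexagonal)
    (ρ : alternatingGroup (Fin 4) →* Sl2Aut) (σ : alternatingGroup (Fin 4) →* TorusAut L)
    (hρ : Function.Injective ρ) (hσ : Function.Injective σ)
    (hfix : ∃ γ, γ ≠ 1 ∧ (σ γ).1 0 = 0) :
    Nonempty (automorphicLieAlgebra ρ σ (zeroOrbit_invariant σ) ≃ₗ⁅ℂ⁆ OnsagerAlgebra) ∧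
    (∃ u, IsHexagonalPeriod L u) ∧
    ∀ u, IsHexagonalPeriod L u →
      ∃ (P P' p₀ p₁ p₂ : RegularFunctions L (zeroOrbit σ)) (θ : Sl2Aut),
        IsGivenBy P (halfPair L).weierstrassP ∧
        IsGivenBy P' (halfPair L).derivWeierstrassP ∧
        IsGivenBy p₀ (pZero L u) ∧ IsGivenBy p₁ (pOne L u) ∧ IsGivenBy p₂ (pTwo L u) ∧
        ∃ h' e' f' : CurrentAlgebra L (zeroOrbit σ),
          h' = -psiH θ (kappa L u) p₀ p₁ p₂ ∧
          e' = -psiF θ (kappa L u) p₀ p₁ p₂ ∧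
          f' = -psiE θ p₀ p₁ p₂ ∧
          invariantFunctions (σ.comp (alternatingGroup.kleinFour (Fin 4)).subtype)
            (fun γ => zeroOrbit_invariant σ γ.1) = Algebra.adjoin ℂ {P, P'} ∧
          IsNormalForm
            (automorphicLieAlgebra (ρ.comp (alternatingGroup.kleinFour (Fin 4)).subtype)
              (σ.comp (alternatingGroup.kleinFour (Fin 4)).subtype)
              (fun γ => zeroOrbit_invariant σ γ.1))
            (Algebra.adjoin ℂ {P, P'}) e' f' h' 1 ∧
          invariantFunctions σ (zeroOrbit_invariant σ) = Algebra.adjoin ℂ {P'} ∧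
          IsNormalForm (automorphicLieAlgebra ρ σ (zeroOrbit_invariant σ))
            (Algebra.adjoin ℂ {P'}) (P • e') (P ^ 2 • f') h' (P ^ 3) := by
  have hu := hL.exists_isHexagonalPeriod
  have key : ∀ u, IsHexagonalPeriod L u → ∃ γ₀ γ₁ γ₂ P P' p₀ p₁ p₂ θ,
      IsA4Frame L u σ γ₀ γ₁ γ₂ ∧ IsFunctionFrame L u σ P P' p₀ p₁ p₂ ∧
      IsEquivariantTriple ρ σ γ₀ γ₁ γ₂ (-psiF θ (kappa L u) p₀ p₁ p₂) (-psiE θ p₀ p₁ p₂)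
        (-psiH θ (kappa L u) p₀ p₁ p₂) := by
    intro u hu
    obtain ⟨γ₀, γ₁, γ₂, h⟩ := hu.exists_isA4Frame hσ hfix
    obtain ⟨P, P', p₀, p₁, p₂, hp⟩ := h.exists_isFunctionFrame
    obtain ⟨Y, θ, hY⟩ := h.exists_isSl2Frame hσ hρ
    exact ⟨γ₀, γ₁, γ₂, P, P', p₀, p₁, p₂, θ, h, hp, hp.isEquivariantTriple h hY⟩
  refine ⟨?_, hu, fun u hu => ?_⟩
  · obtain ⟨u, hu⟩ := hu
    obtain ⟨γ₀, γ₁, γ₂, P, P', p₀, p₁, p₂, θ, h, hp, ht⟩ := key u hu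
    exact ht.nonempty_lieEquiv_onsagerAlgebra hp h
  · obtain ⟨γ₀, γ₁, γ₂, P, P', p₀, p₁, p₂, θ, h, hp, ht⟩ := key u hu
    exact ⟨P, P', p₀, p₁, p₂, θ, hp.givenP, hp.givenP', hp.given₀, hp.given₁, hp.given₂, _, _, _,
      rfl, rfl, rfl, hp.kleinFour_invariants h, ht.isNormalForm_kleinFour hp h,
      hp.invariantFunctions_eq h, ht.isNormalForm hp h⟩
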